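/- **Setup.** Units with $\hbar=1$. Let $N$ be odd, $L,m_{\rm h},m_{\rm i}>0$. Consider $N$ spinless fermions with coordinates $x_1,\dots,x_N$ and one impurity with coordinate $x_{\rm i}$ on a ring of circumference $L$; the Hilbert space consists of the $L^2$ wave functions on the $(N+1)$-fold product of the ring that are antisymmetric in $x_1,\dots,x_N$. Put $k_{\rm F}=\frac{2\pi}{L}\frac{N-1}{2}$ and $q_0=\min\{k_{\rm F},\frac{m_{\rm i}}{m_{\rm h}}k_{\rm F}\}$. The interaction potential $U$ is a real potential on the ring with finite total weight, i.e. a finite signed Borel measure: an integrable function $U(x)$ stands for $U(x)\,dx$, and a contact potential $g\,\delta(x)$ is allowed; $\overline U=\int U(x)\,dx$ is its total mass. The Hamiltonian is $$H=H^0+V,\qquad H^0=\sum_{n=1}^N\frac{\hat p_n^2}{2m_{\rm h}}-C+\frac{\hat p_{\rm i}^2}{2m_{\rm i}},\qquad V=\sum_{n=1}^N U(x_n-x_{\rm i}),\qquad C=\frac{k_{\rm F}^2}{6m_{\rm h}}\frac{N(N+1)}{N-1},$$ with periodic boundary conditions, understood as the operator associated with the quadratic form of $H^0+V$ on the states of finite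 kinetic energy (with the continuous density of $x_n-x_{\rm i}$ used to evaluate $V$). Let $|{\rm FS}\rangle$ be the normalized Slater determinant of the plane waves with momenta $-k_{\rm F},-k_{\rm F}+\frac{2\pi}{L},\dots,k_{\rm F}$, let $p_0\in\frac{2\pi}{L}\mathbb Z$, let $|p_0\rangle$ be the normalized impurity plane wave of momentum $p_0$, and $|{\rm FS},p_0\rangle=|{\rm FS}\rangle\otimes|p_0\rangle$. **Theorem.** Let $0<p_0<q_0$ and assume that every eigenvalue of $H$ in the subspace of total momentum $p_0$ is nondegenerate there. Then the unitary group $e^{-iHt}$ generated by $H$ exists and is unique, the infinite-time momentum of the impurity $$p_\infty=\lim_{t\to\infty}\frac1t\int_0^t\langle{\rm FS},p_0|e^{iHt'}\hat p_{\rm i}e^{-iHt'}|{\rm FS},p_0\rangle\,dt'$$ is well defined (the expectation values, the integrals and the limit exist), and $$p_\infty\ \ge\ p_0-\frac{m_{\rm i}}{q_0-p_0}\Bigl(\langle{\rm FS},p_0|V|{\rm FS},p_0\rangle-\sum_E|\langle{\rm FS},p_0|\Psi_E\rangle|^2\langle\Psi_E|V|\Psi_E\rangle\Bigr),$$ where $E$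 runs over the eigenvalues of $H$ in the subspace of total momentum $p_0$, $\Psi_E$ is a normalized eigenvector for $E$ in this subspace, and the sum converges absolutely. If moreover $U\ge0$ everywhere, then $$p_\infty\ \ge\ p_0-\frac{m_{\rm i}k_{\rm F}\overline U}{\pi(q_0-p_0)}\,\frac{N}{N-1}.$$ -/

import Mathlib

open MeasureTheory Filter Topology
open scoped ComplexConjugate

noncomputable section

namespace ImpurityGas

/-- Configurations of `N` host particles (first component) and one impurity (second component) on a
ring of circumference `L`. -/
abbrev Config (N : ℕ) (L : ℝ) : Type := (Fin N → AddCircle L) × AddCircle L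

/-- Plane-wave labels: integers `(k, l)` stand for host momenta `(2π/L) k n` and impurity momentum
`(2π/L) l` (units with `ħ = 1`). -/
abbrev Mode (N : ℕ) : Type := (Fin N → ℤ) × ℤ

/-- The momentum `2πj/L` on the ring. -/
def ringMomentum (L : ℝ) (j : ℤ) : ℝ := 2 * Real.pi / L * j

/-- Fermi momentum `k_F = (2π/L)(N-1)/2`. -/
def fermiMomentum (N : ℕ) (L : ℝ) : ℝ := 2 * Real.pi / L * (((N : ℝ) - 1) / 2)

/-- `q₀ = min {k_F, (m_i/m_h) k_F}`. -/
def criticalMomentum (N : ℕ) (L mh mi : ℝ) : ℝ :=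
  min (fermiMomentum N L) (mi / mh * fermiMomentum N L)

/-- The constant `C = k_F² N (N+1) / (6 m_h (N-1))` subtracted from the host kinetic energy. -/
def hostShift (N : ℕ) (L mh : ℝ) : ℝ :=
  fermiMomentum N L ^ 2 / (6 * mh) * ((N : ℝ) * ((N : ℝ) + 1) / ((N : ℝ) - 1))

/-- Eigenvalue of `H⁰ = ∑ p̂ₙ²/(2m_h) - C + p̂ᵢ²/(2m_i)` on a plane wave. -/
def kineticEnergy {N : ℕ} (L mh mi : ℝ) (q : Mode N) : ℝ :=
  (∑ n, ringMomentum L (q.1 n) ^ 2 / (2 * mh) - hostShift N L mh)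
    + ringMomentum L q.2 ^ 2 / (2 * mi)

variable {N : ℕ} {L : ℝ} [Fact (0 < L)]

/-- Square-integrable wave functions `ψ(x₁, …, x_N; xᵢ)` (no symmetry imposed yet). -/
abbrev WaveFn (N : ℕ) (L : ℝ) [Fact (0 < L)] : Type :=
  Lp ℂ 2 (volume : Measure (Config N L))

/-- Normalized plane wave
`L^{-(N+1)/2} exp((2πi/L)(∑ₙ k n xₙ + l xᵢ))`, as a continuous function. -/
def planeWaveFun (q : Mode N) : C(Config N L, ℂ) where
  toFun x := ((Real.sqrt (L ^ (N + 1)))⁻¹ : ℝ) *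
    ((∏ n, fourier (q.1 n) (x.1 n)) * fourier q.2 x.2)
  continuous_toFun := by fun_prop

/-- Normalized plane wave as an element of `L²`. -/
def planeWave (q : Mode N) : WaveFn N L :=
  ContinuousMap.toLp 2 volume ℂ (planeWaveFun q)

/-- Momentum-space amplitude `⟨k, l | ψ⟩`. -/
def amplitude (ψ : WaveFn N L) (q : Mode N) : ℂ := inner ℂ (planeWave q) ψ

/-! ### Fermionic statistics -/

/-- Relabelling of the host particles. -/
def permuteConfig (σ : Equiv.Perm (Fin N)) (x : Config N L) : Config N L :=
  (fun n => x.1 (σ n), x.2)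

theorem measurePreserving_permuteConfig (σ : Equiv.Perm (Fin N)) :
    MeasurePreserving (permuteConfig (L := L) σ) volume volume := by
  have h := volume_measurePreserving_piCongrLeft (fun _ : Fin N => AddCircle L) σ.symm
  have h2 := h.prod (MeasurePreserving.id (volume : Measure (AddCircle L)))
  have e : permuteConfig (L := L) σ = Prod.map
      (MeasurableEquiv.piCongrLeft (fun _ : Fin N => AddCircle L) σ.symm) id := by
    funext x
    refine Prod.ext (funext fun n => ?_) rfl
    have := MeasurableEquiv.piCongrLeft_apply_apply (β := fun _ : Fin N => AddCircle L)
      σ.symm x.1 (σ n)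
    simpa [permuteConfig] using this.symm
  rw [e]
  exact h2

/-- The operator `(σψ)(x₁, …, x_N; xᵢ) = ψ(x_{σ 1}, …, x_{σ N}; xᵢ)`. -/
def permuteWave (σ : Equiv.Perm (Fin N)) : WaveFn N L →ₗ[ℂ] WaveFn N L :=
  Lp.compMeasurePreservingₗ ℂ (permuteConfig σ) (measurePreserving_permuteConfig σ)

/-- The Hilbert space of `N` spinless fermions plus one impurity: wave functions that are
antisymmetric in the host coordinates. -/
def FermiSpace (N : ℕ) (L : ℝ) [Fact (0 < L)] : Submodule ℂ (WaveFn N L) where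
  carrier := {ψ | ∀ σ : Equiv.Perm (Fin N),
    permuteWave σ ψ = ((Equiv.Perm.sign σ : ℤ) : ℂ) • ψ}
  add_mem' := fun ha hb σ => by rw [map_add, ha σ, hb σ, smul_add]
  zero_mem' := fun σ => by simp
  smul_mem' := fun c ψ h σ => by rw [map_smul, h σ, smul_comm]

/-- Host momenta of the Fermi sea (for odd `N`): `-(N-1)/2, …, (N-1)/2` in units of `2π/L`. -/
def fermiSeaModes (N : ℕ) (n : Fin N) : ℤ := (n : ℤ) - ((N : ℤ) - 1) / 2

/-- The state `|FS⟩ ⊗ |p₀⟩`, `p₀ = 2πj/L`: normalized Slater determinant of the Fermi-sea plane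
waves times the impurity plane wave. -/
def fermiSeaWave (N : ℕ) (L : ℝ) [Fact (0 < L)] (j : ℤ) : WaveFn N L :=
  ((Real.sqrt (N.factorial : ℝ))⁻¹ : ℂ) •
    ∑ σ : Equiv.Perm (Fin N), ((Equiv.Perm.sign σ : ℤ) : ℂ) •
      planeWave (fun n => fermiSeaModes N (σ n), j)

theorem permuteWave_planeWave (σ : Equiv.Perm (Fin N)) (q : Mode N) :
    permuteWave σ (planeWave (L := L) q) = planeWave (fun n => q.1 (σ.symm n), q.2) := by
  apply Lp.ext
  have h1 : permuteWave σ (planeWave (L := L) q) =ᵐ[volume]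
      (planeWave (L := L) q) ∘ permuteConfig σ :=
    Lp.coeFn_compMeasurePreserving _ (measurePreserving_permuteConfig σ)
  have h2 : (planeWave (L := L) q) =ᵐ[volume] planeWaveFun q :=
    ContinuousMap.coeFn_toLp _ _
  have h3 : (planeWave (L := L) (fun n => q.1 (σ.symm n), q.2)) =ᵐ[volume]
      planeWaveFun (fun n => q.1 (σ.symm n), q.2) :=
    ContinuousMap.coeFn_toLp _ _
  have h4 := (measurePreserving_permuteConfig (L := L) σ).quasiMeasurePreserving.ae_eq_comp h2
  filter_upwards [h1, h3, h4] with x hx1 hx3 hx4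
  rw [hx1, hx3, hx4]
  simp only [Function.comp_apply, planeWaveFun, ContinuousMap.coe_mk, permuteConfig]
  congr 2
  refine Fintype.prod_equiv σ _ _ fun n => ?_
  simp

theorem fermiSeaWave_mem (N : ℕ) (L : ℝ) [Fact (0 < L)] (j : ℤ) :
    fermiSeaWave N L j ∈ FermiSpace N L := by
  intro τ
  unfold fermiSeaWave
  rw [map_smul, map_sum, smul_comm]
  congr 1
  rw [Finset.smul_sum]
  refine Fintype.sum_equiv (Equiv.mulRight τ⁻¹) _ _ fun σ => ?_
  rw [map_smul, permuteWave_planeWave, smul_smul]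
  congr 1
  · have h : ((Equiv.Perm.sign τ : ℤ) : ℂ) * ((Equiv.Perm.sign τ : ℤ) : ℂ) = 1 := by
      rw [← Int.cast_mul, ← Units.val_mul, Int.units_mul_self]; simp
    simp only [Equiv.coe_mulRight, Equiv.Perm.sign_mul, Equiv.Perm.sign_inv, Units.val_mul,
      Int.cast_mul]
    linear_combination (-((Equiv.Perm.sign σ : ℤ) : ℂ)) * h

/-- The initial state `|FS, p₀⟩` with `p₀ = 2πj/L`. -/
def initialState (N : ℕ) (L : ℝ) [Fact (0 < L)] (j : ℤ) : FermiSpace N L :=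
  ⟨fermiSeaWave N L j, fermiSeaWave_mem N L j⟩

/-! ### The interaction

The potential `U` is a finite signed Borel measure on the ring: an integrable function `u` is the
measure `u(x) dx`, the contact potential `g δ(x)` is `g` times the Dirac mass at `0`. -/

/-- `∫ f dU` for a signed measure `U`. -/
def signedIntegral (U : SignedMeasure (AddCircle L)) (f : AddCircle L → ℂ) : ℂ :=
  ∫ y, f y ∂U.toJordanDecomposition.posPart - ∫ y, f y ∂U.toJordanDecomposition.negPart

/-- `ρ` is the continuous density of the relative coordinate `xₙ - xᵢ` under the complex measure
`conj φ(x) ψ(x) dx`. A continuous density is unique. -/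
def IsPairDensity (n : Fin N) (φ ψ : WaveFn N L) (ρ : C(AddCircle L, ℂ)) : Prop :=
  ∀ h : C(AddCircle L, ℂ),
    ∫ x : Config N L, h (x.1 n - x.2) * (conj (φ x) * ψ x) = ∫ y : AddCircle L, h y * ρ y

open Classical in
/-- The continuous density of `xₙ - xᵢ` under `conj φ ψ dx`. It exists whenever `φ` and `ψ` have
finite kinetic energy, the only case in which it is used (default value `0` otherwise). -/
def pairDensity (n : Fin N) (φ ψ : WaveFn N L) : C(AddCircle L, ℂ) :=
  if h : ∃ ρ, IsPairDensity n φ ψ ρ then h.choose else 0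

/-- Sesquilinear form `⟨φ|V̂|ψ⟩` of `V̂ = ∑ₙ U(xₙ - xᵢ)`. For `U = u(y) dy` it is
`∫ ∑ₙ u(xₙ - xᵢ) conj φ(x) ψ(x) dx`. -/
def potentialForm (U : SignedMeasure (AddCircle L)) (φ ψ : WaveFn N L) : ℂ :=
  ∑ n, signedIntegral U (pairDensity n φ ψ)

/-- Expectation value `⟨ψ|V̂|ψ⟩` (the form is Hermitian, so this is real). -/
def potentialEnergy (U : SignedMeasure (AddCircle L)) (ψ : WaveFn N L) : ℝ :=
  (potentialForm U ψ ψ).re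

/-! ### Hamiltonian -/

/-- Finite kinetic energy: `ψ` lies in the form domain of `H⁰`. -/
def FiniteKineticEnergy (mh mi : ℝ) (ψ : WaveFn N L) : Prop :=
  Summable fun q : Mode N => kineticEnergy L mh mi q * ‖amplitude ψ q‖ ^ 2

/-- Sesquilinear form `⟨φ|H⁰|ψ⟩`. -/
def kineticForm (mh mi : ℝ) (φ ψ : WaveFn N L) : ℂ :=
  ∑' q : Mode N, (kineticEnergy L mh mi q : ℂ) * (conj (amplitude φ q) * amplitude ψ q)

/-- `HamiltonianMaps mh mi U ψ χ` says that `ψ` is in the domain of `H = H⁰ + V̂` and `H ψ = χ`.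
Here `H` is the operator on the fermionic space associated with the quadratic form of `H⁰ + V̂` on
the states of finite kinetic energy. -/
def HamiltonianMaps (mh mi : ℝ) (U : SignedMeasure (AddCircle L)) (ψ χ : FermiSpace N L) : Prop :=
  FiniteKineticEnergy mh mi (ψ : WaveFn N L) ∧
  ∀ φ : FermiSpace N L, FiniteKineticEnergy mh mi (φ : WaveFn N L) →
    kineticForm mh mi (φ : WaveFn N L) ψ + potentialForm U (φ : WaveFn N L) ψ = inner ℂ φ χ

/-- `W t = exp(-i H t)`: the strongly continuous one-parameter unitary group whose generator is
`-i H`. -/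
structure IsEvolution (mh mi : ℝ) (U : SignedMeasure (AddCircle L))
    (W : ℝ → (FermiSpace N L ≃ₗᵢ[ℂ] FermiSpace N L)) : Prop where
  add : ∀ s t, W (s + t) = W s * W t
  continuous : ∀ ψ, Continuous fun t => W t ψ
  generator : ∀ ψ χ, HamiltonianMaps mh mi U ψ χ ↔
    HasDerivAt (fun t => W t ψ) (-Complex.I • χ) 0

/-! ### Eigenstates of given total momentum -/

/-- Total momentum `2πj/L`: only plane waves with `∑ₙ k n + l = j` occur in `ψ`. -/
def HasTotalMomentum (j : ℤ) (ψ : WaveFn N L) : Prop :=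
  ∀ q : Mode N, amplitude ψ q ≠ 0 → ∑ n, q.1 n + q.2 = j

/-- `ψ` has total momentum `2πj/L` and `H ψ = E ψ`. -/
def IsSectorEigenvector (mh mi : ℝ) (U : SignedMeasure (AddCircle L)) (j : ℤ) (E : ℝ)
    (ψ : FermiSpace N L) : Prop :=
  HasTotalMomentum j (ψ : WaveFn N L) ∧ HamiltonianMaps mh mi U ψ ((E : ℂ) • ψ)

/-- Eigenvalues of `H` in the sector of total momentum `2πj/L`. -/
def sectorEigenvalues (N : ℕ) (mh mi : ℝ) (U : SignedMeasure (AddCircle L)) (j : ℤ) : Set ℝ :=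
  {E | ∃ ψ : FermiSpace N L, ψ ≠ 0 ∧ IsSectorEigenvector mh mi U j E ψ}

/-- Every eigenvalue of `H` in the sector of total momentum `2πj/L` is nondegenerate. -/
def NondegenerateSector (N : ℕ) (mh mi : ℝ) (U : SignedMeasure (AddCircle L)) (j : ℤ) : Prop :=
  ∀ (E : ℝ) (ψ φ : FermiSpace N L), ψ ≠ 0 → IsSectorEigenvector mh mi U j E ψ →
    IsSectorEigenvector mh mi U j E φ → ∃ c : ℂ, φ = c • ψ

/-! ### Infinite-time momentum of the impurity -/

/-- `ψ` lies in the domain of the impurity momentum operator `p̂ᵢ`. -/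
def InMomentumDomain (ψ : WaveFn N L) : Prop :=
  Summable fun q : Mode N => ringMomentum L q.2 ^ 2 * ‖amplitude ψ q‖ ^ 2

/-- `⟨ψ|p̂ᵢ|ψ⟩`. -/
def meanMomentum (ψ : WaveFn N L) : ℝ :=
  ∑' q : Mode N, ringMomentum L q.2 * ‖amplitude ψ q‖ ^ 2

/-- `p` is the infinite-time momentum
`lim_{t → ∞} (1/t) ∫₀ᵗ ⟨ψ₀| exp(iHt') p̂ᵢ exp(-iHt') |ψ₀⟩ dt'`, all terms being well defined. -/
structure IsInfiniteTimeMomentum (W : ℝ → (FermiSpace N L ≃ₗᵢ[ℂ] FermiSpace N L))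
    (ψ₀ : FermiSpace N L) (p : ℝ) : Prop where
  domain : ∀ t, InMomentumDomain (W t ψ₀ : WaveFn N L)
  integrable : ∀ t, IntervalIntegrable (fun s => meanMomentum (W s ψ₀ : WaveFn N L)) volume 0 t
  tendsto : Tendsto (fun t : ℝ => t⁻¹ * ∫ s in (0 : ℝ)..t, meanMomentum (W s ψ₀ : WaveFn N L))
    atTop (𝓝 p)

end ImpurityGas

end

open ImpurityGas

noncomputable section

namespace ImpurityGas

/-! ### Operators given by a compact form resolvent -/

section Abstract

variable {H : Type*} [NormedAddCommGroup H] [InnerProductSpace ℂ H]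

/-! The heart is a linear lower bound on the kinetic energy. On antisymmetric states of total
momentum p₀, H⁰ ≥ p₀²/(2mᵢ) + ((q₀ - p₀)/mᵢ)(p₀ - p̂ᵢ) (`linear_le_kineticEnergy`), with equality in
|FS, p₀⟩. In an eigenstate ⟨H⁰⟩ = E - ⟨V⟩, so each ⟨p̂ᵢ⟩ is controlled by E and ⟨V⟩. Averaging with
the weights |⟨FS, p₀|Ψ_E⟩|², whose mean energy is p₀²/(2mᵢ) + ⟨V⟩ in the initial state, gives the
estimate (`averaged_lower_bound`). Nondegeneracy identifies the average of the ⟨p̂ᵢ⟩ with p_∞,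
because the off-diagonal terms oscillate with nonzero frequencies and average out.

The bound on H⁰ is arithmetic. For N = 2M + 1 distinct integers with sum K, the sum of squares
exceeds the Fermi-sea value by at least r(N - r), r = K mod N (`fermiSea_sum_sq_le`). Sorting the
integers turns them into weakly monotone displacements of the sea, Abel summation writes both sides
through the increments, and subadditivity of r(N - r) compares them. The resulting host energy lies
above the parabola k(2q₀ - k)/(2mᵢ), and that is the linear bound after completing squares.

The analysis must cope with measure potentials, for which |FS, p₀⟩ need not lie in the operator
domain. With S = (H⁰ + Λ)^{-1/2} and B = SVS, states of finite kinetic energy are the range of S,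
and H + Λ becomes S⁻¹(1 + B)S⁻¹. Pair densities have absolutely summable Fourier coefficients since
∑ 1/(b + a s²) over the impurity momentum converges. This sum tends to 0 as b grows, so ‖B‖ ≤ 1/2
for large Λ (`exists_realization`). Then S(1 + B)⁻¹S is compact, symmetric and injective, so H is
diagonal in a Hilbert basis and generates a unique unitary group. A form version of Bessel's
inequality (`summable_energy`) makes the eigenvector expansion of the initial state converge in the
form norm, uniformly in time. That is enough for every observable Q with SQS bounded, in particular
V and p̂ᵢ.

For U ≥ 0 the eigenstate sum is nonnegative and can be dropped. What remains is ⟨V⟩ in |FS, p₀⟩,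
where relative coordinates are uniformly distributed. -/

theorem _root_.HilbertBasis.ext_inner {ι : Type*} (b : HilbertBasis ι ℂ H) {x y : H}
    (h : ∀ i, (inner ℂ (b i) x : ℂ) = inner ℂ (b i) y) : x = y := by
  apply b.repr.injective
  ext i
  rw [b.repr_apply_apply, b.repr_apply_apply, h i]

/-- A compact symmetric operator has a Hilbert basis of eigenvectors. -/
theorem exists_hilbertBasis_eigenvectors [CompleteSpace H] {T : H →L[ℂ] H}
    (hc : IsCompactOperator T) (hs : T.IsSymmetric) :
    ∃ (s : Set H) (b : HilbertBasis s ℂ H) (r : s → ℝ), ∀ i, T (b i) = (r i : ℂ) • b i := by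
  classical
  let V : ℂ → Submodule ℂ H := fun μ => Module.End.eigenspace (T : Module.End ℂ H) μ
  have hV : OrthogonalFamily ℂ (fun μ => V μ) fun μ => (V μ).subtypeₗᵢ :=
    LinearMap.IsSymmetric.orthogonalFamily_eigenspaces hs
  have hcl : ∀ μ, IsClosed (V μ : Set H) := fun μ => by
    have : (V μ : Set H) = {x | T x = μ • x} := by
      ext x; simp [V]
    rw [this]
    exact isClosed_eq T.continuous (continuous_const_smul μ)
  have hcomp : ∀ μ, CompleteSpace (V μ) := fun μ => (hcl μ).completeSpace_coe
  choose w bw hbw using fun μ => exists_hilbertBasis ℂ (V μ)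
  let v : (Σ μ, w μ) → H := fun a => ((bw a.1 a.2 : V a.1) : H)
  have hv : Orthonormal ℂ v := by
    have := hV.orthonormal_sigma_orthonormal (v_family := fun μ => (bw μ : w μ → V μ))
      (fun μ => (bw μ).orthonormal)
    exact this
  have hsp : (Submodule.span ℂ (Set.range v))ᗮ = ⊥ := by
    rw [eq_bot_iff, ← ContinuousLinearMap.orthogonalComplement_iSup_eigenspaces_eq_bot hc hs]
    intro x hx
    rw [Submodule.mem_orthogonal] at hx
    rw [Submodule.iSup_eq_span, Submodule.mem_orthogonal]
    -- Eigenspaces may be infinite dimensional, so an eigenvector is an infinite sum of the chosen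
    -- basis vectors; continuity of the inner product carries orthogonality through it.
    have key : ∀ μ, ∀ y ∈ V μ, (inner ℂ y x : ℂ) = 0 := by
      intro μ y hy
      have h1 := (bw μ).hasSum_repr ⟨y, hy⟩
      have h2 := ((innerSL ℂ x).comp (V μ).subtypeL).hasSum h1
      have h3 : (fun i => ((innerSL ℂ x).comp (V μ).subtypeL)
          ((bw μ).repr ⟨y, hy⟩ i • (bw μ) i)) = fun _ => 0 := by
        funext i
        have := hx (v ⟨μ, i⟩) (Submodule.subset_span ⟨⟨μ, i⟩, rfl⟩)
        rw [inner_eq_zero_symm] at this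
        simp only [map_smul, ContinuousLinearMap.comp_apply, Submodule.subtypeL_apply,
          innerSL_apply_apply, smul_eq_mul]
        rw [show (inner ℂ x ((bw μ i : V μ) : H) : ℂ) = 0 from this, mul_zero]
      have h4 := h2.unique (by simpa only [Function.comp_def, h3] using hasSum_zero)
      rw [inner_eq_zero_symm]
      simpa using h4
    intro u hu
    induction hu using Submodule.span_induction with
    | mem y hy => obtain ⟨μ, hμ⟩ := Set.mem_iUnion.1 hy; exact key μ y hμ
    | zero => simp
    | add a b _ _ ha hb => rw [inner_add_left, ha, hb, add_zero]
    | smul c a _ ha => rw [inner_smul_left, ha, mul_zero]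
  obtain ⟨s, b, hb⟩ : ∃ (s : Set H) (b : HilbertBasis s ℂ H), ⇑b = ((↑) : s → H) ∧
      s = Set.range v := by
    have hr : Orthonormal ℂ ((↑) : Set.range v → H) := hv.toSubtypeRange
    refine ⟨Set.range v, HilbertBasis.mkOfOrthogonalEqBot hr (by rw [Subtype.range_coe]; exact hsp), ?_, rfl⟩
    exact HilbertBasis.coe_mkOfOrthogonalEqBot hr _
  have hev : ∀ i : s, ∃ r : ℝ, T (b i) = (r : ℂ) • b i := by
    rintro ⟨x, hx⟩
    rw [hb.1]
    rw [hb.2] at hx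
    obtain ⟨⟨μ, i⟩, rfl⟩ := hx
    have hmem : T (v ⟨μ, i⟩) = μ • v ⟨μ, i⟩ := Module.End.mem_eigenspace_iff.1 (bw μ i).2
    have hne : v ⟨μ, i⟩ ≠ 0 := hv.ne_zero _
    have hval : Module.End.HasEigenvalue (T : Module.End ℂ H) μ :=
      Module.End.hasEigenvalue_of_hasEigenvector ⟨Module.End.mem_eigenspace_iff.2 hmem, hne⟩
    have hre := LinearMap.IsSymmetric.conj_eigenvalue_eq_self hs hval
    refine ⟨μ.re, ?_⟩
    rw [Complex.conj_eq_iff_re.1 hre]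
    exact hmem
  choose r hr using hev
  exact ⟨s, b, r, hr⟩

/-- `S` plays the role of `(H⁰ + Λ)^{-1/2}` and `B` that of `S V S`. -/
structure IsFormPair (S B : H →L[ℂ] H) : Prop where
  symm_S : ∀ x y, (inner ℂ (S x) y : ℂ) = inner ℂ x (S y)
  injective_S : Function.Injective S
  compact_S : IsCompactOperator S
  symm_B : ∀ x y, (inner ℂ (B x) y : ℂ) = inner ℂ x (B y)
  norm_B : ‖B‖ ≤ 1 / 2

/-- `ψ` is in the domain of the operator `S⁻¹ (1 + B) S⁻¹ - Λ`, which maps it to `χ`. -/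
def FormMaps (S B : H →L[ℂ] H) (Λ : ℝ) (ψ χ : H) : Prop :=
  ∃ v, S v = ψ ∧ v + B v = S (χ + (Λ : ℂ) • ψ)

namespace IsFormPair

variable {S B : H →L[ℂ] H}

/-- In the variable v = S⁻¹ψ, the form of H + Λ is ⟨v, (1 + B)v⟩, and ‖B‖ ≤ 1/2 leaves at least half
of ‖v‖². All form-norm estimates below rest on this. -/
theorem coercive (h : IsFormPair S B) (v : H) :
    ‖v‖ ^ 2 ≤ 2 * (inner ℂ v (v + B v) : ℂ).re := by
  have h1 : ‖(inner ℂ v (B v) : ℂ)‖ ≤ 1 / 2 * ‖v‖ ^ 2 := by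
    calc ‖(inner ℂ v (B v) : ℂ)‖ ≤ ‖v‖ * ‖B v‖ := norm_inner_le_norm _ _
      _ ≤ ‖v‖ * (1 / 2 * ‖v‖) := by
        gcongr; exact (B.le_opNorm v).trans (by gcongr; exact h.norm_B)
      _ = _ := by ring
  have h2 := (abs_le.1 ((Complex.abs_re_le_norm _).trans h1)).1
  have h3 : (inner ℂ v v : ℂ).re = ‖v‖ ^ 2 := by
    rw [inner_self_eq_norm_sq_to_K]; norm_cast
  rw [inner_add_right, Complex.add_re, h3]
  linarith

theorem inner_add_swap (h : IsFormPair S B) (u v : H) :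
    (inner ℂ u (v + B v) : ℂ) = inner ℂ (u + B u) v := by
  rw [inner_add_right, inner_add_left, h.symm_B]

/-- The operator defined by a form pair is diagonal in a Hilbert basis. -/
theorem exists_diagonalization [CompleteSpace H] (h : IsFormPair S B) (Λ : ℝ) :
    ∃ (s : Set H) (b : HilbertBasis s ℂ H) (E : s → ℝ), ∀ ψ χ, FormMaps S B Λ ψ χ ↔
      ∀ i, (inner ℂ (b i) χ : ℂ) = E i * inner ℂ (b i) ψ := by
  have hB : ‖-B‖ < 1 := by rw [norm_neg]; linarith [h.norm_B]
  let u := Units.oneSub (-B) hB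
  let G : H →L[ℂ] H := ((u⁻¹ : (H →L[ℂ] H)ˣ) : H →L[ℂ] H)
  have hu : (u : H →L[ℂ] H) = 1 + B := by simp [u]
  have hG1 : ∀ x, G x + B (G x) = x := fun x => by
    have : (u : H →L[ℂ] H) * G = 1 := u.mul_inv
    rw [hu] at this
    simpa using DFunLike.congr_fun this x
  have hG2 : ∀ x, G (x + B x) = x := fun x => by
    have : G * (u : H →L[ℂ] H) = 1 := u.inv_mul
    rw [hu] at this
    simpa using DFunLike.congr_fun this x
  have hGs : ∀ x y, (inner ℂ (G x) y : ℂ) = inner ℂ x (G y) := fun x y => by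
    conv_lhs => rw [← hG1 y]
    rw [h.inner_add_swap, hG1]
  -- G = (1 + B)⁻¹ is a Neumann series, so R is the resolvent (H + Λ)⁻¹; it inherits compactness
  -- from S.
  let R : H →L[ℂ] H := S.comp (G.comp S)
  have hR : ∀ x, R x = S (G (S x)) := fun x => rfl
  have hRs : R.IsSymmetric := fun x y => by
    change (inner ℂ (R x) y : ℂ) = inner ℂ x (R y)
    rw [hR, hR, h.symm_S, hGs, h.symm_S]
  have hRc : IsCompactOperator R := h.compact_S.comp_clm (G.comp S)
  have hRi : Function.Injective R := fun x y hxy => by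
    have h1 := h.injective_S hxy
    have h2 : S x = S y := by
      have := congrArg (fun z => z + B z) h1
      simpa [hG1] using this
    exact h.injective_S h2
  have hmaps : ∀ ψ χ, FormMaps S B Λ ψ χ ↔ ψ = R (χ + (Λ : ℂ) • ψ) := fun ψ χ => by
    constructor
    · rintro ⟨v, hv, hv2⟩
      rw [hR, ← hv2, hG2, hv]
    · intro e
      exact ⟨G (S (χ + (Λ : ℂ) • ψ)), e.symm, hG1 _⟩
  obtain ⟨s, b, r, hr⟩ := exists_hilbertBasis_eigenvectors hRc hRs
  have hr0 : ∀ i, (r i : ℂ) ≠ 0 := fun i h0 => by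
    have h1 := hr i
    rw [h0, zero_smul, ← map_zero R] at h1
    exact b.orthonormal.ne_zero i (hRi h1)
  -- An eigenvalue r of (H + Λ)⁻¹, nonzero by injectivity, is the energy 1/r - Λ.
  refine ⟨s, b, fun i => (r i)⁻¹ - Λ, fun ψ χ => ?_⟩
  have hin : ∀ i x, (inner ℂ (b i) (R x) : ℂ) = r i * inner ℂ (b i) x := fun i x => by
    have := hRs (b i) x
    change (inner ℂ (R (b i)) x : ℂ) = inner ℂ (b i) (R x) at this
    rw [← this, hr, inner_smul_left, Complex.conj_ofReal]
  rw [hmaps]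
  constructor
  · intro e i
    have h1 := congrArg (fun z => (inner ℂ (b i) z : ℂ)) e
    simp only [hin, inner_add_right, inner_smul_right] at h1
    push_cast
    have := hr0 i
    field_simp
    linear_combination -h1
  · intro e
    refine b.ext_inner fun i => ?_
    rw [hin, inner_add_right, inner_smul_right, e i]
    push_cast
    have := hr0 i
    field_simp
    ring

end IsFormPair

end Abstract

/-! ### One-parameter unitary groups -/

section Evolution

variable {H : Type*} [NormedAddCommGroup H] [InnerProductSpace ℂ H]

/-- The unitary rescaling of a Hilbert basis by phases. -/
theorem exists_phase_unitary [CompleteSpace H] {ι : Type*} (b : HilbertBasis ι ℂ H) (z : ι → ℂ)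
    (hz : ∀ i, ‖z i‖ = 1) :
    ∃ W : H ≃ₗᵢ[ℂ] H, ∀ ψ i, (inner ℂ (b i) (W ψ) : ℂ) = z i * inner ℂ (b i) ψ := by
  have hz0 : ∀ i, z i ≠ 0 := fun i h => by simpa [h] using hz i
  have ho : Orthonormal ℂ fun i => z i • b i := by
    classical
    rw [orthonormal_iff_ite]
    intro i j
    rw [inner_smul_left, inner_smul_right, orthonormal_iff_ite.1 b.orthonormal i j]
    split_ifs with h
    · subst h
      rw [mul_one, ← Complex.normSq_eq_conj_mul_self, Complex.normSq_eq_norm_sq, hz]; norm_num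
    · simp
  have hsp : (Submodule.span ℂ (Set.range fun i => z i • b i))ᗮ = ⊥ := by
    rw [eq_bot_iff]
    intro x hx
    rw [Submodule.mem_orthogonal] at hx
    rw [Submodule.mem_bot]
    refine b.ext_inner fun i => ?_
    have := hx _ (Submodule.subset_span ⟨i, rfl⟩)
    rw [inner_smul_left] at this
    rw [inner_zero_right]
    exact (mul_eq_zero.1 this).resolve_left (by simpa using hz0 i)
  let b' := HilbertBasis.mkOfOrthogonalEqBot ho hsp
  have hb' : ∀ i, b' i = z i • b i := fun i => by
    rw [show ⇑b' = _ from HilbertBasis.coe_mkOfOrthogonalEqBot ho hsp]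
  refine ⟨b.repr.trans b'.repr.symm, fun ψ i => ?_⟩
  have h1 : b'.repr (b'.repr.symm (b.repr ψ)) i = b.repr ψ i := by simp
  rw [b'.repr_apply_apply, b.repr_apply_apply, hb', inner_smul_left] at h1
  have h2 : z i * conj (z i) = 1 := by
    rw [Complex.mul_conj, Complex.normSq_eq_norm_sq, hz]; norm_num
  rw [← h1, ← mul_assoc, h2, one_mul]
  rfl

theorem norm_exp_neg_I_mul (E t : ℝ) : ‖Complex.exp (-(Complex.I * E * t))‖ = 1 := by
  rw [show -(Complex.I * E * t) = ((-(E * t) : ℝ) : ℂ) * Complex.I by push_cast; ring]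
  exact Complex.norm_exp_ofReal_mul_I _

theorem hasDerivAt_exp_neg_I_mul (E t : ℝ) :
    HasDerivAt (fun t : ℝ => Complex.exp (-(Complex.I * E * t)))
      (-(Complex.I * E) * Complex.exp (-(Complex.I * E * t))) t := by
  have h1 : HasDerivAt (fun t : ℝ => -(Complex.I * E * (t : ℂ))) (-(Complex.I * E)) t := by
    have := ((Complex.ofRealCLM.hasDerivAt (x := t)).const_mul (Complex.I * E)).fun_neg
    simpa using this
  convert h1.cexp using 1
  ring

/-- A self-adjoint operator that is diagonal in a Hilbert basis generates a unitary group. -/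
theorem exists_diagonal_group [CompleteSpace H] {ι : Type*} (b : HilbertBasis ι ℂ H) (E : ι → ℝ) :
    ∃ W : ℝ → (H ≃ₗᵢ[ℂ] H), (∀ s t, W (s + t) = W s * W t) ∧
      (∀ ψ, Continuous fun t => W t ψ) ∧
      ∀ ψ χ, (∀ i, (inner ℂ (b i) χ : ℂ) = E i * inner ℂ (b i) ψ) ↔
        HasDerivAt (fun t => W t ψ) (-Complex.I • χ) 0 := by
  choose W hW using fun t : ℝ => exists_phase_unitary b
    (fun i => Complex.exp (-(Complex.I * E i * t))) (fun i => norm_exp_neg_I_mul (E i) t)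
  have hadd : ∀ s t, W (s + t) = W s * W t := fun s t => by
    ext ψ
    refine b.ext_inner fun i => ?_
    change _ = (inner ℂ (b i) (W s (W t ψ)) : ℂ)
    rw [hW, hW, hW, ← mul_assoc, ← Complex.exp_add]
    congr 2
    push_cast
    ring
  have hW0 : ∀ ψ, W 0 ψ = ψ := fun ψ => b.ext_inner fun i => by rw [hW]; simp
  -- Matrix elements are continuous by the M-test, and since norms are preserved, ‖W t ψ - W s ψ‖ is
  -- a continuous function of ⟨W s ψ, W t ψ⟩.
  have hcont : ∀ ψ, Continuous fun t => W t ψ := fun ψ => by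
    have hin : ∀ s, Continuous fun t => (inner ℂ (W s ψ) (W t ψ) : ℂ) := fun s => by
      have h1 : ∀ t, (inner ℂ (W s ψ) (W t ψ) : ℂ) = ∑' i, inner ℂ (W s ψ) (b i) *
          (Complex.exp (-(Complex.I * E i * t)) * inner ℂ (b i) ψ) := fun t => by
        rw [← b.tsum_inner_mul_inner]
        simp only [hW]
      simp only [h1]
      refine continuous_tsum (u := fun i => ‖(inner ℂ (b i) ψ : ℂ)‖ ^ 2) (fun i => by fun_prop)
        (b.orthonormal.inner_products_summable (x := ψ)) fun i t => ?_
      rw [← inner_conj_symm, hW, norm_mul, norm_mul, RCLike.norm_conj, norm_mul,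
        norm_exp_neg_I_mul, norm_exp_neg_I_mul]
      apply le_of_eq
      ring
    rw [continuous_iff_continuousAt]
    intro s
    rw [ContinuousAt, tendsto_iff_norm_sub_tendsto_zero]
    have h2 : ∀ t, ‖W t ψ - W s ψ‖ = Real.sqrt
        (2 * ‖ψ‖ ^ 2 - 2 * (inner ℂ (W s ψ) (W t ψ) : ℂ).re) := fun t => by
      rw [← Real.sqrt_sq (norm_nonneg (W t ψ - W s ψ))]
      congr 1
      rw [← norm_neg, neg_sub, @norm_sub_sq ℂ, (W s).norm_map, (W t).norm_map]
      simp only [RCLike.re_to_complex]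
      ring
    simp only [h2]
    have h3 : Continuous fun t => Real.sqrt
        (2 * ‖ψ‖ ^ 2 - 2 * (inner ℂ (W s ψ) (W t ψ) : ℂ).re) := by
      have := hin s
      fun_prop
    have h4 := h3.tendsto s
    have h5 : (inner ℂ (W s ψ) (W s ψ) : ℂ).re = ‖ψ‖ ^ 2 := by
      rw [inner_self_eq_norm_sq_to_K, (W s).norm_map]; norm_cast
    rwa [h5, sub_self, Real.sqrt_zero] at h4
  refine ⟨W, hadd, hcont, fun ψ χ => ⟨fun h => ?_, fun h i => ?_⟩⟩
  -- The integrated equation can be checked coordinate by coordinate; strong differentiability then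
  -- follows from the fundamental theorem of calculus, with no estimate on difference quotients.
  · have hint : ∀ t : ℝ, W t ψ = ψ + ∫ s in (0 : ℝ)..t, W s (-Complex.I • χ) := fun t => by
      refine b.ext_inner fun i => ?_
      have hii : IntervalIntegrable (fun s => W s (-Complex.I • χ)) volume 0 t :=
        (hcont _).intervalIntegrable _ _
      have e1 : (inner ℂ (b i) (∫ s in (0 : ℝ)..t, W s (-Complex.I • χ)) : ℂ)
          = ∫ s in (0 : ℝ)..t, (inner ℂ (b i) (W s (-Complex.I • χ)) : ℂ) := by
        exact ((innerSL ℂ (b i)).intervalIntegral_comp_comm hii).symm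
      rw [inner_add_right, e1]
      have e2 : ∀ s : ℝ, (inner ℂ (b i) (W s (-Complex.I • χ)) : ℂ) =
          (-(Complex.I * E i) * Complex.exp (-(Complex.I * E i * s))) * inner ℂ (b i) ψ :=
        fun s => by
          rw [hW, inner_smul_right, h i]
          ring
      simp only [e2]
      rw [intervalIntegral.integral_eq_sub_of_hasDerivAt
        (fun s _ => (hasDerivAt_exp_neg_I_mul (E i) s).mul_const _)
        (by apply Continuous.intervalIntegrable; fun_prop), hW]
      simp
    have hd : HasDerivAt (fun t : ℝ => ψ + ∫ s in (0 : ℝ)..t, W s (-Complex.I • χ))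
        (W 0 (-Complex.I • χ)) 0 :=
      (intervalIntegral.integral_hasDerivAt_right ((hcont _).intervalIntegrable _ _)
        ((hcont _).stronglyMeasurableAtFilter _ _) (hcont _).continuousAt).const_add ψ
    rw [hW0] at hd
    exact hd.congr_of_eventuallyEq (Eventually.of_forall hint)
  · have h1 : HasDerivAt (fun t : ℝ => (inner ℂ (b i) (W t ψ) : ℂ))
        (inner ℂ (b i) (-Complex.I • χ)) 0 :=
      ((innerSL ℂ (b i)).restrictScalars ℝ).hasFDerivAt.comp_hasDerivAt 0 h
    have h2 := (hasDerivAt_exp_neg_I_mul (E i) 0).mul_const (inner ℂ (b i) ψ : ℂ)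
    simp only [hW] at h1
    have h3 := h1.unique h2
    rw [inner_smul_right] at h3
    simp only [Complex.ofReal_zero, mul_zero, neg_zero, Complex.exp_zero, mul_one] at h3
    have hI : Complex.I ≠ 0 := Complex.I_ne_zero
    apply mul_left_cancel₀ hI
    linear_combination -h3

/-- A unitary group acts on an eigenvector of its generator by a phase. -/
theorem group_apply_eigenvector {W : ℝ → (H ≃ₗᵢ[ℂ] H)} (hadd : ∀ s t, W (s + t) = W s * W t)
    {x : H} {E : ℝ} (hx : HasDerivAt (fun t => W t x) (-Complex.I • ((E : ℂ) • x)) 0) (t : ℝ) :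
    W t x = Complex.exp (-(Complex.I * E * t)) • x := by
  have hW0 : W 0 = 1 := by
    have := hadd 0 0
    rw [add_zero] at this
    exact left_eq_mul.1 this
  have hd : ∀ t, HasDerivAt (fun t => W t x) (-Complex.I • ((E : ℂ) • W t x)) t := fun t => by
    have h1 : HasDerivAt (fun s => W t (W s x)) (W t (-Complex.I • ((E : ℂ) • x))) 0 :=
      ((W t).toContinuousLinearEquiv.toContinuousLinearMap.restrictScalars
        ℝ).hasFDerivAt.comp_hasDerivAt 0 hx
    have h2 : HasDerivAt (fun s => W s x) (W t (-Complex.I • ((E : ℂ) • x))) (t + 0) := by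
      have h3 : HasDerivAt (fun s => W (t + s) x) (W t (-Complex.I • ((E : ℂ) • x))) 0 := by
        convert h1 using 2
        rw [hadd]; rfl
      have h4 : HasDerivAt (fun s => W (t + s) x) (W t (-Complex.I • ((E : ℂ) • x)))
          (t + 0 - t) := by simpa using h3
      have h5 := h4.comp_sub_const (t + 0) t
      simpa using h5
    rw [map_smul, map_smul, add_zero] at h2
    exact h2
  -- Undoing the expected phase by the factor exp(iEt) leaves a constant curve.
  have hg : ∀ t : ℝ, HasDerivAt
      (fun t : ℝ => Complex.exp (-(Complex.I * (-E : ℝ) * t)) • W t x) 0 t := fun t => by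
    convert (hasDerivAt_exp_neg_I_mul (-E) t).fun_smul (hd t) using 1
    rw [smul_smul, smul_smul, ← add_smul]
    push_cast
    rw [show Complex.exp (-(Complex.I * -↑E * ↑t)) * -Complex.I * ↑E +
      -(Complex.I * -↑E) * Complex.exp (-(Complex.I * -↑E * ↑t)) = 0 by ring, zero_smul]
  have hconst := is_const_of_deriv_eq_zero (fun t => (hg t).differentiableAt)
    (fun t => (hg t).deriv) t 0
  simp only [hW0, Complex.ofReal_zero, mul_zero, neg_zero, Complex.exp_zero, one_smul,
    LinearIsometryEquiv.coe_one, id_eq] at hconst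
  nth_rw 2 [← hconst]
  rw [smul_smul, ← Complex.exp_add]
  push_cast
  rw [show -(Complex.I * E * t) + -(Complex.I * -E * t) = 0 by ring, Complex.exp_zero, one_smul]

/-- A unitary group whose generator is diagonal in a Hilbert basis is unique. -/
theorem group_ext {ι : Type*} (b : HilbertBasis ι ℂ H) {W W' : ℝ → (H ≃ₗᵢ[ℂ] H)}
    (h : ∀ t i, W t (b i) = W' t (b i)) : W = W' := by
  funext t
  ext ψ
  have h1 := (W t).toContinuousLinearEquiv.toContinuousLinearMap.hasSum (b.hasSum_repr ψ)
  have h2 := (W' t).toContinuousLinearEquiv.toContinuousLinearMap.hasSum (b.hasSum_repr ψ)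
  refine h1.unique ?_
  change HasSum _ (W' t ψ) at h2
  convert h2 using 1
  funext i
  simp [h]

end Evolution

/-! ### Time averages -/

section Averages

/-- The primitive stays bounded by 2/|ω|, so division by t sends it to 0. -/
theorem tendsto_average_exp {ω : ℝ} (hω : ω ≠ 0) :
    Tendsto (fun t : ℝ => t⁻¹ • ∫ s in (0 : ℝ)..t, Complex.exp (-(Complex.I * ω * s)))
      atTop (𝓝 0) := by
  have hc : Complex.I * ω ≠ 0 := mul_ne_zero Complex.I_ne_zero (by exact_mod_cast hω)
  have hint : ∀ t : ℝ, ∫ s in (0 : ℝ)..t, Complex.exp (-(Complex.I * ω * s)) =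
      (-(Complex.I * ω))⁻¹ * (Complex.exp (-(Complex.I * ω * t)) - 1) := fun t => by
    have hd : ∀ s : ℝ, HasDerivAt (fun s : ℝ => (-(Complex.I * ω))⁻¹ *
        Complex.exp (-(Complex.I * ω * s))) (Complex.exp (-(Complex.I * ω * s))) s := fun s => by
      have hd := (hasDerivAt_exp_neg_I_mul ω s).const_mul (-(Complex.I * ω))⁻¹
      rwa [← mul_assoc, inv_mul_cancel₀ (neg_ne_zero.2 hc), one_mul] at hd
    rw [intervalIntegral.integral_eq_sub_of_hasDerivAt (fun s _ => hd s)
      (by apply Continuous.intervalIntegrable; fun_prop)]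
    simp
    ring
  refine squeeze_zero_norm (a := fun t : ℝ => |t⁻¹| * (‖(-(Complex.I * ω))⁻¹‖ * 2))
    (fun t => ?_) ?_
  · rw [norm_smul, hint, norm_mul, Real.norm_eq_abs]
    gcongr
    calc ‖Complex.exp (-(Complex.I * ω * t)) - 1‖
        ≤ ‖Complex.exp (-(Complex.I * ω * t))‖ + ‖(1 : ℂ)‖ := norm_sub_le _ _
      _ = 2 := by rw [norm_exp_neg_I_mul, norm_one]; norm_num
  · have := (tendsto_inv_atTop_zero (𝕜 := ℝ)).abs.mul_const (‖(-(Complex.I * ω))⁻¹‖ * 2)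
    simpa using this

/-- Uniformity in t is what later permits exchanging the limit t → ∞ with the eigenvector series. At
t = 0 the average is 0 by the convention 0⁻¹ = 0. -/
theorem norm_average_le {f : ℝ → ℂ} {C : ℝ} (hC : 0 ≤ C) (hf : ∀ t, ‖f t‖ ≤ C) (t : ℝ) :
    ‖t⁻¹ • ∫ s in (0 : ℝ)..t, f s‖ ≤ C := by
  have h1 := intervalIntegral.norm_integral_le_of_norm_le_const (a := 0) (b := t) (f := f)
    (C := C) fun s _ => hf s
  rw [norm_smul, Real.norm_eq_abs, abs_inv]
  rw [sub_zero] at h1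
  by_cases ht : t = 0
  · subst ht; simpa using hC
  · have : 0 < |t| := abs_pos.2 ht
    calc |t|⁻¹ * ‖∫ s in (0 : ℝ)..t, f s‖ ≤ |t|⁻¹ * (C * |t|) := by gcongr
      _ = C := by field_simp

variable {H : Type*} [NormedAddCommGroup H] [InnerProductSpace ℂ H]

theorem norm_inner_clm_sub_le (Q : H →L[ℂ] H) (x y : H) :
    ‖(inner ℂ x (Q x) : ℂ) - inner ℂ y (Q y)‖ ≤ ‖Q‖ * ‖x - y‖ * (‖x‖ + ‖y‖) := by
  have h : (inner ℂ x (Q x) : ℂ) - inner ℂ y (Q y) =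
      inner ℂ (x - y) (Q x) + inner ℂ y (Q (x - y)) := by
    rw [map_sub, inner_sub_left, inner_sub_right]; ring
  rw [h]
  have e1 : ‖(inner ℂ (x - y) (Q x) : ℂ)‖ ≤ ‖x - y‖ * (‖Q‖ * ‖x‖) :=
    (norm_inner_le_norm _ _).trans (by gcongr; exact Q.le_opNorm x)
  have e2 : ‖(inner ℂ y (Q (x - y)) : ℂ)‖ ≤ ‖y‖ * (‖Q‖ * ‖x - y‖) :=
    (norm_inner_le_norm _ _).trans (by gcongr; exact Q.le_opNorm _)
  calc _ ≤ _ := norm_add_le _ _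
    _ ≤ ‖x - y‖ * (‖Q‖ * ‖x‖) + ‖y‖ * (‖Q‖ * ‖x - y‖) := add_le_add e1 e2
    _ = _ := by ring

/-- Time average of a quadratic expectation value along a trigonometric polynomial with distinct
frequencies. -/
theorem tendsto_average_trigPolynomial {ι : Type*} {E : ι → ℝ} (hE : Function.Injective E)
    (w : ι → H) (Q : H →L[ℂ] H) (F : Finset ι) :
    Tendsto (fun t : ℝ => t⁻¹ • ∫ s in (0 : ℝ)..t,
      (inner ℂ (∑ i ∈ F, Complex.exp (-(Complex.I * E i * s)) • w i)
        (Q (∑ i ∈ F, Complex.exp (-(Complex.I * E i * s)) • w i)) : ℂ)) atTop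
      (𝓝 (∑ i ∈ F, (inner ℂ (w i) (Q (w i)) : ℂ))) := by
  classical
  have hexp : ∀ s : ℝ, (inner ℂ (∑ i ∈ F, Complex.exp (-(Complex.I * E i * s)) • w i)
        (Q (∑ i ∈ F, Complex.exp (-(Complex.I * E i * s)) • w i)) : ℂ) =
      ∑ i ∈ F, ∑ j ∈ F, Complex.exp (-(Complex.I * (E j - E i : ℝ) * s)) *
        inner ℂ (w i) (Q (w j)) := fun s => by
    rw [sum_inner]
    refine Finset.sum_congr rfl fun i _ => ?_
    rw [map_sum, inner_sum]
    refine Finset.sum_congr rfl fun j _ => ?_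
    rw [map_smul, inner_smul_left, inner_smul_right, ← Complex.exp_conj, ← mul_assoc,
      ← Complex.exp_add]
    congr 2
    simp only [map_neg, map_mul, Complex.conj_I, Complex.conj_ofReal]
    push_cast
    ring
  simp only [hexp]
  have hav : ∀ t : ℝ, t⁻¹ • ∫ s in (0 : ℝ)..t, ∑ i ∈ F, ∑ j ∈ F,
      Complex.exp (-(Complex.I * (E j - E i : ℝ) * s)) * (inner ℂ (w i) (Q (w j)) : ℂ) =
      ∑ i ∈ F, ∑ j ∈ F, (t⁻¹ • ∫ s in (0 : ℝ)..t,
        Complex.exp (-(Complex.I * (E j - E i : ℝ) * s))) * (inner ℂ (w i) (Q (w j)) : ℂ) :=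
    fun t => by
      rw [intervalIntegral.integral_finsetSum
        (fun i _ => by apply Continuous.intervalIntegrable; fun_prop), Finset.smul_sum]
      refine Finset.sum_congr rfl fun i _ => ?_
      rw [intervalIntegral.integral_finsetSum
        (fun i _ => by apply Continuous.intervalIntegrable; fun_prop), Finset.smul_sum]
      refine Finset.sum_congr rfl fun j _ => ?_
      rw [intervalIntegral.integral_mul_const, smul_mul_assoc]
  simp only [hav]
  -- The limit is rewritten as a double sum with a Kronecker delta, so that convergence can be
  -- checked pair by pair; distinct energies kill the pairs j ≠ i.
  have hdiag : ∀ i ∈ F, (inner ℂ (w i) (Q (w i)) : ℂ) =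
      ∑ j ∈ F, (if j = i then (1 : ℂ) else 0) * inner ℂ (w i) (Q (w j)) := fun i hi => by
    simp [hi]
  rw [Finset.sum_congr rfl hdiag]
  refine tendsto_finsetSum _ fun i _ => tendsto_finsetSum _ fun j _ => Tendsto.mul_const _ ?_
  split_ifs with hij
  · subst hij
    refine tendsto_const_nhds.congr' ?_
    filter_upwards [eventually_gt_atTop 0] with t ht
    simp [ht.ne']
  · exact tendsto_average_exp (sub_ne_zero.2 (hE.ne hij))

/-- Time average of a quadratic expectation value along a uniform limit of trigonometric
polynomials with distinct frequencies. -/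
theorem tendsto_average_of_tendstoUniformly {ι : Type*} {E : ι → ℝ} (hE : Function.Injective E)
    {w : ι → H} (Q : H →L[ℂ] H) {u : ℝ → H} {M : ℂ}
    (hu : TendstoUniformly (fun (F : Finset ι) (t : ℝ) =>
      ∑ i ∈ F, Complex.exp (-(Complex.I * E i * t)) • w i) u atTop)
    (hM : HasSum (fun i => (inner ℂ (w i) (Q (w i)) : ℂ)) M) :
    Continuous u ∧ Tendsto (fun t : ℝ => t⁻¹ • ∫ s in (0 : ℝ)..t, (inner ℂ (u s) (Q (u s)) : ℂ))
      atTop (𝓝 M) := by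
  have hcF : ∀ F : Finset ι, Continuous fun t : ℝ =>
      ∑ i ∈ F, Complex.exp (-(Complex.I * E i * t)) • w i := fun F => by fun_prop
  have hcu : Continuous u := hu.continuous (Frequently.of_forall hcF)
  refine ⟨hcu, ?_⟩
  rw [Metric.tendstoUniformly_iff] at hu
  obtain ⟨K, hK0, hK⟩ : ∃ K, 0 ≤ K ∧ ∀ t, ‖u t‖ ≤ K := by
    obtain ⟨F, hF⟩ := (hu 1 one_pos).exists
    refine ⟨1 + ∑ i ∈ F, ‖w i‖, by positivity, fun t => ?_⟩
    have h1 := (hF t).le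
    rw [dist_eq_norm] at h1
    have h2 : ‖∑ i ∈ F, Complex.exp (-(Complex.I * E i * t)) • w i‖ ≤ ∑ i ∈ F, ‖w i‖ := by
      refine (norm_sum_le _ _).trans (Finset.sum_le_sum fun i _ => ?_)
      rw [norm_smul, norm_exp_neg_I_mul, one_mul]
    have h3 := norm_sub_norm_le (u t) (∑ i ∈ F, Complex.exp (-(Complex.I * E i * t)) • w i)
    linarith
  -- Interchange of limits: the averages of the finite truncations converge uniformly in t, and each
  -- has its own limit as t → ∞.
  refine TendstoUniformly.tendsto_of_eventually_tendsto (p := atTop)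
    (F := fun (F : Finset ι) (t : ℝ) => t⁻¹ • ∫ s in (0 : ℝ)..t,
      (inner ℂ (∑ i ∈ F, Complex.exp (-(Complex.I * E i * s)) • w i)
        (Q (∑ i ∈ F, Complex.exp (-(Complex.I * E i * s)) • w i)) : ℂ)) ?_
    (Eventually.of_forall fun F => tendsto_average_trigPolynomial hE w Q F) hM
  rw [Metric.tendstoUniformly_iff]
  intro ε hε
  -- 2K + 1 bounds ‖u s‖ + ‖y‖ once y is within 1 of u s; the extra 1 keeps D positive when Q = 0.
  set D := ‖Q‖ * (2 * K + 1) + 1 with hD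
  have hDpos : 0 < D := by positivity
  filter_upwards [hu (min 1 (ε / (2 * D))) (by positivity)] with F hF t
  have hb : ∀ s, ‖(inner ℂ (u s) (Q (u s)) : ℂ) -
      inner ℂ (∑ i ∈ F, Complex.exp (-(Complex.I * E i * s)) • w i)
        (Q (∑ i ∈ F, Complex.exp (-(Complex.I * E i * s)) • w i))‖ ≤ ε / 2 := fun s => by
    set y := ∑ i ∈ F, Complex.exp (-(Complex.I * E i * s)) • w i
    have h1 : ‖u s - y‖ ≤ min 1 (ε / (2 * D)) := by rw [← dist_eq_norm]; exact (hF s).le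
    have h2 : ‖u s - y‖ ≤ 1 := h1.trans (min_le_left _ _)
    have h3 : ‖u s - y‖ ≤ ε / (2 * D) := h1.trans (min_le_right _ _)
    have h4 : ‖y‖ ≤ K + 1 := by
      have := norm_sub_norm_le y (u s)
      rw [norm_sub_rev] at this
      linarith [hK s]
    calc _ ≤ ‖Q‖ * ‖u s - y‖ * (‖u s‖ + ‖y‖) := norm_inner_clm_sub_le Q _ _
      _ ≤ ‖Q‖ * (ε / (2 * D)) * (K + (K + 1)) := by gcongr; exact hK s
      _ = (ε / (2 * D)) * (‖Q‖ * (2 * K + 1)) := by ring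
      _ ≤ (ε / (2 * D)) * D := by gcongr; rw [hD]; linarith
      _ = ε / 2 := by field_simp
  rw [dist_eq_norm, ← smul_sub, ← intervalIntegral.integral_sub
    (by apply Continuous.intervalIntegrable; fun_prop)
    (by apply Continuous.intervalIntegrable; have := hcF F; fun_prop)]
  exact (norm_average_le (by positivity) hb t).trans_lt (by linarith)

end Averages

/-! ### Expansion of states of finite energy in eigenvectors -/

namespace IsFormPair

variable {H : Type*} [NormedAddCommGroup H] [InnerProductSpace ℂ H] {S B : H →L[ℂ] H}

section Expansion

variable {Λ : ℝ} {ι : Type*} {E : ι → ℝ} {v : ι → H}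

/-- For the eigenstate Ψ = S v, the hypothesis `hv` is the equation (H + Λ)Ψ = (E + Λ)Ψ multiplied
by S; symmetry of S gives its weak form. -/
theorem eigen_form (h : IsFormPair S B) (hv : ∀ i, v i + B (v i) = ((E i + Λ : ℝ) : ℂ) • S (S (v i)))
    (x : H) (i : ι) :
    (inner ℂ x (v i + B (v i)) : ℂ) = (E i + Λ : ℝ) * inner ℂ (S x) (S (v i)) := by
  rw [hv, inner_smul_right, h.symm_S]

/-- The form of H + Λ is diagonal on combinations of the v i because the S (v i) are orthonormal;
coercivity turns its value into a bound on the norm. -/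
theorem sum_form_le (h : IsFormPair S B)
    (hv : ∀ i, v i + B (v i) = ((E i + Λ : ℝ) : ℂ) • S (S (v i)))
    (ho : Orthonormal ℂ fun i => S (v i)) (a : ι → ℂ) (F : Finset ι) :
    ‖∑ i ∈ F, a i • v i‖ ^ 2 ≤ 2 * ∑ i ∈ F, ‖a i‖ ^ 2 * (E i + Λ) := by
  classical
  have h1 := h.coercive (∑ i ∈ F, a i • v i)
  have h2 : (inner ℂ (∑ i ∈ F, a i • v i) (∑ i ∈ F, a i • v i + B (∑ i ∈ F, a i • v i)) : ℂ)
      = ((∑ i ∈ F, ‖a i‖ ^ 2 * (E i + Λ) : ℝ) : ℂ) := by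
    have e1 : ∑ i ∈ F, a i • v i + B (∑ i ∈ F, a i • v i) =
        ∑ i ∈ F, a i • (v i + B (v i)) := by
      simp [smul_add, Finset.sum_add_distrib, map_sum]
    rw [e1, inner_sum]
    push_cast
    refine Finset.sum_congr rfl fun i hi => ?_
    rw [inner_smul_right, h.eigen_form hv, map_sum, sum_inner]
    have e2 : ∀ j ∈ F, (inner ℂ (S (a j • v j)) (S (v i)) : ℂ) =
        if j = i then conj (a i) else 0 := fun j _ => by
      rw [map_smul, inner_smul_left, orthonormal_iff_ite.1 ho j i]
      split_ifs with hji
      · rw [hji, mul_one]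
      · simp
    rw [Finset.sum_congr rfl e2, Finset.sum_ite_eq' F i, if_pos hi]
    push_cast
    rw [← Complex.mul_conj']
    ring
  rw [h2, Complex.ofReal_re] at h1
  exact h1

theorem norm_sq_le (h : IsFormPair S B)
    (hv : ∀ i, v i + B (v i) = ((E i + Λ : ℝ) : ℂ) • S (S (v i)))
    (ho : Orthonormal ℂ fun i => S (v i)) (i : ι) : ‖v i‖ ^ 2 ≤ 2 * (E i + Λ) := by
  classical
  simpa using h.sum_form_le hv ho (fun _ => 1) {i}

theorem eigenvalue_nonneg (h : IsFormPair S B)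
    (hv : ∀ i, v i + B (v i) = ((E i + Λ : ℝ) : ℂ) • S (S (v i)))
    (ho : Orthonormal ℂ fun i => S (v i)) (i : ι) : 0 ≤ E i + Λ := by
  have := h.norm_sq_le hv ho i
  nlinarith [sq_nonneg ‖v i‖]

/-- Bessel's inequality for the inner product given by the form of H + Λ: it is nonnegative at u₀ -
x, where x is the finite eigenvector expansion. The mixed terms and the value at x all equal the
partial sum s, so s is at most the form energy of u₀. -/
theorem summable_energy (h : IsFormPair S B)
    (hv : ∀ i, v i + B (v i) = ((E i + Λ : ℝ) : ℂ) • S (S (v i)))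
    (ho : Orthonormal ℂ fun i => S (v i)) (u₀ : H) :
    Summable fun i => ‖(inner ℂ (S (v i)) (S u₀) : ℂ)‖ ^ 2 * (E i + Λ) := by
  classical
  refine summable_of_sum_le (c := (inner ℂ u₀ (u₀ + B u₀) : ℂ).re)
    (fun i => mul_nonneg (sq_nonneg _) (h.eigenvalue_nonneg hv ho i)) fun F => ?_
  set c : ι → ℂ := fun i => inner ℂ (S (v i)) (S u₀)
  set x := ∑ i ∈ F, c i • v i with hx
  have hxB : x + B x = ∑ i ∈ F, c i • (v i + B (v i)) := by
    simp [hx, smul_add, Finset.sum_add_distrib, map_sum]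
  set s : ℝ := ∑ i ∈ F, ‖c i‖ ^ 2 * (E i + Λ) with hs
  have e1 : (inner ℂ u₀ (x + B x) : ℂ) = s := by
    rw [hxB, inner_sum, hs]
    push_cast
    refine Finset.sum_congr rfl fun i _ => ?_
    rw [inner_smul_right, h.eigen_form hv, ← inner_conj_symm (S u₀)]
    push_cast
    rw [← Complex.mul_conj']
    ring
  have e2 : (inner ℂ x (u₀ + B u₀) : ℂ) = s := by
    rw [h.inner_add_swap, ← inner_conj_symm, e1, Complex.conj_ofReal]
  have e3 : (inner ℂ x (x + B x) : ℂ) = s := by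
    rw [hxB, inner_sum, hs]
    push_cast
    refine Finset.sum_congr rfl fun i hi => ?_
    rw [inner_smul_right, h.eigen_form hv, hx, map_sum, sum_inner]
    have e2 : ∀ j ∈ F, (inner ℂ (S (c j • v j)) (S (v i)) : ℂ) =
        if j = i then conj (c i) else 0 := fun j _ => by
      rw [map_smul, inner_smul_left, orthonormal_iff_ite.1 ho j i]
      split_ifs with hji
      · rw [hji, mul_one]
      · simp
    rw [Finset.sum_congr rfl e2, Finset.sum_ite_eq' F i, if_pos hi]
    push_cast
    rw [← Complex.mul_conj']
    ring
  have h1 := h.coercive (u₀ - x)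
  have h2 : (inner ℂ (u₀ - x) (u₀ - x + B (u₀ - x)) : ℂ) =
      inner ℂ u₀ (u₀ + B u₀) - inner ℂ u₀ (x + B x) - inner ℂ x (u₀ + B u₀)
        + inner ℂ x (x + B x) := by
    rw [map_sub]
    simp only [inner_sub_left, inner_add_right, inner_sub_right]
    ring
  rw [h2, e1, e2, e3] at h1
  simp only [Complex.add_re, Complex.sub_re, Complex.ofReal_re] at h1
  nlinarith [sq_nonneg ‖u₀ - x‖]

/-- A series in the eigenvectors whose coefficients are square summable with the energy weights
converges in the form norm, uniformly in the phases. -/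
theorem exists_evolution_series [CompleteSpace H] (h : IsFormPair S B)
    (hv : ∀ i, v i + B (v i) = ((E i + Λ : ℝ) : ℂ) • S (S (v i)))
    (ho : Orthonormal ℂ fun i => S (v i)) {c : ι → ℂ}
    (hc : Summable fun i => ‖c i‖ ^ 2 * (E i + Λ)) :
    ∃ u : ℝ → H, TendstoUniformly (fun (F : Finset ι) (t : ℝ) =>
      ∑ i ∈ F, Complex.exp (-(Complex.I * E i * t)) • (c i • v i)) u atTop := by
  classical
  have hb : ∀ (t : ℝ) (F : Finset ι),
      ‖∑ i ∈ F, Complex.exp (-(Complex.I * E i * t)) • (c i • v i)‖ ^ 2 ≤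
        2 * ∑ i ∈ F, ‖c i‖ ^ 2 * (E i + Λ) := fun t F => by
    have := h.sum_form_le hv ho (fun i => Complex.exp (-(Complex.I * E i * t)) * c i) F
    simpa only [smul_smul, norm_mul, norm_exp_neg_I_mul, one_mul] using this
  -- The phases have modulus 1 and drop out of the tail bound, so one F₀ serves all times.
  have hvan : ∀ ε > 0, ∃ F₀ : Finset ι, ∀ F, Disjoint F F₀ → ∀ t : ℝ,
      ‖∑ i ∈ F, Complex.exp (-(Complex.I * E i * t)) • (c i • v i)‖ < ε := fun ε hε => by
    obtain ⟨F₀, hF₀⟩ := summable_iff_vanishing_norm.1 hc (ε ^ 2 / 2) (by positivity)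
    refine ⟨F₀, fun F hF t => ?_⟩
    have h1 := hF₀ F hF
    have h2 := (le_abs_self _).trans_lt h1
    exact lt_of_pow_lt_pow_left₀ 2 hε.le (by linarith [hb t F])
  have hsum : ∀ t : ℝ, Summable fun i => Complex.exp (-(Complex.I * E i * t)) • (c i • v i) :=
    fun t => summable_iff_vanishing_norm.2 fun ε hε => by
      obtain ⟨F₀, hF₀⟩ := hvan ε hε
      exact ⟨F₀, fun F hF => hF₀ F hF t⟩
  refine ⟨fun t => ∑' i, Complex.exp (-(Complex.I * E i * t)) • (c i • v i), ?_⟩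
  rw [Metric.tendstoUniformly_iff]
  intro ε hε
  obtain ⟨F₀, hF₀⟩ := hvan (ε / 2) (by positivity)
  filter_upwards [eventually_ge_atTop F₀] with F hF t
  have h1 : Tendsto (fun G : Finset ι => ‖∑ i ∈ G, Complex.exp (-(Complex.I * E i * t)) •
      (c i • v i) - ∑ i ∈ F, Complex.exp (-(Complex.I * E i * t)) • (c i • v i)‖) atTop
      (𝓝 ‖∑' i, Complex.exp (-(Complex.I * E i * t)) • (c i • v i) -
        ∑ i ∈ F, Complex.exp (-(Complex.I * E i * t)) • (c i • v i)‖) :=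
    ((hsum t).hasSum.sub_const _).norm
  have h2 : ∀ᶠ G : Finset ι in atTop, ‖∑ i ∈ G, Complex.exp (-(Complex.I * E i * t)) •
      (c i • v i) - ∑ i ∈ F, Complex.exp (-(Complex.I * E i * t)) • (c i • v i)‖ ≤ ε / 2 := by
    filter_upwards [eventually_ge_atTop F] with G hG
    rw [← Finset.sum_sdiff hG, add_sub_cancel_right]
    refine (hF₀ _ ?_ t).le
    exact Finset.disjoint_of_subset_right hF Finset.sdiff_disjoint
  have h3 := le_of_tendsto h1 h2
  rw [dist_eq_norm]
  linarith

end Expansion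

end IsFormPair

section

/-! ### The plane-wave basis -/

section PlaneWaves

variable {N : ℕ} {L : ℝ}

theorem norm_fourier_apply (m : ℤ) (y : AddCircle L) : ‖fourier m y‖ = 1 := by
  rw [fourier_apply]; exact Circle.norm_coe _

/-- Unnormalized plane waves. -/
def character (q : Mode N) : C(Config N L, ℂ) where
  toFun x := (∏ n, fourier (q.1 n) (x.1 n)) * fourier q.2 x.2
  continuous_toFun := by fun_prop

theorem character_add (q q' : Mode N) :
    (character (q + q') : C(Config N L, ℂ)) = character q * character q' := by
  ext x
  simp only [character, ContinuousMap.coe_mk, ContinuousMap.mul_apply, Prod.fst_add, Prod.snd_add,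
    Pi.add_apply, fourier_add, Finset.prod_mul_distrib]
  ring

theorem character_zero : (character 0 : C(Config N L, ℂ)) = 1 := by
  ext x
  simp [character]

/-- The star algebra of trigonometric polynomials. -/
def characterAlgebra (N : ℕ) (L : ℝ) : StarSubalgebra ℂ C(Config N L, ℂ) where
  toSubalgebra := Algebra.adjoin ℂ (Set.range character)
  star_mem' := by
    change Algebra.adjoin ℂ (Set.range character) ≤ star (Algebra.adjoin ℂ (Set.range character))
    refine Algebra.adjoin_le ?_
    rintro _ ⟨q, rfl⟩
    refine Algebra.subset_adjoin ⟨-q, ?_⟩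
    ext1 x
    simp only [character, ContinuousMap.coe_mk, ContinuousMap.star_apply, Prod.fst_neg,
      Prod.snd_neg, Pi.neg_apply, fourier_neg, star_mul', RCLike.star_def, map_prod]

theorem characterAlgebra_coe :
    (characterAlgebra N L).toSubalgebra.toSubmodule = Submodule.span ℂ (Set.range character) := by
  apply Algebra.adjoin_eq_span_of_subset
  refine .trans (fun x ↦ Submonoid.closure_induction (fun _ ↦ id) ⟨0, character_zero⟩ ?_)
    Submodule.subset_span
  rintro _ _ _ _ ⟨m, rfl⟩ ⟨n, rfl⟩
  exact ⟨m + n, character_add m n⟩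

variable [Fact (0 < L)]

theorem integral_fourier_eq (m : ℤ) :
    ∫ y : AddCircle L, fourier m y = if m = 0 then (L : ℂ) else 0 := by
  have hL : 0 < L := Fact.out
  have h := congrFun (fourierCoeff_fourier (T := L) m) 0
  simp only [fourierCoeff, neg_zero, fourier_zero, one_smul, AddCircle.integral_haarAddCircle,
    Pi.single_apply] at h
  have h2 := congrArg (fun z => L • z) h
  simp only [smul_inv_smul₀ hL.ne'] at h2
  rw [h2]
  by_cases hm : m = 0
  · simp [hm]
  · simp [hm, Ne.symm hm]

theorem conj_planeWaveFun_mul (q q' : Mode N) (x : Config N L) :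
    conj (planeWaveFun q x) * planeWaveFun q' x = ((L ^ (N + 1))⁻¹ : ℝ) *
      ((∏ n, fourier (q'.1 n - q.1 n) (x.1 n)) * fourier (q'.2 - q.2) x.2) := by
  have hL : 0 < L := Fact.out
  simp only [planeWaveFun, ContinuousMap.coe_mk, map_mul, map_prod, Complex.conj_ofReal,
    ← fourier_neg, sub_eq_add_neg, fourier_add, Finset.prod_mul_distrib]
  have h : (((Real.sqrt (L ^ (N + 1)))⁻¹ : ℝ) : ℂ) * ((Real.sqrt (L ^ (N + 1)))⁻¹ : ℝ) =
      ((L ^ (N + 1))⁻¹ : ℝ) := by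
    rw [← Complex.ofReal_mul, ← mul_inv, Real.mul_self_sqrt (by positivity)]
  rw [← h]
  ring

theorem orthonormal_planeWave : Orthonormal ℂ (planeWave (N := N) (L := L)) := by
  have hL : 0 < L := Fact.out
  rw [orthonormal_iff_ite]
  intro q q'
  simp only [planeWave, ContinuousMap.inner_toLp]
  have h1 : ∀ x : Config N L, planeWaveFun q' x * conj (planeWaveFun q x) =
      ((L ^ (N + 1))⁻¹ : ℝ) * ((∏ n, fourier (q'.1 n - q.1 n) (x.1 n)) *
        fourier (q'.2 - q.2) x.2) := fun x => by rw [mul_comm, conj_planeWaveFun_mul]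
  simp only [h1]
  rw [integral_const_mul]
  have h2 := integral_prod_mul (μ := (volume : Measure (Fin N → AddCircle L)))
    (ν := (volume : Measure (AddCircle L)))
    (fun x => ∏ n, fourier (q'.1 n - q.1 n) (x n)) (fun y => (fourier (q'.2 - q.2) y : ℂ))
  have h3 := integral_fintype_prod_volume_eq_prod (𝕜 := ℂ) (E := fun _ : Fin N => AddCircle L)
    (fun n y => fourier (q'.1 n - q.1 n) y)
  rw [show (volume : Measure (Config N L)) = (volume : Measure (Fin N → AddCircle L)).prod
    (volume : Measure (AddCircle L)) from rfl, h2, h3]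
  simp only [integral_fourier_eq]
  split_ifs with h0 h h
  · subst h
    simp only [sub_self, if_true, Finset.prod_const, Finset.card_univ, Fintype.card_fin]
    rw [← pow_succ]
    push_cast
    exact inv_mul_cancel₀ (pow_ne_zero _ (by exact_mod_cast hL.ne'))
  · have hne : ∃ n, q'.1 n - q.1 n ≠ 0 := by
      by_contra! hc
      exact h (Prod.ext (funext fun n => (sub_eq_zero.1 (hc n)).symm) (sub_eq_zero.1 h0).symm)
    obtain ⟨n, hn⟩ := hne
    rw [Finset.prod_eq_zero (Finset.mem_univ n) (by rw [if_neg hn])]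
    simp
  · exact absurd (by rw [h, sub_self]) h0
  · simp

theorem characterAlgebra_separatesPoints : (characterAlgebra N L).SeparatesPoints := by
  have hL : L ≠ 0 := (Fact.out : 0 < L).ne'
  intro x y hxy
  have hinj : ∀ a b : AddCircle L, a ≠ b → (fourier 1 a : ℂ) ≠ fourier 1 b := fun a b hab => by
    rw [fourier_one, fourier_one]
    exact fun h => hab (AddCircle.injective_toCircle hL (Circle.ext h))
  by_cases h2 : x.2 = y.2
  · have h1 : ∃ n, x.1 n ≠ y.1 n := by
      by_contra! hc
      exact hxy (Prod.ext (funext hc) h2)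
    obtain ⟨n, hn⟩ := h1
    refine ⟨_, ⟨character (Pi.single n 1, 0), Algebra.subset_adjoin ⟨_, rfl⟩, rfl⟩, ?_⟩
    have hv : ∀ z : Config N L, character (Pi.single n 1, 0) z = fourier 1 (z.1 n) := fun z => by
      simp only [character, ContinuousMap.coe_mk, fourier_zero, mul_one]
      rw [Finset.prod_eq_single n]
      · rw [Pi.single_eq_same]
      · intro m _ hm
        rw [Pi.single_eq_of_ne hm, fourier_zero]
      · simp
    change (character (Pi.single n 1, 0) : C(Config N L, ℂ)) x ≠ character (Pi.single n 1, 0) y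
    rw [hv, hv]
    exact hinj _ _ hn
  · refine ⟨_, ⟨character (0, 1), Algebra.subset_adjoin ⟨_, rfl⟩, rfl⟩, ?_⟩
    have hv : ∀ z : Config N L, character (0, 1) z = fourier 1 z.2 := fun z => by
      simp [character]
    change (character (0, 1) : C(Config N L, ℂ)) x ≠ character (0, 1) y
    rw [hv, hv]
    exact hinj _ _ h2

/-- Stone–Weierstrass; the span of the characters is already an algebra because characters multiply
to characters. -/
theorem span_character_closure_eq_top :
    (Submodule.span ℂ (Set.range (character (N := N) (L := L)))).topologicalClosure = ⊤ := by
  rw [← characterAlgebra_coe]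
  exact congr_arg (Subalgebra.toSubmodule <| StarSubalgebra.toSubalgebra ·)
    (ContinuousMap.starSubalgebra_topologicalClosure_eq_top_of_separatesPoints _
      characterAlgebra_separatesPoints)

theorem span_planeWave_closure_eq_top :
    (Submodule.span ℂ (Set.range (planeWave (N := N) (L := L)))).topologicalClosure = ⊤ := by
  have hL : 0 < L := Fact.out
  have hs : (Real.sqrt (L ^ (N + 1)) : ℂ) ≠ 0 := by
    exact_mod_cast (Real.sqrt_pos.2 (by positivity)).ne'
  have h1 := (ContinuousMap.toLp_denseRange (p := 2) ℂ (volume : Measure (Config N L)) ℂ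
    (by norm_num)).topologicalClosure_map_submodule (span_character_closure_eq_top (N := N) (L := L))
  rw [eq_top_iff, ← h1]
  apply Submodule.topologicalClosure_mono
  rw [Submodule.map_span, Submodule.span_le]
  rintro _ ⟨_, ⟨q, rfl⟩, rfl⟩
  have h2 : (character q : C(Config N L, ℂ)) =
      (Real.sqrt (L ^ (N + 1)) : ℂ) • planeWaveFun q := by
    ext x
    simp only [character, planeWaveFun, ContinuousMap.coe_mk, ContinuousMap.smul_apply,
      smul_eq_mul]
    push_cast
    field_simp
  rw [h2]
  change (ContinuousMap.toLp 2 volume ℂ) ((Real.sqrt (L ^ (N + 1)) : ℂ) • planeWaveFun q) ∈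
    Submodule.span ℂ (Set.range (planeWave (N := N) (L := L)))
  rw [map_smul]
  exact Submodule.smul_mem _ _ (Submodule.subset_span ⟨q, rfl⟩)

/-- The Hilbert basis of plane waves. -/
def planeWaveBasis (N : ℕ) (L : ℝ) [Fact (0 < L)] : HilbertBasis (Mode N) ℂ (WaveFn N L) :=
  HilbertBasis.mk orthonormal_planeWave span_planeWave_closure_eq_top.ge

theorem planeWaveBasis_apply (q : Mode N) : planeWaveBasis N L q = planeWave q := by
  rw [planeWaveBasis, HilbertBasis.coe_mk]

theorem amplitude_add (ψ χ : WaveFn N L) (q : Mode N) :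
    amplitude (ψ + χ) q = amplitude ψ q + amplitude χ q := inner_add_right _ _ _

theorem amplitude_smul (c : ℂ) (ψ : WaveFn N L) (q : Mode N) :
    amplitude (c • ψ) q = c * amplitude ψ q := inner_smul_right _ _ _

theorem amplitude_sum {ι : Type*} (s : Finset ι) (f : ι → WaveFn N L) (q : Mode N) :
    amplitude (∑ i ∈ s, f i) q = ∑ i ∈ s, amplitude (f i) q := inner_sum _ _ _

open Classical in
theorem amplitude_planeWave (q q' : Mode N) :
    amplitude (planeWave (L := L) q') q = if q = q' then 1 else 0 :=
  orthonormal_iff_ite.1 orthonormal_planeWave q q'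

theorem amplitude_ext {ψ χ : WaveFn N L} (h : ∀ q, amplitude ψ q = amplitude χ q) : ψ = χ :=
  (planeWaveBasis N L).ext_inner fun q => by rw [planeWaveBasis_apply]; exact h q

theorem hasSum_amplitude (φ ψ : WaveFn N L) :
    HasSum (fun q => conj (amplitude φ q) * amplitude ψ q) (inner ℂ φ ψ) := by
  have := (planeWaveBasis N L).hasSum_inner_mul_inner φ ψ
  simpa only [planeWaveBasis_apply, amplitude, inner_conj_symm] using this

theorem hasSum_norm_sq_amplitude (ψ : WaveFn N L) :
    HasSum (fun q => ‖amplitude ψ q‖ ^ 2) (‖ψ‖ ^ 2) := by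
  have := Complex.reCLM.hasSum (hasSum_amplitude ψ ψ)
  rw [inner_self_eq_norm_sq_to_K] at this
  convert this using 1
  · funext q
    rw [Complex.conj_mul', Complex.reCLM_apply]
    norm_cast
  · norm_cast

theorem summable_norm_sq_amplitude (ψ : WaveFn N L) :
    Summable fun q => ‖amplitude ψ q‖ ^ 2 := (hasSum_norm_sq_amplitude ψ).summable

/-- Riesz–Fischer for the plane-wave basis; it allows operators to be defined by their action on
amplitudes. -/
theorem exists_amplitude_eq {f : Mode N → ℂ} (hf : Summable fun q => ‖f q‖ ^ 2) :
    ∃ ψ : WaveFn N L, ∀ q, amplitude ψ q = f q := by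
  have hm : Memℓp f 2 := by
    apply memℓp_gen
    simpa using hf
  refine ⟨(planeWaveBasis N L).repr.symm ⟨f, hm⟩, fun q => ?_⟩
  have := (planeWaveBasis N L).repr_apply_apply ((planeWaveBasis N L).repr.symm ⟨f, hm⟩) q
  rw [planeWaveBasis_apply] at this
  rw [amplitude, ← this, LinearIsometryEquiv.apply_symm_apply]

/-! ### The fermionic space in momentum representation -/

/-- The mode with permuted host momenta. -/
def permuteMode (σ : Equiv.Perm (Fin N)) (q : Mode N) : Mode N := (fun n => q.1 (σ n), q.2)

/-- `permuteWave` as an isometry. -/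
def permuteIsometry (σ : Equiv.Perm (Fin N)) : WaveFn N L →ₗᵢ[ℂ] WaveFn N L where
  toLinearMap := permuteWave σ
  norm_map' ψ := Lp.norm_compMeasurePreserving ψ (measurePreserving_permuteConfig σ)

theorem amplitude_permuteWave (σ : Equiv.Perm (Fin N)) (ψ : WaveFn N L) (q : Mode N) :
    amplitude (permuteWave σ ψ) q = amplitude ψ (permuteMode σ q) := by
  have h1 : planeWave (L := L) q = permuteIsometry σ (planeWave (permuteMode σ q)) := by
    change _ = permuteWave σ (planeWave (permuteMode σ q))
    rw [permuteWave_planeWave]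
    simp [permuteMode]
  rw [amplitude, h1]
  exact (permuteIsometry σ).inner_map_map _ _

theorem mem_fermiSpace_iff (ψ : WaveFn N L) : ψ ∈ FermiSpace N L ↔
    ∀ (σ : Equiv.Perm (Fin N)) (q : Mode N),
      amplitude ψ (permuteMode σ q) = ((Equiv.Perm.sign σ : ℤ) : ℂ) * amplitude ψ q := by
  constructor
  · intro h σ q
    rw [← amplitude_permuteWave, h σ, amplitude_smul]
  · intro h σ
    refine amplitude_ext fun q => ?_
    rw [amplitude_permuteWave, h, amplitude_smul]

/-- Pauli principle. -/
theorem amplitude_eq_zero_of_not_injective {ψ : WaveFn N L} (hψ : ψ ∈ FermiSpace N L) {q : Mode N}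
    (hq : ¬ Function.Injective q.1) : amplitude ψ q = 0 := by
  simp only [Function.Injective, not_forall] at hq
  obtain ⟨a, b, hab, hne⟩ := hq
  have h := (mem_fermiSpace_iff ψ).1 hψ (Equiv.swap a b) q
  have hp : permuteMode (Equiv.swap a b) q = q := by
    refine Prod.ext (funext fun n => ?_) rfl
    simp only [permuteMode]
    by_cases h1 : n = a
    · subst h1; rw [Equiv.swap_apply_left, hab]
    · by_cases h2 : n = b
      · subst h2; rw [Equiv.swap_apply_right, hab]
      · rw [Equiv.swap_apply_of_ne_of_ne h1 h2]
  rw [hp, Equiv.Perm.sign_swap hne] at h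
  simp only [Units.val_neg, Units.val_one, Int.cast_neg, Int.cast_one, neg_mul, one_mul] at h
  linear_combination h / 2

theorem isClosed_fermiSpace : IsClosed (FermiSpace N L : Set (WaveFn N L)) := by
  have : (FermiSpace N L : Set (WaveFn N L)) = ⋂ σ : Equiv.Perm (Fin N),
      {ψ | permuteIsometry σ ψ = ((Equiv.Perm.sign σ : ℤ) : ℂ) • ψ} := by
    ext ψ
    simp only [Set.mem_iInter]
    rfl
  rw [this]
  exact isClosed_iInter fun σ => isClosed_eq (permuteIsometry σ).continuous
    (continuous_const_smul _)

instance : CompleteSpace (FermiSpace N L) := isClosed_fermiSpace.completeSpace_coe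

theorem fermi_ext {ψ χ : FermiSpace N L}
    (h : ∀ q, amplitude (ψ : WaveFn N L) q = amplitude (χ : WaveFn N L) q) : ψ = χ :=
  Subtype.ext (amplitude_ext h)

theorem fermi_inner (φ ψ : FermiSpace N L) :
    (inner ℂ φ ψ : ℂ) = inner ℂ (φ : WaveFn N L) (ψ : WaveFn N L) := rfl

/-- Multiplication operators in momentum space. -/
theorem exists_diagonal_operator {g : Mode N → ℝ} {C : ℝ} (hC : ∀ q, |g q| ≤ C)
    (hsym : ∀ σ q, g (permuteMode σ q) = g q) :
    ∃ T : FermiSpace N L →L[ℂ] FermiSpace N L, (∀ ψ : FermiSpace N L, ∀ q,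
      amplitude (T ψ : WaveFn N L) q = g q * amplitude (ψ : WaveFn N L) q) ∧ ‖T‖ ≤ C := by
  have hC0 : 0 ≤ C := (abs_nonneg _).trans (hC 0)
  have hb : ∀ (ψ : WaveFn N L) q, ‖(g q : ℂ) * amplitude ψ q‖ ^ 2 ≤ C ^ 2 * ‖amplitude ψ q‖ ^ 2 :=
    fun ψ q => by
      rw [norm_mul, mul_pow, Complex.norm_real, Real.norm_eq_abs]
      gcongr
      exact hC q
  have hex : ∀ ψ : FermiSpace N L, ∃ χ : FermiSpace N L, ∀ q,
      amplitude (χ : WaveFn N L) q = g q * amplitude (ψ : WaveFn N L) q := fun ψ => by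
    obtain ⟨χ, hχ⟩ := exists_amplitude_eq (L := L)
      (f := fun q => (g q : ℂ) * amplitude (ψ : WaveFn N L) q)
      (Summable.of_nonneg_of_le (fun _ => sq_nonneg _) (hb ψ)
        ((summable_norm_sq_amplitude _).mul_left _))
    refine ⟨⟨χ, (mem_fermiSpace_iff χ).2 fun σ q => ?_⟩, hχ⟩
    rw [hχ, hχ, hsym, (mem_fermiSpace_iff _).1 ψ.2 σ q]
    ring
  choose T hT using hex
  let Tl : FermiSpace N L →ₗ[ℂ] FermiSpace N L :=
    { toFun := T
      map_add' := fun a b => fermi_ext fun q => by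
        rw [hT, Submodule.coe_add, Submodule.coe_add, amplitude_add, amplitude_add, hT, hT]; ring
      map_smul' := fun c a => fermi_ext fun q => by
        rw [hT, RingHom.id_apply, Submodule.coe_smul, Submodule.coe_smul, amplitude_smul,
          amplitude_smul, hT]; ring }
  have hbound : ∀ ψ, ‖Tl ψ‖ ≤ C * ‖ψ‖ := fun ψ => by
    refine le_of_sq_le_sq ?_ (by positivity)
    have h1 := hasSum_norm_sq_amplitude (T ψ : WaveFn N L)
    have h2 := (hasSum_norm_sq_amplitude (ψ : WaveFn N L)).mul_left (C ^ 2)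
    rw [mul_pow]
    exact hasSum_le (fun q => by rw [hT]; exact hb ψ q) h1 h2
  exact ⟨Tl.mkContinuous C hbound, hT, LinearMap.mkContinuous_norm_le _ hC0 _⟩

/-- A momentum-space multiplication operator is compact if its symbol tends to `0`. -/
theorem isCompactOperator_of_amplitude {g : Mode N → ℝ}
    (hsym : ∀ σ q, g (permuteMode σ q) = g q)
    (hg : ∀ ε > 0, {q | ε < |g q|}.Finite) {T : FermiSpace N L →L[ℂ] FermiSpace N L}
    (hT : ∀ ψ : FermiSpace N L, ∀ q,
      amplitude (T ψ : WaveFn N L) q = g q * amplitude (ψ : WaveFn N L) q) :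
    IsCompactOperator T := by
  classical
  have happrox : ∀ ε > 0, ∃ T' : FermiSpace N L →L[ℂ] FermiSpace N L,
      IsCompactOperator T' ∧ ‖T - T'‖ ≤ ε := fun ε hε => by
    -- D keeps only the part of the symbol of size at most ε. The remainder T - D is supported on
    -- finitely many modes, hence has finite rank.
    obtain ⟨D, hD, hDn⟩ := exists_diagonal_operator (L := L)
      (g := fun q => if ε < |g q| then 0 else g q) (C := ε)
      (fun q => by
        split_ifs with h
        · simpa using hε.le
        · exact not_lt.1 h)
      (fun σ q => by rw [hsym])
    refine ⟨T - D, ?_, by simpa using hDn⟩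
    let F := (hg ε hε).toFinset
    have hzero : ∀ ψ q, q ∉ F → amplitude ((T - D) ψ : WaveFn N L) q = 0 := fun ψ q hq => by
      have hq' : ¬ ε < |g q| := by simpa [F] using hq
      have h1 : ((T - D) ψ : WaveFn N L) = (T ψ : WaveFn N L) + (-1 : ℂ) • (D ψ : WaveFn N L) := by
        simp [sub_eq_add_neg]
      rw [h1, amplitude_add, amplitude_smul, hT, hD, if_neg hq']
      ring
    let V : Submodule ℂ (FermiSpace N L) := LinearMap.range (T - D).toLinearMap
    let ev : V →ₗ[ℂ] (F → ℂ) :=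
      { toFun := fun ψ q => amplitude ((ψ : FermiSpace N L) : WaveFn N L) q
        map_add' := fun a b => funext fun q => amplitude_add _ _ _
        map_smul' := fun c a => funext fun q => amplitude_smul _ _ _ }
    have hinj : Function.Injective ev := by
      rintro ⟨a, ψ, rfl⟩ ⟨b, χ, rfl⟩ hab
      refine Subtype.ext (fermi_ext fun q => ?_)
      by_cases hq : q ∈ F
      · exact congrFun hab ⟨q, hq⟩
      · exact (hzero ψ q hq).trans (hzero χ q hq).symm
    have hfin : FiniteDimensional ℂ V := FiniteDimensional.of_injective ev hinj
    let T₁ : FermiSpace N L →L[ℂ] V := (T - D).codRestrict V fun ψ => ⟨ψ, rfl⟩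
    have h1 : IsCompactOperator T₁ := by
      have : ProperSpace V := FiniteDimensional.proper ℂ V
      exact isCompactOperator_of_locallyCompactSpace_dom T₁
    exact h1.clm_comp V.subtypeL
  choose A hA1 hA2 using fun n : ℕ => happrox (1 / ((n : ℝ) + 1)) (by positivity)
  refine isCompactOperator_of_tendsto (l := atTop) (F := A) ?_ (Eventually.of_forall hA1)
  have hlim : Tendsto (fun n => ‖A n - T‖) atTop (𝓝 0) := by
    refine squeeze_zero (fun n => norm_nonneg (A n - T)) (fun n => ?_)
      tendsto_one_div_add_atTop_nhds_zero_nat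
    exact (norm_sub_rev (A n) T).trans_le (hA2 n)
  exact (tendsto_iff_norm_sub_tendsto_zero (E := FermiSpace N L →L[ℂ] FermiSpace N L)).2 hlim

end PlaneWaves

end

section

/-! ### Pair densities -/

section PairDensity

variable {N : ℕ} {L : ℝ}

theorem measurable_relative (n : Fin N) :
    Measurable fun x : Config N L => x.1 n - x.2 :=
  Continuous.measurable (by fun_prop)

/-- Transfer of `m` units of momentum from the impurity to the host particle `n`. -/
def shiftMode (n : Fin N) (m : ℤ) (q : Mode N) : Mode N := (q.1 + Pi.single n m, q.2 - m)

theorem shiftMode_neg_shiftMode (n : Fin N) (m : ℤ) (q : Mode N) :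
    shiftMode n (-m) (shiftMode n m q) = q := by
  refine Prod.ext ?_ ?_
  · simp [shiftMode, Pi.single_neg]
  · simp [shiftMode]

/-- Momentum conservation of the pair interaction, the reason why the sector projection commutes
with B. -/
theorem totalMomentum_shiftMode (n : Fin N) (m : ℤ) (q : Mode N) :
    ∑ i, (shiftMode n m q).1 i + (shiftMode n m q).2 = ∑ i, q.1 i + q.2 := by
  simp [shiftMode, Finset.sum_add_distrib]

theorem fourier_sub_apply (m : ℤ) (a b : AddCircle L) :
    (fourier m (a - b) : ℂ) = fourier m a * fourier (-m) b := by
  rw [fourier_apply, fourier_apply, fourier_apply, zsmul_sub, sub_eq_add_neg,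
    AddCircle.toCircle_add, neg_smul, Circle.coe_mul]

theorem fourier_mul_planeWaveFun (n : Fin N) (m : ℤ) (q : Mode N) (x : Config N L) :
    fourier m (x.1 n - x.2) * planeWaveFun q x = planeWaveFun (shiftMode n m q) x := by
  simp only [planeWaveFun, ContinuousMap.coe_mk, shiftMode, Pi.add_apply, fourier_add,
    Finset.prod_mul_distrib, sub_eq_add_neg q.2]
  have h : ∏ i, (fourier ((Pi.single n m : Fin N → ℤ) i) (x.1 i) : ℂ) = fourier m (x.1 n) := by
    rw [Finset.prod_eq_single n]
    · rw [Pi.single_eq_same]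
    · intro i _ hi
      rw [Pi.single_eq_of_ne hi, fourier_zero]
    · simp
  rw [h, fourier_sub_apply]
  ring

variable [Fact (0 < L)]

/-- The functional `h ↦ ∫ h(g x) w(x) dμ` on continuous functions on the ring. -/
def pushFunctional {X : Type*} [MeasurableSpace X] (μ : Measure X) {g : X → AddCircle L}
    (hg : Measurable g) {w : X → ℂ} (hw : Integrable w μ) : C(AddCircle L, ℂ) →L[ℂ] ℂ :=
  have hint : ∀ h : C(AddCircle L, ℂ), Integrable (fun x => h (g x) * w x) μ := fun h =>
    hw.bdd_mul (c := ‖h‖) (h.continuous.measurable.comp hg).aestronglyMeasurable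
      (Eventually.of_forall fun _ => h.norm_coe_le_norm _)
  LinearMap.mkContinuous
    { toFun := fun h => ∫ x, h (g x) * w x ∂μ
      map_add' := fun h h' => by
        rw [← integral_add (hint h) (hint h')]
        simp only [ContinuousMap.add_apply, add_mul]
      map_smul' := fun c h => by
        rw [RingHom.id_apply, smul_eq_mul, ← integral_const_mul]
        simp only [ContinuousMap.smul_apply, smul_eq_mul, mul_assoc] }
    (∫ x, ‖w x‖ ∂μ) fun h => by
      rw [mul_comm, ← integral_const_mul]
      refine norm_integral_le_of_norm_le (hw.norm.const_mul _) (Eventually.of_forall fun x => ?_)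
      rw [norm_mul]
      gcongr
      exact h.norm_coe_le_norm _

theorem pushFunctional_apply {X : Type*} [MeasurableSpace X] {μ : Measure X} {g : X → AddCircle L}
    (hg : Measurable g) {w : X → ℂ} (hw : Integrable w μ) (h : C(AddCircle L, ℂ)) :
    pushFunctional μ hg hw h = ∫ x, h (g x) * w x ∂μ := rfl

theorem integrable_conj_mul (φ ψ : WaveFn N L) : Integrable fun x => conj (φ x) * ψ x := by
  have := L2.integrable_inner (𝕜 := ℂ) φ ψ
  simpa only [RCLike.inner_apply, mul_comm] using this

theorem inner_waveFn (φ ψ : WaveFn N L) : (inner ℂ φ ψ : ℂ) = ∫ x, conj (φ x) * ψ x := by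
  rw [L2.inner_def]
  simp only [RCLike.inner_apply, mul_comm]

theorem integrable_continuous_ring (ρ : C(AddCircle L, ℂ)) :
    Integrable (fun y : AddCircle L => ρ y) :=
  ρ.continuous.integrable_of_hasCompactSupport (HasCompactSupport.of_compactSpace _)

/-- A pair density is determined by its Fourier coefficients. -/
theorem isPairDensity_of_fourier {n : Fin N} {φ ψ : WaveFn N L} {ρ : C(AddCircle L, ℂ)}
    (h : ∀ m : ℤ, ∫ x : Config N L, fourier m (x.1 n - x.2) * (conj (φ x) * ψ x) =
      ∫ y : AddCircle L, fourier m y * ρ y) : IsPairDensity n φ ψ ρ := by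
  have key : pushFunctional volume (measurable_relative n) (integrable_conj_mul φ ψ) =
      pushFunctional volume measurable_id (integrable_continuous_ring ρ) := by
    refine ContinuousLinearMap.ext_on (s := Set.range (fourier (T := L))) ?_ ?_
    · rw [← Submodule.dense_iff_topologicalClosure_eq_top.symm.eq]
      exact span_fourier_closure_eq_top
    · rintro _ ⟨m, rfl⟩
      exact h m
  exact fun f => DFunLike.congr_fun key f

/-- Testing with the conjugate of ρ - ρ' gives ∫|ρ - ρ'|² = 0; continuity upgrades almost everywhere
to everywhere. This makes the choice in `pairDensity` harmless and the potential form linear. -/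
theorem IsPairDensity.unique {n : Fin N} {φ ψ : WaveFn N L} {ρ ρ' : C(AddCircle L, ℂ)}
    (h : IsPairDensity n φ ψ ρ) (h' : IsPairDensity n φ ψ ρ') : ρ = ρ' := by
  have h1 : ∫ y : AddCircle L, (star (ρ - ρ')) y * (ρ - ρ') y = 0 := by
    have e := (h (star (ρ - ρ'))).symm.trans (h' (star (ρ - ρ')))
    have i1 := integrable_continuous_ring (star (ρ - ρ') * ρ)
    have i2 := integrable_continuous_ring (star (ρ - ρ') * ρ')
    simp only [ContinuousMap.sub_apply, mul_sub]
    exact (integral_sub i1 i2).trans (by rw [sub_eq_zero]; exact e)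
  have h2 : ∫ y : AddCircle L, ‖(ρ - ρ') y‖ ^ 2 = 0 := by
    have e : ∀ y, (star (ρ - ρ')) y * (ρ - ρ') y = ((‖(ρ - ρ') y‖ ^ 2 : ℝ) : ℂ) := fun y => by
      rw [ContinuousMap.star_apply, RCLike.star_def, Complex.conj_mul']
      push_cast
      rfl
    simp only [e] at h1
    have h3 := (integral_ofReal (𝕜 := ℂ) (μ := (volume : Measure (AddCircle L)))
      (f := fun y => ‖(ρ - ρ') y‖ ^ 2)).symm.trans h1
    exact Complex.ofReal_eq_zero.1 h3
  have hc : Continuous fun y => ‖(ρ - ρ') y‖ ^ 2 := by fun_prop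
  rw [integral_eq_zero_iff_of_nonneg (fun y => sq_nonneg _)
    (hc.integrable_of_hasCompactSupport (HasCompactSupport.of_compactSpace _))] at h2
  have h3 := (Continuous.ae_eq_iff_eq volume hc continuous_const).1 h2
  ext y
  have h4 : ‖(ρ - ρ') y‖ ^ 2 = 0 := congrFun h3 y
  rw [sq_eq_zero_iff, norm_eq_zero, ContinuousMap.sub_apply] at h4
  exact sub_eq_zero.1 h4

theorem IsPairDensity.pairDensity_eq {n : Fin N} {φ ψ : WaveFn N L} {ρ : C(AddCircle L, ℂ)}
    (h : IsPairDensity n φ ψ ρ) : pairDensity n φ ψ = ρ := by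
  have hex : ∃ ρ, IsPairDensity n φ ψ ρ := ⟨ρ, h⟩
  rw [pairDensity, dif_pos hex]
  exact hex.choose_spec.unique h

theorem integrable_test (n : Fin N) (φ ψ : WaveFn N L) (h : C(AddCircle L, ℂ)) :
    Integrable fun x : Config N L => h (x.1 n - x.2) * (conj (φ x) * ψ x) :=
  (integrable_conj_mul φ ψ).bdd_mul (c := ‖h‖)
    (h.continuous.measurable.comp (measurable_relative n)).aestronglyMeasurable
    (Eventually.of_forall fun _ => h.norm_coe_le_norm _)

theorem IsPairDensity.add_right {n : Fin N} {φ ψ ψ' : WaveFn N L} {ρ ρ' : C(AddCircle L, ℂ)}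
    (h : IsPairDensity n φ ψ ρ) (h' : IsPairDensity n φ ψ' ρ') :
    IsPairDensity n φ (ψ + ψ') (ρ + ρ') := by
  intro f
  have e1 : (fun x : Config N L => f (x.1 n - x.2) * (conj (φ x) * (ψ + ψ' : WaveFn N L) x))
      =ᵐ[volume] fun x => f (x.1 n - x.2) * (conj (φ x) * ψ x) +
        f (x.1 n - x.2) * (conj (φ x) * ψ' x) := by
    filter_upwards [Lp.coeFn_add ψ ψ'] with x hx
    rw [hx, Pi.add_apply]
    ring
  rw [integral_congr_ae e1, integral_add (integrable_test n φ ψ f) (integrable_test n φ ψ' f),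
    h f, h' f]
  have i1 := integrable_continuous_ring (f * ρ)
  have i2 := integrable_continuous_ring (f * ρ')
  simp only [ContinuousMap.add_apply, mul_add]
  exact (integral_add i1 i2).symm

theorem IsPairDensity.smul_right {n : Fin N} {φ ψ : WaveFn N L} {ρ : C(AddCircle L, ℂ)}
    (h : IsPairDensity n φ ψ ρ) (c : ℂ) : IsPairDensity n φ (c • ψ) (c • ρ) := by
  intro f
  have e1 : (fun x : Config N L => f (x.1 n - x.2) * (conj (φ x) * (c • ψ : WaveFn N L) x))
      =ᵐ[volume] fun x => c * (f (x.1 n - x.2) * (conj (φ x) * ψ x)) := by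
    filter_upwards [Lp.coeFn_smul c ψ] with x hx
    rw [hx, Pi.smul_apply, smul_eq_mul]
    ring
  rw [integral_congr_ae e1, integral_const_mul, h f, ← integral_const_mul]
  refine integral_congr_ae (Eventually.of_forall fun y => ?_)
  simp only [ContinuousMap.smul_apply, smul_eq_mul]
  ring

theorem IsPairDensity.symm {n : Fin N} {φ ψ : WaveFn N L} {ρ : C(AddCircle L, ℂ)}
    (h : IsPairDensity n φ ψ ρ) : IsPairDensity n ψ φ (star ρ) := by
  intro f
  have h1 := congrArg conj (h (star f))
  rw [← integral_conj, ← integral_conj] at h1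
  simp only [map_mul, ContinuousMap.star_apply, RCLike.star_def, Complex.conj_conj] at h1
  simp only [ContinuousMap.star_apply, RCLike.star_def]
  rw [← h1]
  refine integral_congr_ae (Eventually.of_forall fun x => ?_)
  change f (x.1 n - x.2) * (conj (ψ x) * φ x) = f (x.1 n - x.2) * (φ x * conj (ψ x))
  ring

/-! #### Fourier coefficients of the pair density -/

/-- Fourier coefficients of the density of `xₙ - xᵢ` in terms of the amplitudes. -/
theorem hasSum_fourier_density (n : Fin N) (m : ℤ) (φ ψ : WaveFn N L) :
    HasSum (fun q => conj (amplitude φ (shiftMode n m q)) * amplitude ψ q)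
      (∫ x : Config N L, fourier m (x.1 n - x.2) * (conj (φ x) * ψ x)) := by
  have hmem : MemLp (fun x : Config N L => conj (fourier m (x.1 n - x.2)) * φ x) 2 volume := by
    refine (Lp.memLp φ).of_le_mul (c := 1) ?_ (Eventually.of_forall fun x => ?_)
    · refine AEStronglyMeasurable.mul ?_ (Lp.aestronglyMeasurable φ)
      exact Continuous.aestronglyMeasurable (by fun_prop)
    · rw [norm_mul, RCLike.norm_conj, norm_fourier_apply]
  -- The exponential is absorbed into φ: the Fourier coefficient is ⟨g|ψ⟩, and Parseval applies, the
  -- amplitudes of g being shifted amplitudes of φ.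
  set g : WaveFn N L := hmem.toLp with hg
  have hgae : g =ᵐ[volume] fun x : Config N L => conj (fourier m (x.1 n - x.2)) * φ x :=
    hmem.coeFn_toLp
  have hin : ∀ χ : WaveFn N L, (inner ℂ g χ : ℂ) =
      ∫ x : Config N L, fourier m (x.1 n - x.2) * (conj (φ x) * χ x) := fun χ => by
    rw [inner_waveFn]
    refine integral_congr_ae ?_
    filter_upwards [hgae] with x hx
    rw [hx, map_mul, Complex.conj_conj, mul_assoc]
  rw [← hin ψ]
  convert hasSum_amplitude g ψ using 2 with q
  congr 1
  rw [amplitude, amplitude, inner_conj_symm, inner_conj_symm, hin, inner_waveFn]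
  have h2 : (planeWave (L := L) q) =ᵐ[volume] planeWaveFun q := ContinuousMap.coeFn_toLp _ _
  have h3 : (planeWave (L := L) (shiftMode n m q)) =ᵐ[volume] planeWaveFun (shiftMode n m q) :=
    ContinuousMap.coeFn_toLp _ _
  refine integral_congr_ae ?_
  filter_upwards [h2, h3] with x h2 h3
  rw [h2, h3, ← fourier_mul_planeWaveFun]
  ring

/-- Absolute summability of the Fourier coefficients makes the Fourier series converge in sup norm,
so the density is continuous and can be integrated against any finite measure, including a point
mass. -/
theorem exists_isPairDensity (n : Fin N) {φ ψ : WaveFn N L}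
    (hs : Summable fun p : ℤ × Mode N =>
      ‖amplitude φ (shiftMode n p.1 p.2)‖ * ‖amplitude ψ p.2‖) :
    ∃ ρ, IsPairDensity n φ ψ ρ ∧
      ‖ρ‖ ≤ L⁻¹ * ∑' p : ℤ × Mode N, ‖amplitude φ (shiftMode n p.1 p.2)‖ * ‖amplitude ψ p.2‖ := by
  have hL : 0 < L := Fact.out
  set c : ℤ → ℂ := fun m => ∫ x : Config N L, fourier m (x.1 n - x.2) * (conj (φ x) * ψ x) with hc
  set T : ℤ → ℝ := fun m => ∑' q, ‖amplitude φ (shiftMode n m q)‖ * ‖amplitude ψ q‖ with hT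
  have hfib : ∀ m, Summable fun q => ‖amplitude φ (shiftMode n m q)‖ * ‖amplitude ψ q‖ :=
    fun m => hs.prod_factor m
  have hTs : HasSum T (∑' p : ℤ × Mode N,
      ‖amplitude φ (shiftMode n p.1 p.2)‖ * ‖amplitude ψ p.2‖) :=
    hs.hasSum.prod_fiberwise fun m => (hfib m).hasSum
  have hcT : ∀ m, ‖c m‖ ≤ T m := fun m => by
    rw [hc]
    simp only
    rw [← (hasSum_fourier_density n m φ ψ).tsum_eq]
    refine (norm_tsum_le_tsum_norm ?_).trans_eq ?_
    · simpa only [norm_mul, RCLike.norm_conj] using hfib m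
    · simp only [norm_mul, RCLike.norm_conj, hT]
  -- Testing with `fourier m` detects the frequency -m, and the ring has volume L.
  let f : ℤ → C(AddCircle L, ℂ) := fun m => ((L⁻¹ : ℝ) * c m : ℂ) • fourier (-m)
  have hfn : ∀ m, ‖f m‖ ≤ L⁻¹ * T m := fun m => by
    rw [norm_smul, fourier_norm, mul_one, norm_mul, Complex.norm_real, Real.norm_of_nonneg
      (by positivity)]
    gcongr
    exact hcT m
  have hfs : Summable f := Summable.of_norm_bounded (hTs.summable.mul_left _) hfn
  refine ⟨∑' m, f m, isPairDensity_of_fourier fun m => ?_, ?_⟩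
  · have h1 := (pushFunctional volume measurable_id
      (integrable_continuous_ring (fourier m))).hasSum hfs.hasSum
    have h2 : ∀ k, pushFunctional volume measurable_id
        (integrable_continuous_ring (fourier m)) (f k) = if k = m then c m else 0 := fun k => by
      rw [map_smul, pushFunctional_apply]
      have e : ∀ y : AddCircle L, (fourier (-k) (id y) : ℂ) * fourier m y = fourier (-k + m) y :=
        fun y => by rw [fourier_add]; rfl
      simp only [e, integral_fourier_eq]
      by_cases hk : k = m
      · subst hk
        simp only [neg_add_cancel, if_true, smul_eq_mul]
        have hLc : (L : ℂ) ≠ 0 := by exact_mod_cast hL.ne'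
        push_cast
        field_simp
      · rw [if_neg hk, if_neg (by omega), smul_zero]
    simp only [h2] at h1
    have h3 := h1.unique (hasSum_ite_eq m (c m))
    rw [pushFunctional_apply] at h3
    change c m = _
    rw [← h3]
    refine integral_congr_ae (Eventually.of_forall fun y => ?_)
    exact mul_comm _ _
  · exact tsum_of_norm_bounded (hTs.mul_left _) hfn

/-- Summability and bound behind the existence of pair densities. -/
theorem summable_shift_product {κ : ℤ → ℝ} (hκ : ∀ s, 0 < κ s) (hκs : Summable fun s => (κ s)⁻¹)
    (n : Fin N) {φ ψ u v : WaveFn N L}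
    (hφ : ∀ q, ‖amplitude φ q‖ ≤ (Real.sqrt (κ q.2))⁻¹ * ‖amplitude u q‖)
    (hψ : ∀ q, ‖amplitude ψ q‖ ≤ (Real.sqrt (κ q.2))⁻¹ * ‖amplitude v q‖) :
    (Summable fun p : ℤ × Mode N =>
      ‖amplitude φ (shiftMode n p.1 p.2)‖ * ‖amplitude ψ p.2‖) ∧
    ∑' p : ℤ × Mode N, ‖amplitude φ (shiftMode n p.1 p.2)‖ * ‖amplitude ψ p.2‖ ≤
      (∑' s, (κ s)⁻¹) / 2 * (‖u‖ ^ 2 + ‖v‖ ^ 2) := by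
  set A := ∑' s, (κ s)⁻¹
  have hprod : ∀ w : WaveFn N L,
      HasSum (fun p : Mode N × ℤ => ‖amplitude w p.1‖ ^ 2 * (κ p.2)⁻¹) (‖w‖ ^ 2 * A) := fun w =>
    (hasSum_norm_sq_amplitude w).mul hκs.hasSum
      ((summable_norm_sq_amplitude w).mul_of_nonneg hκs (fun _ => sq_nonneg _)
        fun s => (inv_pos.2 (hκ s)).le)
  -- Each amplitude is to be paired with the weight of the other mode. Final mode and initial
  -- impurity momentum (`e₁`), or initial mode and final impurity momentum (`e₂`), are independent
  -- coordinates on the pairs (m, q), so both double sums factorize.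
  let e₁ : ℤ × Mode N ≃ Mode N × ℤ :=
    { toFun := fun p => (shiftMode n p.1 p.2, p.2.2)
      invFun := fun p => (p.2 - p.1.2, shiftMode n (-(p.2 - p.1.2)) p.1)
      left_inv := fun p => by
        have h : p.2.2 - (shiftMode n p.1 p.2).2 = p.1 := by simp [shiftMode]
        simp only [h, shiftMode_neg_shiftMode]
      right_inv := fun p => by
        refine Prod.ext ?_ ?_
        · have := shiftMode_neg_shiftMode n (-(p.2 - p.1.2)) p.1
          simpa only [neg_neg] using this
        · simp [shiftMode] }
  let e₂ : ℤ × Mode N ≃ Mode N × ℤ :=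
    { toFun := fun p => (p.2, p.2.2 - p.1)
      invFun := fun p => (p.1.2 - p.2, p.1)
      left_inv := fun p => by simp
      right_inv := fun p => by simp }
  have h1 := (e₁.hasSum_iff).2 (hprod u)
  have h2 := (e₂.hasSum_iff).2 (hprod v)
  have h3 := (h1.add h2).mul_left (1 / 2)
  have hle : ∀ p : ℤ × Mode N, ‖amplitude φ (shiftMode n p.1 p.2)‖ * ‖amplitude ψ p.2‖ ≤
      1 / 2 * (((fun p : Mode N × ℤ => ‖amplitude u p.1‖ ^ 2 * (κ p.2)⁻¹) ∘ e₁) p +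
        ((fun p : Mode N × ℤ => ‖amplitude v p.1‖ ^ 2 * (κ p.2)⁻¹) ∘ e₂) p) := fun p => by
    simp only [Function.comp_apply, e₁, e₂, Equiv.coe_fn_mk]
    set q' := shiftMode n p.1 p.2 with hq'
    have hq2 : q'.2 = p.2.2 - p.1 := rfl
    rw [← hq2]
    set x := ‖amplitude u q'‖
    set y := ‖amplitude v p.2‖
    set s := (Real.sqrt (κ q'.2))⁻¹ with hs
    set r := (Real.sqrt (κ p.2.2))⁻¹ with hr
    have hs2 : (κ q'.2)⁻¹ = s ^ 2 := by rw [hs, inv_pow, Real.sq_sqrt (hκ _).le]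
    have hr2 : (κ p.2.2)⁻¹ = r ^ 2 := by rw [hr, inv_pow, Real.sq_sqrt (hκ _).le]
    rw [hs2, hr2]
    have hs0 : 0 ≤ s := by positivity
    have hr0 : 0 ≤ r := by positivity
    calc ‖amplitude φ q'‖ * ‖amplitude ψ p.2‖ ≤ (s * x) * (r * y) := by
          gcongr
          · exact hφ q'
          · exact hψ p.2
      _ ≤ 1 / 2 * (x ^ 2 * r ^ 2 + y ^ 2 * s ^ 2) := by nlinarith [sq_nonneg (x * r - y * s)]
  have hsum := Summable.of_nonneg_of_le (fun p => by positivity) hle h3.summable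
  refine ⟨hsum, ?_⟩
  refine (hsum.tsum_le_tsum hle h3.summable).trans_eq ?_
  rw [h3.tsum_eq]
  ring

end PairDensity

end

section

/-! ### Bounded Hermitian forms -/

section Forms

variable {H : Type*} [NormedAddCommGroup H] [InnerProductSpace ℂ H]

/-- A bounded Hermitian form is given by a bounded symmetric operator. -/
theorem exists_operator_of_form [CompleteSpace H] {f : H → H → ℂ} {K : ℝ} (hK : 0 ≤ K)
    (hadd : ∀ u v v', f u (v + v') = f u v + f u v') (hsmul : ∀ (c : ℂ) u v, f u (c • v) = c * f u v)
    (hsymm : ∀ u v, conj (f u v) = f v u)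
    (hb : ∀ u v, ‖f u v‖ ≤ K / 2 * (‖u‖ ^ 2 + ‖v‖ ^ 2)) :
    ∃ B : H →L[ℂ] H, (∀ u v, (inner ℂ u (B v) : ℂ) = f u v) ∧
      (∀ u v, (inner ℂ (B u) v : ℂ) = inner ℂ u (B v)) ∧ ‖B‖ ≤ K := by
  have hadd' : ∀ u u' v, f (u + u') v = f u v + f u' v := fun u u' v => by
    rw [← hsymm v, hadd, map_add, hsymm, hsymm]
  have hsmul' : ∀ (c : ℂ) u v, f (c • u) v = conj c * f u v := fun c u v => by
    rw [← hsymm v, hsmul, map_mul, hsymm]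
  have hbd : ∀ u v, ‖f u v‖ ≤ K * ‖u‖ * ‖v‖ := fun u v => by
    by_cases hu : u = 0
    · subst hu
      have := hsmul' 0 0 v
      simp only [zero_smul, map_zero, zero_mul] at this
      simp [this]
    by_cases hv : v = 0
    · subst hv
      have := hsmul 0 u 0
      simp only [zero_smul, zero_mul] at this
      simp [this]
    have hu0 : 0 < ‖u‖ := norm_pos_iff.2 hu
    have hv0 : 0 < ‖v‖ := norm_pos_iff.2 hv
    -- Rescaling to unit vectors converts the bound by a sum of squares into a bound by the product
    -- of the norms.
    have h1 := hb ((‖u‖⁻¹ : ℂ) • u) ((‖v‖⁻¹ : ℂ) • v)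
    rw [hsmul, hsmul', norm_mul, norm_mul, norm_smul, norm_smul] at h1
    simp only [RCLike.norm_conj, norm_inv, Complex.norm_real, norm_norm, inv_mul_cancel₀ hu0.ne',
      inv_mul_cancel₀ hv0.ne'] at h1
    have h2 : ‖f u v‖ = (‖v‖⁻¹ * (‖u‖⁻¹ * ‖f u v‖)) * (‖u‖ * ‖v‖) := by
      field_simp
    rw [h2, mul_assoc K]
    gcongr
    linarith
  let fl : H →ₛₗ[starRingEnd ℂ] H →ₗ[ℂ] ℂ :=
    LinearMap.mk₂'ₛₗ (starRingEnd ℂ) (RingHom.id ℂ) f hadd' hsmul' hadd hsmul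
  let F := fl.mkContinuous₂ K hbd
  let B := InnerProductSpace.continuousLinearMapOfBilin F
  have hB : ∀ u v, (inner ℂ (B u) v : ℂ) = f u v := fun u v =>
    InnerProductSpace.continuousLinearMapOfBilin_apply F u v
  have hB' : ∀ u v, (inner ℂ u (B v) : ℂ) = f u v := fun u v => by
    rw [← inner_conj_symm, hB, hsymm]
  refine ⟨B, hB', fun u v => by rw [hB, hB'], ContinuousLinearMap.opNorm_le_bound _ hK fun v => ?_⟩
  have h1 := hbd (B v) v
  rw [← hB', inner_self_eq_norm_sq_to_K] at h1
  have h2 : ‖((‖B v‖ : ℝ) : ℂ) ^ 2‖ = ‖B v‖ ^ 2 := by simp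
  change ‖((‖B v‖ : ℝ) : ℂ) ^ 2‖ ≤ _ at h1
  rw [h2] at h1
  rcases (norm_nonneg (B v)).eq_or_lt with h0 | h0
  · rw [← h0]; positivity
  · nlinarith

end Forms

/-! ### Signed integrals -/

section Signed

variable {L : ℝ}

variable (U : SignedMeasure (AddCircle L))

/-- Total variation of the potential. -/
def totalWeight : ℝ :=
  U.toJordanDecomposition.posPart.real Set.univ + U.toJordanDecomposition.negPart.real Set.univ

theorem totalWeight_nonneg : 0 ≤ totalWeight U := by
  unfold totalWeight
  positivity

theorem signedIntegral_smul (c : ℂ) (ρ : C(AddCircle L, ℂ)) :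
    signedIntegral U (c • ρ : C(AddCircle L, ℂ)) = c * signedIntegral U ρ := by
  simp only [signedIntegral, ContinuousMap.smul_apply, smul_eq_mul, integral_const_mul]
  ring

theorem signedIntegral_star (ρ : C(AddCircle L, ℂ)) :
    signedIntegral U (star ρ : C(AddCircle L, ℂ)) = conj (signedIntegral U ρ) := by
  simp only [signedIntegral, ContinuousMap.star_apply, RCLike.star_def, map_sub, ← integral_conj]

variable [Fact (0 < L)]

theorem integrable_of_continuous_finite (μ : Measure (AddCircle L))
    [IsFiniteMeasure μ] (ρ : C(AddCircle L, ℂ)) : Integrable (fun y => ρ y) μ :=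
  ρ.continuous.integrable_of_hasCompactSupport (HasCompactSupport.of_compactSpace _)

theorem signedIntegral_add (ρ ρ' : C(AddCircle L, ℂ)) :
    signedIntegral U (ρ + ρ' : C(AddCircle L, ℂ)) = signedIntegral U ρ + signedIntegral U ρ' := by
  simp only [signedIntegral, ContinuousMap.add_apply]
  rw [integral_add (integrable_of_continuous_finite _ ρ) (integrable_of_continuous_finite _ ρ'),
    integral_add (integrable_of_continuous_finite _ ρ) (integrable_of_continuous_finite _ ρ')]
  ring

theorem norm_signedIntegral_le (ρ : C(AddCircle L, ℂ)) :
    ‖signedIntegral U ρ‖ ≤ ‖ρ‖ * totalWeight U := by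
  refine (norm_sub_le _ _).trans ?_
  rw [totalWeight, mul_add]
  exact add_le_add
    (norm_integral_le_of_norm_le_const (Eventually.of_forall fun y => ρ.norm_coe_le_norm y))
    (norm_integral_le_of_norm_le_const (Eventually.of_forall fun y => ρ.norm_coe_le_norm y))

end Signed

/-! ### Kinetic weights -/

section Weights

theorem summable_inv_add_mul_sq {a b : ℝ} (ha : 0 < a) (hb : 1 ≤ b) :
    Summable fun s : ℤ => (b + a * (s : ℝ) ^ 2)⁻¹ := by
  have h1 : Summable fun s : ℤ => a⁻¹ * (1 / (s : ℝ) ^ 2) :=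
    (Real.summable_one_div_int_pow.2 (by norm_num)).mul_left _
  refine Summable.of_norm_bounded_eventually h1 ?_
  filter_upwards [eventually_cofinite_ne (0 : ℤ)] with s hs
  have hs2 : 0 < (s : ℝ) ^ 2 := by positivity
  rw [Real.norm_of_nonneg (by positivity), one_div, ← mul_inv]
  gcongr
  linarith

/-- Dominated convergence: every term tends to 0 as b → ∞. This makes the interaction a small form
perturbation however strong it is. -/
theorem exists_small_weight_sum {a : ℝ} (ha : 0 < a) (K : ℝ) :
    ∃ b : ℝ, 1 ≤ b ∧ K * ∑' s : ℤ, (b + a * (s : ℝ) ^ 2)⁻¹ ≤ 1 / 2 := by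
  have h1 : Tendsto (fun b : ℝ => ∑' s : ℤ, (b + a * (s : ℝ) ^ 2)⁻¹) atTop
      (𝓝 (∑' _ : ℤ, (0 : ℝ))) := by
    refine tendsto_tsum_of_dominated_convergence (summable_inv_add_mul_sq ha le_rfl)
      (fun s => ?_) ?_
    · exact tendsto_inv_atTop_zero.comp (tendsto_atTop_add_const_right _ _ tendsto_id)
    · filter_upwards [eventually_ge_atTop 1] with b hb s
      rw [Real.norm_of_nonneg (by positivity)]
      gcongr
  have h2 := h1.const_mul K
  rw [tsum_zero, mul_zero] at h2
  have h3 := (h2.eventually_le_const (show (0 : ℝ) < 1 / 2 by norm_num)).and (eventually_ge_atTop 1)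
  obtain ⟨b, hb1, hb2⟩ := h3.exists
  exact ⟨b, hb2, hb1⟩

variable {N : ℕ} {L mh mi : ℝ}

theorem kineticEnergy_permuteMode (σ : Equiv.Perm (Fin N)) (q : Mode N) :
    kineticEnergy L mh mi (permuteMode σ q) = kineticEnergy L mh mi q := by
  simp only [kineticEnergy, permuteMode]
  rw [Equiv.sum_comp σ (fun n => ringMomentum L (q.1 n) ^ 2 / (2 * mh))]

theorem finite_int_sq_le {a : ℝ} (ha : 0 < a) (C : ℝ) : {k : ℤ | a * (k : ℝ) ^ 2 ≤ C}.Finite := by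
  refine (Set.finite_Icc (-⌈C / a⌉) ⌈C / a⌉).subset fun k hk => ?_
  have h1 : (k : ℝ) ^ 2 ≤ C / a := by
    rw [le_div_iff₀ ha, mul_comm]; exact hk
  have h2 : (k ^ 2 : ℤ) ≤ ⌈C / a⌉ := by
    have := h1.trans (Int.le_ceil _)
    exact_mod_cast this
  constructor <;> nlinarith [sq_nonneg (k - 1), sq_nonneg (k + 1), sq_nonneg k,
    Int.le_self_sq k, Int.le_self_sq (-k)]

/-- Source of compactness: the ring makes momenta discrete, so the symbol of (H⁰ + Λ)^{-1/2} tends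
to 0. -/
theorem finite_kineticEnergy_le (hL : 0 < L) (hmh : 0 < mh) (hmi : 0 < mi) (C : ℝ) :
    {q : Mode N | kineticEnergy L mh mi q ≤ C}.Finite := by
  have hp : 0 < 2 * Real.pi / L := by positivity
  set D := C + hostShift N L mh
  have h1 := finite_int_sq_le (a := (2 * Real.pi / L) ^ 2 / (2 * mh)) (by positivity) D
  have h2 := finite_int_sq_le (a := (2 * Real.pi / L) ^ 2 / (2 * mi)) (by positivity) D
  refine ((Set.Finite.pi' fun _ : Fin N => h1).prod h2).subset fun q hq => ?_
  have hq' : ∑ n, ringMomentum L (q.1 n) ^ 2 / (2 * mh) + ringMomentum L q.2 ^ 2 / (2 * mi) ≤ D := by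
    have : kineticEnergy L mh mi q ≤ C := hq
    simp only [kineticEnergy] at this
    linarith
  have hnn : ∀ n ∈ Finset.univ, 0 ≤ ringMomentum L (q.1 n) ^ 2 / (2 * mh) := fun n _ => by
    positivity
  have hnn2 : 0 ≤ ringMomentum L q.2 ^ 2 / (2 * mi) := by positivity
  refine ⟨fun n => ?_, ?_⟩
  · have h3 := Finset.single_le_sum hnn (Finset.mem_univ n)
    have e : ringMomentum L (q.1 n) ^ 2 / (2 * mh) =
        (2 * Real.pi / L) ^ 2 / (2 * mh) * (q.1 n : ℝ) ^ 2 := by rw [ringMomentum]; ring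
    rw [e] at h3
    change (2 * Real.pi / L) ^ 2 / (2 * mh) * (q.1 n : ℝ) ^ 2 ≤ D
    linarith
  · have h3 := Finset.sum_nonneg hnn
    have e : ringMomentum L q.2 ^ 2 / (2 * mi) =
        (2 * Real.pi / L) ^ 2 / (2 * mi) * (q.2 : ℝ) ^ 2 := by rw [ringMomentum]; ring
    rw [e] at hq'
    change (2 * Real.pi / L) ^ 2 / (2 * mi) * (q.2 : ℝ) ^ 2 ≤ D
    linarith

end Weights

/-! ### Realization of the Hamiltonian by a form pair -/

section Realization

variable {N : ℕ} {L : ℝ} [Fact (0 < L)]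

/-- `S = (H⁰ + Λ)^{-1/2}` and `B = S V S` on the fermionic space. -/
structure IsRealization (mh mi : ℝ) (U : SignedMeasure (AddCircle L)) (Λ : ℝ)
    (S B : FermiSpace N L →L[ℂ] FermiSpace N L) : Prop where
  formPair : IsFormPair S B
  le_weight : ∀ q : Mode N, 1 + ringMomentum L q.2 ^ 2 / (2 * mi) ≤ Λ + kineticEnergy L mh mi q
  amplitude_S : ∀ (ψ : FermiSpace N L) (q : Mode N), amplitude (S ψ : WaveFn N L) q =
    ((Real.sqrt (Λ + kineticEnergy L mh mi q))⁻¹ : ℝ) * amplitude (ψ : WaveFn N L) q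
  exists_density : ∀ (n : Fin N) (u v : FermiSpace N L),
    ∃ ρ, IsPairDensity n (S u : WaveFn N L) (S v : WaveFn N L) ρ
  inner_B : ∀ u v : FermiSpace N L,
    (inner ℂ u (B v) : ℂ) = potentialForm U (S u : WaveFn N L) (S v : WaveFn N L)

/-- Boundedness of S V S comes from the decay in the impurity momentum alone; the host kinetic
energy is only used to be nonnegative there, and to grow for the compactness of S. -/
theorem exists_realization {mh mi : ℝ} (hmh : 0 < mh) (hmi : 0 < mi)
    (U : SignedMeasure (AddCircle L)) :
    ∃ (Λ : ℝ) (S B : FermiSpace N L →L[ℂ] FermiSpace N L), IsRealization mh mi U Λ S B := by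
  have hL : 0 < L := Fact.out
  set a := (2 * Real.pi / L) ^ 2 / (2 * mi) with ha
  have ha0 : 0 < a := by positivity
  -- The constant collects the N interaction terms, the factor 1/L of the density and the total
  -- variation of U; times the weight sum it bounds ‖B‖.
  obtain ⟨b, hb1, hb2⟩ := exists_small_weight_sum ha0 (N * (L⁻¹ * totalWeight U))
  set Λ := b + hostShift N L mh with hΛ
  have hae : ∀ q : Mode N, ringMomentum L q.2 ^ 2 / (2 * mi) = a * (q.2 : ℝ) ^ 2 := fun q => by
    rw [ringMomentum, ha]; ring
  have hw : ∀ q : Mode N, b + a * (q.2 : ℝ) ^ 2 ≤ Λ + kineticEnergy L mh mi q := fun q => by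
    rw [← hae, kineticEnergy, hΛ]
    have : 0 ≤ ∑ n, ringMomentum L (q.1 n) ^ 2 / (2 * mh) :=
      Finset.sum_nonneg fun n _ => by positivity
    linarith
  have hw1 : ∀ q : Mode N, 1 ≤ Λ + kineticEnergy L mh mi q := fun q =>
    le_trans (by nlinarith [sq_nonneg (q.2 : ℝ)]) (hw q)
  set g : Mode N → ℝ := fun q => (Real.sqrt (Λ + kineticEnergy L mh mi q))⁻¹ with hg
  have hg0 : ∀ q, 0 < g q := fun q => inv_pos.2 (Real.sqrt_pos.2 (by linarith [hw1 q]))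
  have hgsym : ∀ σ q, g (permuteMode σ q) = g q := fun σ q => by
    simp only [hg, kineticEnergy_permuteMode]
  obtain ⟨S, hS, -⟩ := exists_diagonal_operator (L := L) (g := g) (C := 1) (fun q => by
    rw [abs_of_pos (hg0 q)]
    exact inv_le_one_of_one_le₀ (Real.one_le_sqrt.2 (hw1 q))) hgsym
  have hfin : ∀ ε > 0, {q | ε < |g q|}.Finite := fun ε hε => by
    refine (finite_kineticEnergy_le hL hmh hmi ((ε⁻¹) ^ 2 - Λ)).subset fun q hq => ?_
    have h1 : ε < g q := by
      have : ε < |g q| := hq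
      rwa [abs_of_pos (hg0 q)] at this
    have h2 : Real.sqrt (Λ + kineticEnergy L mh mi q) ≤ ε⁻¹ := by
      rw [hg] at h1
      simp only at h1
      exact ((lt_inv_comm₀ hε (Real.sqrt_pos.2 (by linarith [hw1 q]))).1 h1).le
    have h3 := (Real.sqrt_le_left (by positivity)).1 h2
    change kineticEnergy L mh mi q ≤ (ε⁻¹) ^ 2 - Λ
    linarith
  have hκ : ∀ s : ℤ, 0 < b + a * (s : ℝ) ^ 2 := fun s => by positivity
  have hamp : ∀ (u : FermiSpace N L) (q : Mode N), ‖amplitude (S u : WaveFn N L) q‖ ≤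
      (Real.sqrt (b + a * (q.2 : ℝ) ^ 2))⁻¹ * ‖amplitude (u : WaveFn N L) q‖ := fun u q => by
    rw [hS, norm_mul, Complex.norm_real, Real.norm_of_nonneg (hg0 q).le]
    gcongr
    exact inv_anti₀ (Real.sqrt_pos.2 (hκ _)) (Real.sqrt_le_sqrt (hw q))
  have hdens : ∀ (n : Fin N) (u v : FermiSpace N L),
      ∃ ρ, IsPairDensity n (S u : WaveFn N L) (S v : WaveFn N L) ρ ∧
        ‖ρ‖ ≤ L⁻¹ * ((∑' s : ℤ, (b + a * (s : ℝ) ^ 2)⁻¹) / 2 * (‖u‖ ^ 2 + ‖v‖ ^ 2)) :=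
    fun n u v => by
      obtain ⟨h1, h2⟩ := summable_shift_product (κ := fun s : ℤ => b + a * (s : ℝ) ^ 2) hκ
        (summable_inv_add_mul_sq ha0 hb1) n (hamp u) (hamp v)
      obtain ⟨ρ, h3, h4⟩ := exists_isPairDensity n h1
      refine ⟨ρ, h3, h4.trans ?_⟩
      gcongr
      exact h2
  choose ρ hρ hρn using hdens
  have hpot : ∀ u v : FermiSpace N L, potentialForm U (S u : WaveFn N L) (S v : WaveFn N L) =
      ∑ n, signedIntegral U (ρ n u v) := fun u v => by
    unfold potentialForm
    exact Finset.sum_congr rfl fun n _ => by rw [(hρ n u v).pairDensity_eq]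
  have hρadd : ∀ n u v v', ρ n u (v + v') = ρ n u v + ρ n u v' := fun n u v v' => by
    refine (hρ n u (v + v')).unique ?_
    rw [map_add]
    exact (hρ n u v).add_right (hρ n u v')
  have hρsmul : ∀ n (c : ℂ) u v, ρ n u (c • v) = c • ρ n u v := fun n c u v => by
    refine (hρ n u (c • v)).unique ?_
    rw [map_smul]
    exact (hρ n u v).smul_right c
  have hρsymm : ∀ n u v, star (ρ n u v) = ρ n v u := fun n u v =>
    (hρ n u v).symm.unique (hρ n v u)
  have hA0 : 0 ≤ ∑' s : ℤ, (b + a * (s : ℝ) ^ 2)⁻¹ := tsum_nonneg fun s => (inv_pos.2 (hκ s)).le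
  have hU0 := totalWeight_nonneg U
  obtain ⟨B, hB1, hB2, hB3⟩ := exists_operator_of_form
    (f := fun u v : FermiSpace N L => potentialForm U (S u : WaveFn N L) (S v : WaveFn N L))
    (K := N * (L⁻¹ * totalWeight U) * ∑' s : ℤ, (b + a * (s : ℝ) ^ 2)⁻¹) (by positivity)
    (fun u v v' => by
      simp only [hpot, ← Finset.sum_add_distrib, ← signedIntegral_add, hρadd])
    (fun c u v => by
      simp only [hpot, Finset.mul_sum, ← signedIntegral_smul, hρsmul])
    (fun u v => by
      simp only [hpot, map_sum, ← signedIntegral_star, hρsymm])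
    (fun u v => by
      rw [hpot]
      refine (norm_sum_le _ _).trans ((Finset.sum_le_card_nsmul _ _ (L⁻¹ *
        ((∑' s : ℤ, (b + a * (s : ℝ) ^ 2)⁻¹) / 2 * (‖u‖ ^ 2 + ‖v‖ ^ 2)) * totalWeight U)
        fun n _ => ?_).trans_eq ?_)
      · refine (norm_signedIntegral_le U _).trans ?_
        gcongr
        exact hρn n u v
      · simp only [Finset.card_univ, Fintype.card_fin, nsmul_eq_mul]
        ring)
  refine ⟨Λ, S, B, ⟨fun x y => ?_, fun x y hxy => fermi_ext fun q => ?_,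
    isCompactOperator_of_amplitude hgsym hfin hS, hB2, hB3.trans hb2⟩, fun q => ?_, hS,
    fun n u v => ⟨_, hρ n u v⟩, hB1⟩
  · rw [fermi_inner, fermi_inner]
    refine (hasSum_amplitude _ _).unique ?_
    convert hasSum_amplitude (x : WaveFn N L) (S y : WaveFn N L) using 2 with q
    rw [hS, hS, map_mul, Complex.conj_ofReal]
    ring
  · have h1 : amplitude (S x : WaveFn N L) q = amplitude (S y : WaveFn N L) q := by rw [hxy]
    rw [hS, hS] at h1
    exact mul_left_cancel₀ (by exact_mod_cast (hg0 q).ne') h1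
  · rw [hae]
    linarith [hw q]

end Realization

end

/-! ### Lower bound on the host kinetic energy at fixed momentum -/

section HostEnergy

/-- The function `x ↦ r (N - r)`, where `r` is the residue of `x` modulo `N`. -/
def residueEnergy (N x : ℤ) : ℤ := x % N * (N - x % N)

theorem residueEnergy_nonneg {N : ℤ} (hN : 0 < N) (x : ℤ) : 0 ≤ residueEnergy N x :=
  mul_nonneg (Int.emod_nonneg _ hN.ne') (by linarith [Int.emod_lt_of_pos x hN])

theorem residueEnergy_of_mem {N x : ℤ} (h0 : 0 ≤ x) (h1 : x < N) :
    residueEnergy N x = x * (N - x) := by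
  rw [residueEnergy, Int.emod_eq_of_lt h0 h1]

theorem residueEnergy_add_mul (N x k : ℤ) : residueEnergy N (x + N * k) = residueEnergy N x := by
  simp [residueEnergy]

/-- With residues r and s, the defect is 2rs if no carry occurs and 2(N - r)(N - s) if one does. -/
theorem residueEnergy_add_le {N : ℤ} (hN : 0 < N) (x y : ℤ) :
    residueEnergy N (x + y) ≤ residueEnergy N x + residueEnergy N y := by
  unfold residueEnergy
  rw [Int.add_emod]
  have hx0 := Int.emod_nonneg x hN.ne'
  have hy0 := Int.emod_nonneg y hN.ne'
  have hx1 := Int.emod_lt_of_pos x hN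
  have hy1 := Int.emod_lt_of_pos y hN
  set r := x % N
  set s := y % N
  rcases lt_or_ge (r + s) N with h | h
  · rw [Int.emod_eq_of_lt (by positivity) h]
    nlinarith [mul_nonneg hx0 hy0]
  · have : (r + s) % N = r + s - N := by
      rw [← Int.sub_emod_right, Int.emod_eq_of_lt (by linarith) (by linarith)]
    rw [this]
    nlinarith [mul_nonneg (sub_nonneg.2 hx1.le) (sub_nonneg.2 hy1.le)]

theorem residueEnergy_nat_mul_le {N : ℤ} (hN : 0 < N) (e : ℕ) (x : ℤ) :
    residueEnergy N (e * x) ≤ e * residueEnergy N x := by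
  induction e with
  | zero => simp [residueEnergy]
  | succ e ih =>
    push_cast
    rw [add_mul, add_mul, one_mul, one_mul]
    exact (residueEnergy_add_le hN _ _).trans (by linarith)

theorem residueEnergy_sum_le {N : ℤ} (hN : 0 < N) {ι : Type*} (s : Finset ι) (f : ι → ℤ) :
    residueEnergy N (∑ i ∈ s, f i) ≤ ∑ i ∈ s, residueEnergy N (f i) := by
  classical
  induction s using Finset.induction_on with
  | empty => simp [residueEnergy]
  | insert i s hi ih =>
    rw [Finset.sum_insert hi, Finset.sum_insert hi]
    exact (residueEnergy_add_le hN _ _).trans (by linarith)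

/-- Abel summation. Modulo n + 1 the common displacement d 0 disappears, and the increment at i
counts n - i times: it moves the n - i topmost particles. -/
theorem sum_range_eq_increments (d : ℕ → ℤ) (n : ℕ) :
    ∑ i ∈ Finset.range (n + 1), d i = (n + 1) * d 0 +
      ∑ i ∈ Finset.range n, ((n : ℤ) - i) * (d (i + 1) - d i) := by
  induction n with
  | zero => simp
  | succ n ih =>
    rw [Finset.sum_range_succ, ih, Finset.sum_range_succ]
    have h1 : ∑ i ∈ Finset.range n, (((n + 1 : ℕ) : ℤ) - i) * (d (i + 1) - d i) =
        ∑ i ∈ Finset.range n, ((n : ℤ) - i) * (d (i + 1) - d i) +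
          ∑ i ∈ Finset.range n, (d (i + 1) - d i) := by
      rw [← Finset.sum_add_distrib]
      exact Finset.sum_congr rfl fun i _ => by push_cast; ring
    rw [h1, Finset.sum_range_sub]
    push_cast
    ring

/-- Abel summation again. The weight (i + 1)(n - i) is exactly the residue energy of n - i modulo n
+ 1, which makes the comparison with the previous identity termwise. -/
theorem sum_range_weighted_eq_increments (d : ℕ → ℤ) (n : ℕ) :
    ∑ i ∈ Finset.range (n + 1), (2 * (i : ℤ) - n) * d i =
      ∑ i ∈ Finset.range n, ((i : ℤ) + 1) * ((n : ℤ) - i) * (d (i + 1) - d i) := by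
  induction n with
  | zero => simp
  | succ n ih =>
    rw [Finset.sum_range_succ _ (n + 1), Finset.sum_range_succ
      (fun i : ℕ => ((i : ℤ) + 1) * (((n + 1 : ℕ) : ℤ) - i) * (d (i + 1) - d i)) n]
    have h1 : ∑ i ∈ Finset.range n, ((i : ℤ) + 1) * (((n + 1 : ℕ) : ℤ) - i) * (d (i + 1) - d i) =
        ∑ i ∈ Finset.range n, ((i : ℤ) + 1) * ((n : ℤ) - i) * (d (i + 1) - d i) +
          ∑ i ∈ Finset.range n, ((i : ℤ) + 1) * (d (i + 1) - d i) := by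
      rw [← Finset.sum_add_distrib]
      exact Finset.sum_congr rfl fun i _ => by push_cast; ring
    have h2 : ∑ i ∈ Finset.range (n + 1), (2 * (i : ℤ) - (n + 1 : ℕ)) * d i =
        ∑ i ∈ Finset.range (n + 1), (2 * (i : ℤ) - n) * d i - ∑ i ∈ Finset.range (n + 1), d i := by
      rw [← Finset.sum_sub_distrib]
      exact Finset.sum_congr rfl fun i _ => by push_cast; ring
    have h3 : ∀ m : ℕ, ∑ i ∈ Finset.range m, ((i : ℤ) + 1) * (d (i + 1) - d i) =
        (m + 1) * d m - ∑ i ∈ Finset.range (m + 1), d i := fun m => by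
      induction m with
      | zero => simp
      | succ m ihm =>
        rw [Finset.sum_range_succ, ihm, Finset.sum_range_succ _ (m + 1)]
        push_cast
        ring
    rw [h1, h2, ih, h3]
    push_cast
    ring

/-- Energy of monotone displacements of a filled Fermi sea. -/
theorem residueEnergy_le_of_monotone {d : ℕ → ℤ} (hd : Monotone d) (n : ℕ) :
    residueEnergy (n + 1) (∑ i ∈ Finset.range (n + 1), d i) ≤
      ∑ i ∈ Finset.range (n + 1), (2 * (i : ℤ) - n) * d i := by
  have hN : (0 : ℤ) < n + 1 := by positivity
  rw [sum_range_eq_increments, sum_range_weighted_eq_increments, add_comm (((n : ℤ) + 1) * d 0),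
    residueEnergy_add_mul]
  refine (residueEnergy_sum_le hN _ _).trans (Finset.sum_le_sum fun i hi => ?_)
  have hi' : i < n := Finset.mem_range.1 hi
  obtain ⟨e, he⟩ := Int.eq_ofNat_of_zero_le (sub_nonneg.2 (hd (Nat.le_succ i)))
  change d (i + 1) - d i = e at he
  rw [he, mul_comm ((n : ℤ) - i) (e : ℤ)]
  refine (residueEnergy_nat_mul_le hN e _).trans_eq ?_
  rw [residueEnergy_of_mem (by omega) (by omega)]
  ring

theorem sum_range_odd (M : ℕ) : ∑ i ∈ Finset.range (2 * M + 1), (i : ℤ) = (2 * M + 1) * M := by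
  induction M with
  | zero => simp
  | succ M ih =>
    rw [show 2 * (M + 1) + 1 = 2 * M + 1 + 1 + 1 by ring, Finset.sum_range_succ,
      Finset.sum_range_succ, ih]
    push_cast
    ring

/-- Among sets of `2 M + 1` distinct integers with sum `K`, the sum of squares exceeds that of the
Fermi sea `{-M, …, M}` by at least `r (2 M + 1 - r)`, where `r` is the residue of `K` modulo
`2 M + 1`. -/
theorem fermiSea_sum_sq_le {M : ℕ} {k : Fin (2 * M + 1) → ℤ} (hk : Function.Injective k) :
    ∑ i : Fin (2 * M + 1), ((i : ℤ) - M) ^ 2 + residueEnergy (2 * M + 1) (∑ i, k i) ≤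
      ∑ i, k i ^ 2 := by
  classical
  set s : Finset ℤ := Finset.univ.image k with hs
  have hcard : s.card = 2 * M + 1 := by
    rw [hs, Finset.card_image_of_injective _ hk, Finset.card_univ, Fintype.card_fin]
  let κ := s.orderEmbOfFin hcard
  have hsum : ∀ f : ℤ → ℤ, ∑ i, f (k i) = ∑ i, f (κ i) := fun f => by
    have h1 : ∑ i, f (k i) = ∑ x ∈ s, f x := by
      rw [hs, Finset.sum_image (fun a _ b _ h => hk h)]
    have h2 : ∑ i, f (κ i) = ∑ x ∈ s, f x := by
      rw [← Finset.image_orderEmbOfFin_univ s hcard,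
        Finset.sum_image (fun a _ b _ h => κ.injective h)]
    rw [h1, h2]
  rw [hsum (fun x => x ^ 2), show ∑ i, k i = ∑ i, κ i from hsum id]
  -- Displacements of the sorted integers from 0, …, 2M. They increase weakly because distinct
  -- sorted integers differ by at least 1; the minimum freezes the sequence beyond 2M.
  let d : ℕ → ℤ := fun i => κ ⟨min i (2 * M), by omega⟩ - ((min i (2 * M) : ℕ) : ℤ)
  have hstep : ∀ i, d i ≤ d (i + 1) := fun i => by
    simp only [d]
    rcases lt_or_ge i (2 * M) with h | h
    · have e1 : min i (2 * M) = i := min_eq_left h.le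
      have e2 : min (i + 1) (2 * M) = i + 1 := min_eq_left h
      have hlt : κ ⟨min i (2 * M), by omega⟩ < κ ⟨min (i + 1) (2 * M), by omega⟩ := by
        apply κ.strictMono
        rw [Fin.mk_lt_mk, e1, e2]
        exact Nat.lt_succ_self i
      rw [e1, e2] at *
      push_cast
      omega
    · have e1 : min i (2 * M) = 2 * M := min_eq_right h
      have e2 : min (i + 1) (2 * M) = 2 * M := min_eq_right (by omega)
      simp only [e1, e2, le_refl]
  have hmono : Monotone d := monotone_nat_of_le_succ hstep
  have hκd : ∀ i : Fin (2 * M + 1), κ i = d i + i := fun i => by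
    have e1 : min (i : ℕ) (2 * M) = i := min_eq_left (by omega)
    simp only [d, e1]
    simp
  have hmain := residueEnergy_le_of_monotone hmono (2 * M)
  rw [← Fin.sum_univ_eq_sum_range (fun i => d i), ← Fin.sum_univ_eq_sum_range
    (fun i => (2 * (i : ℤ) - (2 * M : ℕ)) * d i)] at hmain
  -- 0 + … + 2M = (2M + 1)M is a multiple of 2M + 1; this is where an odd particle number matters.
  have hres : residueEnergy (2 * M + 1) (∑ i, κ i) =
      residueEnergy (((2 * M : ℕ) : ℤ) + 1) (∑ i : Fin (2 * M + 1), d i) := by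
    have hg : ∑ i : Fin (2 * M + 1), ((i : ℕ) : ℤ) = (2 * M + 1) * M := by
      rw [Fin.sum_univ_eq_sum_range (fun i => (i : ℤ))]
      exact sum_range_odd M
    simp only [hκd, Finset.sum_add_distrib, hg]
    push_cast
    exact residueEnergy_add_mul _ _ _
  rw [hres]
  set D := ∑ i : Fin (2 * M + 1), d i
  -- Expansion of κ i = (i - M) + (d i + M). The term linear in i - M alone sums to zero and the
  -- squares (d i + M)² are discarded.
  have hsq : ∑ i, κ i ^ 2 = ∑ i : Fin (2 * M + 1), ((i : ℤ) - M) ^ 2 +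
      ∑ i : Fin (2 * M + 1), (2 * (i : ℤ) - (2 * M : ℕ)) * d i +
      ∑ i : Fin (2 * M + 1), (d i + M) ^ 2
      + 2 * M * ∑ i : Fin (2 * M + 1), ((i : ℤ) - M) := by
    rw [Finset.mul_sum, ← Finset.sum_add_distrib, ← Finset.sum_add_distrib,
      ← Finset.sum_add_distrib]
    refine Finset.sum_congr rfl fun i _ => ?_
    rw [hκd]
    push_cast
    ring
  have hz : ∑ i : Fin (2 * M + 1), ((i : ℤ) - M) = 0 := by
    rw [Fin.sum_univ_eq_sum_range (fun i => (i : ℤ) - M), Finset.sum_sub_distrib]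
    rw [sum_range_odd]
    simp only [Finset.sum_const, Finset.card_range, nsmul_eq_mul]
    push_cast
    ring
  rw [hsq, hz, mul_zero, add_zero]
  have hnn : 0 ≤ ∑ i : Fin (2 * M + 1), (d i + M) ^ 2 := Finset.sum_nonneg fun i _ => sq_nonneg _
  linarith

end HostEnergy

section

/-! ### Comparison of the host energy with the impurity parabola -/

section KineticBound

theorem sum_fermiSea_sq (M : ℕ) :
    (∑ i : Fin (2 * M + 1), (((i : ℕ) : ℝ) - M) ^ 2) = M * (M + 1) * (2 * M + 1) / 3 := by
  rw [Fin.sum_univ_eq_sum_range (fun i => ((i : ℝ) - M) ^ 2)]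
  have h : ∀ (c : ℝ) (n : ℕ), ∑ i ∈ Finset.range (n + 1), ((i : ℝ) - c) ^ 2 =
      n * (n + 1) * (2 * n + 1) / 6 - c * n * (n + 1) + c ^ 2 * (n + 1) := fun c n => by
    induction n with
    | zero => simp
    | succ n ih =>
      rw [Finset.sum_range_succ, ih]
      push_cast
      ring
  rw [h]
  push_cast
  ring

/-- The constant C is the kinetic energy of the Fermi sea, so host energies are measured from it. -/
theorem hostShift_odd (M : ℕ) (L mh : ℝ) :
    hostShift (2 * M + 1) L mh =
      (2 * Real.pi / L) ^ 2 * (M * (M + 1) * (2 * M + 1) / 3) / (2 * mh) := by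
  -- For one host particle the defining quotient divides by N - 1 = 0; both sides are then 0.
  rcases Nat.eq_zero_or_pos M with h | h
  · subst h
    simp [hostShift, fermiMomentum]
  · have hM : (M : ℝ) ≠ 0 := by positivity
    unfold hostShift fermiMomentum
    push_cast
    rw [show (2 * (M : ℝ) + 1 - 1) = 2 * M by ring]
    field_simp
    ring

theorem sum_ringMomentum_sq {N : ℕ} (L : ℝ) (k : Fin N → ℤ) :
    ∑ n, ringMomentum L (k n) ^ 2 = (2 * Real.pi / L) ^ 2 * ((∑ n, k n ^ 2 : ℤ) : ℝ) := by
  push_cast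
  rw [Finset.mul_sum]
  exact Finset.sum_congr rfl fun n _ => by rw [ringMomentum]; ring

theorem criticalMomentum_nonneg {N : ℕ} (hN : Odd N) {L mh mi : ℝ} (hL : 0 < L) (hmh : 0 < mh)
    (hmi : 0 < mi) : 0 ≤ criticalMomentum N L mh mi := by
  obtain ⟨M, rfl⟩ := hN
  have : 0 ≤ fermiMomentum (2 * M + 1) L := by
    unfold fermiMomentum
    push_cast
    rw [show (2 * (M : ℝ) + 1 - 1) / 2 = M by ring]
    positivity
  exact le_min this (by positivity)

/-- In the sector of total momentum `p₀ = 2πj/L`, the kinetic energy is bounded below by a linear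
function of the impurity momentum. -/
theorem linear_le_kineticEnergy {N : ℕ} (hN : Odd N) {L mh mi : ℝ} (hL : 0 < L) (hmh : 0 < mh)
    (hmi : 0 < mi) {j : ℤ} {q : Mode N} (hq : Function.Injective q.1) (hj : ∑ n, q.1 n + q.2 = j) :
    ringMomentum L j ^ 2 / (2 * mi) + (criticalMomentum N L mh mi - ringMomentum L j) / mi *
      (ringMomentum L j - ringMomentum L q.2) ≤ kineticEnergy L mh mi q := by
  have hq0 := criticalMomentum_nonneg hN hL hmh hmi
  obtain ⟨M, rfl⟩ := hN
  set h := 2 * Real.pi / L with hh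
  have hh0 : 0 < h := by positivity
  set K := ∑ n, q.1 n with hK
  set k := h * (K : ℝ) with hk
  have hpi : ringMomentum L q.2 = ringMomentum L j - k := by
    rw [ringMomentum, ringMomentum, hk, ← hj]
    push_cast
    ring
  set p₀ := ringMomentum L j
  set q₀ := criticalMomentum (2 * M + 1) L mh mi with hq₀
  have hkF : fermiMomentum (2 * M + 1) L = h * M := by
    unfold fermiMomentum
    push_cast
    ring
  have hq1 : q₀ ≤ h * M := by rw [← hkF]; exact min_le_left _ _
  have hq2 : q₀ ≤ mi / mh * (h * M) := by rw [← hkF]; exact min_le_right _ _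
  set X : ℝ := ((∑ n, q.1 n ^ 2 : ℤ) : ℝ) - M * (M + 1) * (2 * M + 1) / 3 with hX
  have hXr : (residueEnergy (2 * M + 1) K : ℝ) ≤ X := by
    have h1 := fermiSea_sum_sq_le hq
    have h2 : ((∑ i : Fin (2 * M + 1), ((i : ℤ) - M) ^ 2 : ℤ) : ℝ) =
        M * (M + 1) * (2 * M + 1) / 3 := by
      rw [← sum_fermiSea_sq]
      push_cast
      rfl
    have h3 : ((∑ i : Fin (2 * M + 1), ((i : ℤ) - M) ^ 2 : ℤ) : ℝ) +
        (residueEnergy (2 * M + 1) K : ℝ) ≤ ((∑ n, q.1 n ^ 2 : ℤ) : ℝ) := by exact_mod_cast h1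
    rw [h2] at h3
    rw [hX]
    linarith
  have hX0 : 0 ≤ X := by
    have := residueEnergy_nonneg (N := 2 * M + 1) (by positivity) K
    have h2 : (0 : ℝ) ≤ (residueEnergy (2 * M + 1) K : ℝ) := by exact_mod_cast this
    linarith
  have hkin : kineticEnergy L mh mi q = h ^ 2 * X / (2 * mh) + (p₀ - k) ^ 2 / (2 * mi) := by
    rw [kineticEnergy, ← Finset.sum_div, sum_ringMomentum_sq, hostShift_odd, hpi, hX]
    ring
  -- Host energy above the sea against the parabola in the transferred momentum k. Outside 0 < K ≤
  -- 2M the parabola is nonpositive, so only the first arch of the residue energy is needed.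
  have hkey : k * (2 * q₀ - k) / (2 * mi) ≤ h ^ 2 * X / (2 * mh) := by
    have hR : 0 ≤ h ^ 2 * X / (2 * mh) := by positivity
    rcases le_or_gt K 0 with hK0 | hK0
    · refine le_trans ?_ hR
      have hk0 : k ≤ 0 := mul_nonpos_of_nonneg_of_nonpos hh0.le (by exact_mod_cast hK0)
      exact div_nonpos_of_nonpos_of_nonneg
        (mul_nonpos_of_nonpos_of_nonneg hk0 (by linarith)) (by positivity)
    have hk0 : 0 < k := mul_pos hh0 (by exact_mod_cast hK0)
    rcases le_or_gt K (2 * M) with hK1 | hK1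
    · have hres : residueEnergy (2 * M + 1) K = K * (2 * M + 1 - K) :=
        residueEnergy_of_mem hK0.le (by omega)
      rw [hres] at hXr
      push_cast at hXr
      have hKM : (K : ℝ) ≤ 2 * M := by exact_mod_cast hK1
      have hKp : (0 : ℝ) < K := by exact_mod_cast hK0
      have h1 : k * (2 * (h * M) - k) ≤ h ^ 2 * X := by
        have e : k * (2 * (h * M) - k) = h ^ 2 * (K * (2 * M - K)) := by rw [hk]; ring
        rw [e]
        gcongr
        nlinarith
      have h2 : 0 ≤ 2 * (h * M) - k := by
        rw [hk]
        nlinarith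
      refine le_trans ?_ (div_le_div_of_nonneg_right h1 (by positivity))
      rw [mul_div_assoc, mul_div_assoc]
      refine mul_le_mul_of_nonneg_left ?_ hk0.le
      rw [div_le_div_iff₀ (by positivity) (by positivity)]
      -- A heavy impurity uses q₀ ≤ k_F and 2k_F - k ≥ 0; a light one uses q₀ ≤ (mᵢ/m_h) k_F and k >
      -- 0.
      rcases le_total mh mi with hm | hm
      · nlinarith [mul_le_mul_of_nonneg_right hm h2]
      · have h3 : q₀ * mh ≤ mi * (h * M) := by
          have := mul_le_mul_of_nonneg_right hq2 hmh.le
          rwa [show mi / mh * (h * M) * mh = mi * (h * M) by field_simp] at this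
        nlinarith [mul_le_mul_of_nonneg_right hm hk0.le]
    · refine le_trans ?_ hR
      have hKM : (2 * M : ℝ) ≤ K := by exact_mod_cast hK1.le
      have h2 : 2 * q₀ - k ≤ 0 := by
        rw [hk]
        nlinarith
      exact div_nonpos_of_nonpos_of_nonneg
        (mul_nonpos_of_nonneg_of_nonpos hk0.le h2) (by positivity)
  rw [hkin, hpi]
  have e : p₀ ^ 2 / (2 * mi) + (q₀ - p₀) / mi * (p₀ - (p₀ - k)) =
      k * (2 * q₀ - k) / (2 * mi) + (p₀ - k) ^ 2 / (2 * mi) := by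
    field_simp
    ring
  rw [e]
  linarith

end KineticBound

/-! ### The Fermi-sea state -/

section FermiSea

variable {N : ℕ} {L : ℝ} [Fact (0 < L)]

theorem fermiSeaModes_injective : Function.Injective (fermiSeaModes N) := fun a b h => by
  simp only [fermiSeaModes] at h
  exact Fin.ext (by omega)

theorem fermiSeaWave_eq (j : ℤ) : fermiSeaWave N L j = ∑ σ : Equiv.Perm (Fin N),
    (((Real.sqrt (N.factorial : ℝ))⁻¹ : ℂ) * ((Equiv.Perm.sign σ : ℤ) : ℂ)) •
      planeWave (fun n => fermiSeaModes N (σ n), j) := by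
  rw [fermiSeaWave, Finset.smul_sum]
  exact Finset.sum_congr rfl fun σ _ => by rw [smul_smul]

theorem exists_perm_of_amplitude_ne_zero {j : ℤ} {q : Mode N}
    (hq : amplitude (fermiSeaWave N L j) q ≠ 0) :
    ∃ σ : Equiv.Perm (Fin N), q = (fun n => fermiSeaModes N (σ n), j) := by
  by_contra! hc
  apply hq
  rw [fermiSeaWave_eq, amplitude_sum]
  refine Finset.sum_eq_zero fun σ _ => ?_
  rw [amplitude_smul, amplitude_planeWave, if_neg (hc σ), mul_zero]

theorem norm_fermiSeaWave (j : ℤ) : ‖fermiSeaWave N L j‖ = 1 := by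
  have hinj : Function.Injective fun σ : Equiv.Perm (Fin N) =>
      ((fun n => fermiSeaModes N (σ n), j) : Mode N) := fun σ τ h => by
    ext n
    have := congrFun (congrArg Prod.fst h) n
    exact congrArg Fin.val (fermiSeaModes_injective this)
  have ho := (orthonormal_planeWave (N := N) (L := L)).comp _ hinj
  have h1 := ho.inner_sum
    (fun σ => ((Real.sqrt (N.factorial : ℝ))⁻¹ : ℂ) * ((Equiv.Perm.sign σ : ℤ) : ℂ))
    (fun σ => ((Real.sqrt (N.factorial : ℝ))⁻¹ : ℂ) * ((Equiv.Perm.sign σ : ℤ) : ℂ)) Finset.univ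
  simp only [Function.comp_apply] at h1
  rw [← fermiSeaWave_eq, inner_self_eq_norm_sq_to_K] at h1
  have h2 : ∀ σ : Equiv.Perm (Fin N),
      conj (((Real.sqrt (N.factorial : ℝ))⁻¹ : ℂ) * ((Equiv.Perm.sign σ : ℤ) : ℂ)) *
        (((Real.sqrt (N.factorial : ℝ))⁻¹ : ℂ) * ((Equiv.Perm.sign σ : ℤ) : ℂ)) =
      ((N.factorial : ℂ))⁻¹ := fun σ => by
    have e1 : ((Equiv.Perm.sign σ : ℤ) : ℂ) * ((Equiv.Perm.sign σ : ℤ) : ℂ) = 1 := by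
      rw [← Int.cast_mul, ← Units.val_mul, Int.units_mul_self]; simp
    have e2 : ((Real.sqrt (N.factorial : ℝ) : ℝ) : ℂ) * (Real.sqrt (N.factorial : ℝ) : ℝ) =
        (N.factorial : ℂ) := by
      rw [← Complex.ofReal_mul, Real.mul_self_sqrt (by positivity)]; simp
    simp only [map_mul, map_inv₀, Complex.conj_ofReal, map_intCast]
    rw [mul_mul_mul_comm, ← mul_inv, e2, e1, mul_one]
  rw [Finset.sum_congr rfl fun σ _ => h2 σ, Finset.sum_const, Finset.card_univ,
    Fintype.card_perm, Fintype.card_fin, nsmul_eq_mul,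
    mul_inv_cancel₀ (by exact_mod_cast N.factorial_ne_zero)] at h1
  have h3 : ‖fermiSeaWave N L j‖ ^ 2 = 1 := Complex.ofReal_injective (by push_cast; exact h1)
  exact (pow_eq_one_iff_of_nonneg (norm_nonneg _) two_ne_zero).1 h3

theorem hasTotalMomentum_fermiSeaWave (hN : Odd N) (j : ℤ) :
    HasTotalMomentum j (fermiSeaWave N L j) := by
  intro q hq
  obtain ⟨σ, rfl⟩ := exists_perm_of_amplitude_ne_zero hq
  rw [Equiv.sum_comp σ (fermiSeaModes N)]
  obtain ⟨M, rfl⟩ := hN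
  have h1 : ∀ n : Fin (2 * M + 1), fermiSeaModes (2 * M + 1) n = ((n : ℕ) : ℤ) - M := fun n => by
    simp only [fermiSeaModes]
    push_cast
    omega
  simp only [h1]
  rw [Fin.sum_univ_eq_sum_range (fun i => (i : ℤ) - M), Finset.sum_sub_distrib, sum_range_odd]
  simp only [Finset.sum_const, Finset.card_range, nsmul_eq_mul]
  push_cast
  ring

/-- The host contribution cancels against C, so the initial state saturates the linear lower bound.
-/
theorem kineticEnergy_fermiSea (hN : Odd N) (mh mi : ℝ) {j : ℤ} {q : Mode N}
    (hq : amplitude (fermiSeaWave N L j) q ≠ 0) :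
    kineticEnergy L mh mi q = ringMomentum L j ^ 2 / (2 * mi) := by
  obtain ⟨σ, rfl⟩ := exists_perm_of_amplitude_ne_zero hq
  obtain ⟨M, rfl⟩ := hN
  have h1 : ∀ n : Fin (2 * M + 1), fermiSeaModes (2 * M + 1) n = ((n : ℕ) : ℤ) - M := fun n => by
    simp only [fermiSeaModes]
    push_cast
    omega
  have h2 : ∑ n, fermiSeaModes (2 * M + 1) (σ n) ^ 2 =
      ∑ n, fermiSeaModes (2 * M + 1) n ^ 2 :=
    Equiv.sum_comp σ fun n => fermiSeaModes (2 * M + 1) n ^ 2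
  rw [kineticEnergy, ← Finset.sum_div, sum_ringMomentum_sq, hostShift_odd]
  simp only
  rw [h2, ← sum_fermiSea_sq]
  simp only [h1]
  push_cast
  ring

theorem kineticEnergy_mul_fermiSea (hN : Odd N) (mh mi : ℝ) (j : ℤ) (q : Mode N) :
    kineticEnergy L mh mi q * ‖amplitude (fermiSeaWave N L j) q‖ ^ 2 =
      ringMomentum L j ^ 2 / (2 * mi) * ‖amplitude (fermiSeaWave N L j) q‖ ^ 2 := by
  by_cases hq : amplitude (fermiSeaWave N L j) q = 0
  · simp [hq]
  · rw [kineticEnergy_fermiSea hN mh mi hq]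

theorem finiteKineticEnergy_fermiSeaWave (hN : Odd N) (mh mi : ℝ) (j : ℤ) :
    FiniteKineticEnergy mh mi (fermiSeaWave N L j) := by
  unfold FiniteKineticEnergy
  simp only [kineticEnergy_mul_fermiSea hN]
  exact (summable_norm_sq_amplitude _).mul_left _

theorem kineticForm_fermiSeaWave (hN : Odd N) (mh mi : ℝ) (j : ℤ) :
    kineticForm mh mi (fermiSeaWave N L j) (fermiSeaWave N L j) =
      ((ringMomentum L j ^ 2 / (2 * mi) : ℝ) : ℂ) := by
  unfold kineticForm
  have h1 : ∀ q, (kineticEnergy L mh mi q : ℂ) * (conj (amplitude (fermiSeaWave N L j) q) *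
      amplitude (fermiSeaWave N L j) q) = ((ringMomentum L j ^ 2 / (2 * mi) *
        ‖amplitude (fermiSeaWave N L j) q‖ ^ 2 : ℝ) : ℂ) := fun q => by
    rw [← kineticEnergy_mul_fermiSea hN mh mi, Complex.conj_mul']
    push_cast
    rfl
  simp only [h1]
  rw [← Complex.ofReal_tsum, tsum_mul_left, (hasSum_norm_sq_amplitude _).tsum_eq,
    norm_fermiSeaWave]
  simp

/-- In the Fermi-sea state the relative coordinates are uniformly distributed. -/
theorem isPairDensity_fermiSeaWave (n : Fin N) (j : ℤ) :
    IsPairDensity n (fermiSeaWave N L j) (fermiSeaWave N L j)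
      (ContinuousMap.const _ ((L⁻¹ : ℝ) : ℂ)) := by
  have hL : (L : ℂ) ≠ 0 := by exact_mod_cast (Fact.out : 0 < L).ne'
  refine isPairDensity_of_fourier fun m => ?_
  rw [← (hasSum_fourier_density n m _ _).tsum_eq]
  simp only [ContinuousMap.const_apply]
  rw [integral_mul_const, integral_fourier_eq]
  split_ifs with hm
  · subst hm
    have h1 : ∀ q : Mode N, shiftMode n 0 q = q := fun q => by simp [shiftMode]
    simp only [h1]
    rw [(hasSum_amplitude _ _).tsum_eq, inner_self_eq_norm_sq_to_K, norm_fermiSeaWave]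
    push_cast
    rw [mul_inv_cancel₀ hL]
    norm_num
  · rw [zero_mul]
    -- The impurity has sharp momentum, so a transfer m ≠ 0 leads to an orthogonal state.
    have h1 : ∀ q : Mode N, conj (amplitude (fermiSeaWave N L j) (shiftMode n m q)) *
        amplitude (fermiSeaWave N L j) q = 0 := fun q => by
      by_contra hne
      obtain ⟨h2, h3⟩ := mul_ne_zero_iff.1 hne
      obtain ⟨σ, hσ⟩ := exists_perm_of_amplitude_ne_zero h3
      obtain ⟨τ, hτ⟩ := exists_perm_of_amplitude_ne_zero (fun h => h2 (by rw [h, map_zero]))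
      have e1 : q.2 = j := congrArg Prod.snd hσ
      have e2 : q.2 - m = j := congrArg Prod.snd hτ
      omega
    simp only [h1, tsum_zero]

theorem potentialEnergy_fermiSeaWave (U : SignedMeasure (AddCircle L)) (j : ℤ) :
    potentialEnergy U (fermiSeaWave N L j) = N * U Set.univ / L := by
  have h1 : signedIntegral U (ContinuousMap.const (AddCircle L) ((L⁻¹ : ℝ) : ℂ)) =
      ((U Set.univ / L : ℝ) : ℂ) := by
    rw [U.apply_eq_posPart_real_sub_negPart_real MeasurableSet.univ]
    simp only [signedIntegral, ContinuousMap.const_apply, integral_const, Complex.real_smul]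
    push_cast
    ring
  unfold potentialEnergy potentialForm
  simp only [(isPairDensity_fermiSeaWave _ j).pairDensity_eq, h1, Finset.sum_const,
    Finset.card_univ, Fintype.card_fin, nsmul_eq_mul]
  rw [← Complex.ofReal_natCast, ← Complex.ofReal_mul, Complex.ofReal_re]
  ring

end FermiSea

/-! ### Repulsive potentials -/

section Repulsive

variable {N : ℕ} {L : ℝ}

/-- The negative part has total mass -U on the negative set of a Hahn decomposition, and positivity
of U makes this at most 0. -/
theorem negPart_eq_zero {U : SignedMeasure (AddCircle L)} (hU : 0 ≤ U) :
    U.toJordanDecomposition.negPart = 0 := by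
  obtain ⟨i, hi1, hi2, hi3, -, hneg⟩ := U.toJordanDecomposition_spec
  rw [← Measure.measure_univ_eq_zero, hneg, SignedMeasure.toMeasureOfLEZero_apply _ hi3 hi1.compl
    MeasurableSet.univ, ENNReal.coe_eq_zero, ← NNReal.coe_eq_zero]
  have h1 : 0 ≤ U (iᶜ ∩ Set.univ) := hU _ (hi1.compl.inter MeasurableSet.univ)
  have h2 := NNReal.coe_nonneg (NNReal.mk (-U (iᶜ ∩ Set.univ)) (by
    have := VectorMeasure.nonpos_of_restrict_le_zero U hi3
    rw [Set.inter_univ]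
    linarith))
  change -U (iᶜ ∩ Set.univ) = 0
  change 0 ≤ -U (iᶜ ∩ Set.univ) at h2
  linarith

variable [Fact (0 < L)]

/-- Tested with g = max(0, -Re ρ), the configuration integral is nonnegative while the ring integral
has real part -∫ g²; hence g vanishes. -/
theorem IsPairDensity.re_nonneg {n : Fin N} {ψ : WaveFn N L} {ρ : C(AddCircle L, ℂ)}
    (h : IsPairDensity n ψ ψ ρ) (y : AddCircle L) : 0 ≤ (ρ y).re := by
  let g : C(AddCircle L, ℝ) := ⟨fun y => max 0 (-(ρ y).re), by fun_prop⟩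
  let f : C(AddCircle L, ℂ) := ⟨fun y => (g y : ℂ), by fun_prop⟩
  have h1 := congrArg Complex.re (h f)
  have hre : ∀ {X : Type} [MeasurableSpace X] (μ : Measure X) (F : X → ℂ), Integrable F μ →
      (∫ x, F x ∂μ).re = ∫ x, (F x).re ∂μ := fun μ F hF =>
    (Complex.reCLM.integral_comp_comm hF).symm
  have hL : 0 ≤ (∫ x : Config N L, f (x.1 n - x.2) * (conj (ψ x) * ψ x)).re := by
    rw [hre _ _ (integrable_test n ψ ψ f)]
    refine integral_nonneg fun x => ?_
    have e : f (x.1 n - x.2) * (conj (ψ x) * ψ x) =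
        ((g (x.1 n - x.2) * ‖ψ x‖ ^ 2 : ℝ) : ℂ) := by
      rw [Complex.conj_mul']
      push_cast
      rfl
    simp only [Pi.zero_apply]
    rw [e, Complex.ofReal_re]
    exact mul_nonneg (le_max_left _ _) (sq_nonneg _)
  have hR : (∫ y : AddCircle L, f y * ρ y).re = -∫ y : AddCircle L, g y ^ 2 := by
    refine (hre _ _ (integrable_continuous_ring (f * ρ))).trans ?_
    rw [← integral_neg]
    refine integral_congr_ae (Eventually.of_forall fun y => ?_)
    change ((g y : ℂ) * ρ y).re = -(g y ^ 2)
    rw [Complex.re_ofReal_mul]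
    change max 0 (-(ρ y).re) * (ρ y).re = -(max 0 (-(ρ y).re) ^ 2)
    rcases le_total 0 (ρ y).re with h0 | h0
    · rw [max_eq_left (by linarith)]; ring
    · rw [max_eq_right (by linarith)]; ring
  rw [hR] at h1
  rw [h1] at hL
  have hc : Continuous fun y => g y ^ 2 := by fun_prop
  have h2 : ∫ y : AddCircle L, g y ^ 2 = 0 :=
    le_antisymm (by linarith) (integral_nonneg fun y => sq_nonneg _)
  rw [integral_eq_zero_iff_of_nonneg (fun y => sq_nonneg _)
    (hc.integrable_of_hasCompactSupport (HasCompactSupport.of_compactSpace _))] at h2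
  have h3 := congrFun ((Continuous.ae_eq_iff_eq volume hc continuous_const).1 h2) y
  have h4 : g y = 0 := by
    have : g y ^ 2 = 0 := h3
    exact pow_eq_zero_iff (two_ne_zero) |>.1 this
  have h5 : -(ρ y).re ≤ g y := le_max_right _ _
  linarith

theorem potentialEnergy_nonneg {U : SignedMeasure (AddCircle L)} (hU : 0 ≤ U) {ψ : WaveFn N L}
    (hψ : ∀ n, ∃ ρ, IsPairDensity n ψ ψ ρ) : 0 ≤ potentialEnergy U ψ := by
  unfold potentialEnergy potentialForm
  rw [Complex.re_sum]
  refine Finset.sum_nonneg fun n _ => ?_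
  obtain ⟨ρ, hρ⟩ := hψ n
  rw [hρ.pairDensity_eq, signedIntegral, negPart_eq_zero hU, integral_zero_measure, sub_zero]
  have h1 : (∫ y, ρ y ∂U.toJordanDecomposition.posPart).re =
      ∫ y, (ρ y).re ∂U.toJordanDecomposition.posPart :=
    (Complex.reCLM.integral_comp_comm (integrable_of_continuous_finite _ ρ)).symm
  rw [h1]
  exact integral_nonneg fun y => hρ.re_nonneg y

end Repulsive

end

/-! ### The Hamiltonian in terms of its form pair -/

section Abstract

variable {H : Type*} [NormedAddCommGroup H] [InnerProductSpace ℂ H]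

/-- Testing with S u for all u amounts to testing with the whole form domain, so the weak equation
is equivalent to a vector equation free of unbounded operators. -/
theorem IsFormPair.form_eq_iff {S B : H →L[ℂ] H} (h : IsFormPair S B) (Λ : ℝ) (v χ : H) :
    v + B v = S (χ + (Λ : ℂ) • S v) ↔
      ∀ u, (inner ℂ u v - Λ * inner ℂ (S u) (S v) + inner ℂ u (B v) : ℂ) = inner ℂ (S u) χ := by
  have key : ∀ u, (inner ℂ u (S (χ + (Λ : ℂ) • S v)) : ℂ) =
      inner ℂ (S u) χ + Λ * inner ℂ (S u) (S v) := fun u => by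
    rw [← h.symm_S, inner_add_right, inner_smul_right]
  constructor
  · intro e u
    have h1 := key u
    rw [← e, inner_add_right] at h1
    linear_combination h1
  · intro e
    refine ext_inner_left ℂ fun u => ?_
    rw [key, ← e u, inner_add_right]
    ring

theorem _root_.HilbertBasis.inner_smul_self {ι : Type*} (b : HilbertBasis ι ℂ H) (E : ι → ℝ)
    (i k : ι) : (inner ℂ (b k) ((E i : ℂ) • b i) : ℂ) = E k * inner ℂ (b k) (b i) := by
  classical
  rw [inner_smul_right, orthonormal_iff_ite.1 b.orthonormal k i]
  split_ifs with hki
  · rw [hki]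
  · simp

end Abstract

namespace IsRealization

variable {N : ℕ} {L : ℝ} [Fact (0 < L)] {mh mi : ℝ} {U : SignedMeasure (AddCircle L)} {Λ : ℝ}
  {S B : FermiSpace N L →L[ℂ] FermiSpace N L}

theorem weight_pos (h : IsRealization mh mi U Λ S B) (hmi : 0 < mi) (q : Mode N) :
    0 < Λ + kineticEnergy L mh mi q := by
  have h1 := h.le_weight q
  have h2 : 0 ≤ ringMomentum L q.2 ^ 2 / (2 * mi) := by positivity
  linarith

theorem weight_mul (h : IsRealization mh mi U Λ S B) (hmi : 0 < mi) (u v : FermiSpace N L)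
    (q : Mode N) :
    ((Λ + kineticEnergy L mh mi q : ℝ) : ℂ) *
      (conj (amplitude (S u : WaveFn N L) q) * amplitude (S v : WaveFn N L) q) =
      conj (amplitude (u : WaveFn N L) q) * amplitude (v : WaveFn N L) q := by
  rw [h.amplitude_S, h.amplitude_S, map_mul, Complex.conj_ofReal]
  have hw := h.weight_pos hmi q
  set w := Λ + kineticEnergy L mh mi q
  have h1 : (w : ℂ) * (((Real.sqrt w)⁻¹ : ℝ) * ((Real.sqrt w)⁻¹ : ℝ)) = 1 := by
    rw [← Complex.ofReal_mul, ← mul_inv, Real.mul_self_sqrt hw.le, ← Complex.ofReal_mul,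
      mul_inv_cancel₀ hw.ne', Complex.ofReal_one]
  linear_combination (conj (amplitude (u : WaveFn N L) q) * amplitude (v : WaveFn N L) q) * h1

theorem weight_mul_norm_sq (h : IsRealization mh mi U Λ S B) (hmi : 0 < mi) (u : FermiSpace N L)
    (q : Mode N) :
    (Λ + kineticEnergy L mh mi q) * ‖amplitude (S u : WaveFn N L) q‖ ^ 2 =
      ‖amplitude (u : WaveFn N L) q‖ ^ 2 := by
  have h1 := h.weight_mul hmi u u q
  rw [Complex.conj_mul', Complex.conj_mul'] at h1
  exact_mod_cast h1

/-- The preimage under S is obtained by multiplying amplitudes by √(Λ + kinetic energy); this keeps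
them square summable exactly on the form domain, and antisymmetric. -/
theorem finiteKineticEnergy_iff (h : IsRealization mh mi U Λ S B) (hmi : 0 < mi)
    (ψ : FermiSpace N L) :
    FiniteKineticEnergy mh mi (ψ : WaveFn N L) ↔ ∃ v, S v = ψ := by
  constructor
  · intro hψ
    have h1 : Summable fun q : Mode N =>
        (Λ + kineticEnergy L mh mi q) * ‖amplitude (ψ : WaveFn N L) q‖ ^ 2 := by
      simpa only [add_mul] using
        ((summable_norm_sq_amplitude (ψ : WaveFn N L)).mul_left Λ).add hψ
    obtain ⟨v, hv⟩ := exists_amplitude_eq (L := L) (f := fun q : Mode N =>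
      ((Real.sqrt (Λ + kineticEnergy L mh mi q) : ℝ) : ℂ) * amplitude (ψ : WaveFn N L) q) (by
        convert h1 using 2 with q
        rw [norm_mul, mul_pow, Complex.norm_real, Real.norm_of_nonneg (Real.sqrt_nonneg _),
          Real.sq_sqrt (h.weight_pos hmi q).le])
    refine ⟨⟨v, (mem_fermiSpace_iff v).2 fun σ q => ?_⟩, fermi_ext fun q => ?_⟩
    · rw [hv, hv, kineticEnergy_permuteMode, (mem_fermiSpace_iff _).1 ψ.2 σ q]
      ring
    · rw [h.amplitude_S, hv, ← mul_assoc, ← Complex.ofReal_mul,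
        inv_mul_cancel₀ (Real.sqrt_pos.2 (h.weight_pos hmi q)).ne', Complex.ofReal_one, one_mul]
  · rintro ⟨v, rfl⟩
    have h1 := (summable_norm_sq_amplitude (v : WaveFn N L)).sub
      ((summable_norm_sq_amplitude (S v : WaveFn N L)).mul_left Λ)
    unfold FiniteKineticEnergy
    refine h1.congr fun q => ?_
    rw [← h.weight_mul_norm_sq hmi v q]
    ring

theorem kineticForm_eq (h : IsRealization mh mi U Λ S B) (hmi : 0 < mi) (u v : FermiSpace N L) :
    kineticForm mh mi (S u : WaveFn N L) (S v : WaveFn N L) =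
      inner ℂ u v - Λ * inner ℂ (S u) (S v) := by
  have h1 := (hasSum_amplitude (u : WaveFn N L) (v : WaveFn N L)).sub
    ((hasSum_amplitude (S u : WaveFn N L) (S v : WaveFn N L)).mul_left (Λ : ℂ))
  rw [fermi_inner, fermi_inner, ← h1.tsum_eq, kineticForm]
  refine tsum_congr fun q => ?_
  rw [← h.weight_mul hmi u v q]
  push_cast
  ring

theorem hamiltonianMaps_iff (h : IsRealization mh mi U Λ S B) (hmi : 0 < mi)
    (ψ χ : FermiSpace N L) : HamiltonianMaps mh mi U ψ χ ↔ FormMaps S B Λ ψ χ := by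
  have hform : ∀ u v : FermiSpace N L, kineticForm mh mi (S u : WaveFn N L) (S v : WaveFn N L) +
      potentialForm U (S u : WaveFn N L) (S v : WaveFn N L) =
      inner ℂ u v - Λ * inner ℂ (S u) (S v) + inner ℂ u (B v) := fun u v => by
    rw [h.kineticForm_eq hmi, ← h.inner_B]
  constructor
  · rintro ⟨h1, h2⟩
    obtain ⟨v, rfl⟩ := (h.finiteKineticEnergy_iff hmi ψ).1 h1
    exact ⟨v, rfl, (h.formPair.form_eq_iff Λ v χ).2 fun u => (hform u v).symm.trans
      (h2 (S u) ((h.finiteKineticEnergy_iff hmi _).2 ⟨u, rfl⟩))⟩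
  · rintro ⟨v, rfl, hv⟩
    refine ⟨(h.finiteKineticEnergy_iff hmi _).2 ⟨v, rfl⟩, fun φ hφ => ?_⟩
    obtain ⟨u, rfl⟩ := (h.finiteKineticEnergy_iff hmi φ).1 hφ
    exact (hform u v).trans ((h.formPair.form_eq_iff Λ v χ).1 hv u)

/-- The operator `S p̂ᵢ S` is bounded and gives the mean impurity momentum. -/
theorem exists_momentum_operator (h : IsRealization mh mi U Λ S B) (hmi : 0 < mi) :
    ∃ Q : FermiSpace N L →L[ℂ] FermiSpace N L, ∀ u,
      HasSum (fun q : Mode N => ringMomentum L q.2 * ‖amplitude (S u : WaveFn N L) q‖ ^ 2)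
        (inner ℂ u (Q u) : ℂ).re := by
  obtain ⟨Q, hQ, -⟩ := exists_diagonal_operator (L := L)
    (g := fun q : Mode N => ringMomentum L q.2 / (Λ + kineticEnergy L mh mi q))
    -- |p| ≤ 1 + p² ≤ (1 + 2mᵢ)(1 + p²/(2mᵢ)), and the last factor is below the weight by
    -- `le_weight`.
    (C := 1 + 2 * mi) (fun q => by
      have hw := h.weight_pos hmi q
      rw [abs_div, abs_of_pos hw, div_le_iff₀ hw]
      have h1 := h.le_weight q
      set p := ringMomentum L q.2
      have h2 : |p| ≤ 1 + p ^ 2 := by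
        rw [← sq_abs]
        nlinarith [sq_nonneg (|p| - 1), abs_nonneg p]
      have h3 : (1 + 2 * mi) * (1 + p ^ 2 / (2 * mi)) = 1 + 2 * mi + p ^ 2 / (2 * mi) + p ^ 2 := by
        field_simp
        ring
      have h4 : 0 ≤ p ^ 2 / (2 * mi) := by positivity
      have h5 := mul_le_mul_of_nonneg_left h1 (show 0 ≤ 1 + 2 * mi by linarith)
      linarith)
    (fun σ q => by rw [kineticEnergy_permuteMode]; rfl)
  refine ⟨Q, fun u => ?_⟩
  have h1 := Complex.reCLM.hasSum (hasSum_amplitude (u : WaveFn N L) (Q u : WaveFn N L))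
  refine (congrArg (fun f => HasSum f _) (funext fun q => ?_)).mpr h1
  rw [hQ, Complex.reCLM_apply, mul_left_comm, Complex.conj_mul', Complex.re_ofReal_mul]
  have h2 : ((‖amplitude (u : WaveFn N L) q‖ : ℂ) ^ 2).re = ‖amplitude (u : WaveFn N L) q‖ ^ 2 := by
    norm_cast
  rw [h2, ← h.weight_mul_norm_sq hmi u q]
  have := (h.weight_pos hmi q).ne'
  field_simp

theorem inMomentumDomain (h : IsRealization mh mi U Λ S B) (hmi : 0 < mi) (u : FermiSpace N L) :
    InMomentumDomain (S u : WaveFn N L) := by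
  refine Summable.of_nonneg_of_le (fun q => by positivity) (fun q => ?_)
    ((summable_norm_sq_amplitude (u : WaveFn N L)).mul_left (2 * mi))
  rw [← h.weight_mul_norm_sq hmi u q, ← mul_assoc]
  have h1 := h.le_weight q
  have h2 : ringMomentum L q.2 ^ 2 = 2 * mi * (ringMomentum L q.2 ^ 2 / (2 * mi)) := by
    field_simp
  refine mul_le_mul_of_nonneg_right ?_ (sq_nonneg _)
  rw [h2]
  exact mul_le_mul_of_nonneg_left (by linarith) (by linarith)

/-- Lower bound on the kinetic energy of states of given total momentum. -/
theorem kinetic_lower_bound (h : IsRealization mh mi U Λ S B) (hN : Odd N) (hmh : 0 < mh)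
    (hmi : 0 < mi) {j : ℤ} {u : FermiSpace N L} (hj : HasTotalMomentum j (S u : WaveFn N L))
    (hu : ‖S u‖ = 1) :
    ringMomentum L j ^ 2 / (2 * mi) + (criticalMomentum N L mh mi - ringMomentum L j) / mi *
      (ringMomentum L j - meanMomentum (S u : WaveFn N L)) ≤
      (kineticForm mh mi (S u : WaveFn N L) (S u : WaveFn N L)).re := by
  have hL : 0 < L := Fact.out
  obtain ⟨Q, hQ⟩ := h.exists_momentum_operator hmi
  have hm := hQ u
  rw [show (inner ℂ u (Q u) : ℂ).re = meanMomentum (S u : WaveFn N L) from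
    hm.tsum_eq.symm] at hm
  have hn : HasSum (fun q : Mode N => ‖amplitude (S u : WaveFn N L) q‖ ^ 2) 1 := by
    have := hasSum_norm_sq_amplitude (S u : WaveFn N L)
    rwa [show ‖(S u : WaveFn N L)‖ = 1 from hu, one_pow] at this
  have hk : HasSum (fun q : Mode N =>
      kineticEnergy L mh mi q * ‖amplitude (S u : WaveFn N L) q‖ ^ 2)
      (kineticForm mh mi (S u : WaveFn N L) (S u : WaveFn N L)).re := by
    have hs : Summable fun q : Mode N =>
        kineticEnergy L mh mi q * ‖amplitude (S u : WaveFn N L) q‖ ^ 2 :=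
      (h.finiteKineticEnergy_iff hmi _).2 ⟨u, rfl⟩
    have he : kineticForm mh mi (S u : WaveFn N L) (S u : WaveFn N L) =
        ((∑' q : Mode N, kineticEnergy L mh mi q * ‖amplitude (S u : WaveFn N L) q‖ ^ 2 : ℝ) : ℂ) := by
      rw [kineticForm, Complex.ofReal_tsum]
      refine tsum_congr fun q => ?_
      rw [Complex.conj_mul']
      push_cast
      rfl
    rw [he, Complex.ofReal_re]
    exact hs.hasSum
  set p₀ := ringMomentum L j
  set A := (criticalMomentum N L mh mi - p₀) / mi
  have hl := ((hn.mul_left (p₀ ^ 2 / (2 * mi))).add (((hn.mul_left p₀).sub hm).mul_left A))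
  rw [mul_one, mul_one] at hl
  refine hasSum_le (fun q => ?_) hl hk
  -- Only occupied modes count: these have total momentum j, and distinct host momenta by the Pauli
  -- principle, as the arithmetic bound requires.
  by_cases hq : amplitude (S u : WaveFn N L) q = 0
  · simp [hq]
  have hinj : Function.Injective q.1 := by
    by_contra hni
    exact hq (amplitude_eq_zero_of_not_injective (S u).2 hni)
  have hb := mul_le_mul_of_nonneg_right (linear_le_kineticEnergy hN hL hmh hmi hinj (hj q hq))
    (sq_nonneg ‖amplitude (S u : WaveFn N L) q‖)
  refine le_trans (le_of_eq ?_) hb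
  ring

/-- The evolution generated by the Hamiltonian exists and is unique. -/
theorem existsUnique_evolution (h : IsRealization mh mi U Λ S B) (hmi : 0 < mi) :
    ∃! W, IsEvolution (N := N) mh mi U W := by
  obtain ⟨s, b, E, hb⟩ := h.formPair.exists_diagonalization Λ
  obtain ⟨W, hW1, hW2, hW3⟩ := exists_diagonal_group b E
  have hev : IsEvolution (N := N) mh mi U W :=
    ⟨hW1, hW2, fun ψ χ =>
      ((h.hamiltonianMaps_iff hmi ψ χ).trans (hb ψ χ)).trans (hW3 ψ χ)⟩
  refine ⟨W, hev, fun W' hW' => ?_⟩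
  -- Any group with this generator must act on the eigenbasis by the same phases, which determines
  -- it.
  have heig : ∀ i, HamiltonianMaps mh mi U (b i) ((E i : ℂ) • b i) := fun i =>
    (h.hamiltonianMaps_iff hmi _ _).2 ((hb _ _).2 fun k => b.inner_smul_self E i k)
  refine group_ext b fun t i => ?_
  rw [group_apply_eigenvector hW'.add ((hW'.generator _ _).1 (heig i)),
    group_apply_eigenvector hev.add ((hev.generator _ _).1 (heig i))]

/-- The projection onto total momentum `2πj/L`, commuting with `S` and `B`. -/
theorem exists_sector_projection (h : IsRealization mh mi U Λ S B) (j : ℤ) :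
    ∃ P : FermiSpace N L →L[ℂ] FermiSpace N L,
      (∀ ψ : FermiSpace N L, HasTotalMomentum j (P ψ : WaveFn N L)) ∧
      (∀ ψ : FermiSpace N L, HasTotalMomentum j (ψ : WaveFn N L) → P ψ = ψ) ∧
      (∀ x y, (inner ℂ (P x) y : ℂ) = inner ℂ x (P y)) ∧
      (∀ x, P (S x) = S (P x)) ∧ ∀ x, P (B x) = B (P x) := by
  classical
  obtain ⟨P, hP, -⟩ := exists_diagonal_operator (L := L)
    (g := fun q : Mode N => if ∑ n, q.1 n + q.2 = j then 1 else 0) (C := 1)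
    (fun q => by split_ifs <;> simp)
    (fun σ q => by
      have : ∑ n, (permuteMode σ q).1 n + (permuteMode σ q).2 = ∑ n, q.1 n + q.2 := by
        simp only [permuteMode]
        rw [Equiv.sum_comp σ q.1]
      rw [this])
  have hsymm : ∀ x y, (inner ℂ (P x) y : ℂ) = inner ℂ x (P y) := fun x y => by
    rw [fermi_inner, fermi_inner]
    refine (hasSum_amplitude _ _).unique ?_
    convert hasSum_amplitude (x : WaveFn N L) (P y : WaveFn N L) using 2 with q
    rw [hP, hP, map_mul, Complex.conj_ofReal]
    ring
  have hPS : ∀ x, P (S x) = S (P x) := fun x => fermi_ext fun q => by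
    rw [hP, h.amplitude_S, h.amplitude_S, hP]
    ring
  refine ⟨P, fun ψ q hq => ?_, fun ψ hψ => fermi_ext fun q => ?_, hsymm, hPS, fun x => ?_⟩
  · by_contra hne
    exact hq (by rw [hP, if_neg hne]; simp)
  · rw [hP]
    split_ifs with hq
    · simp
    · by_cases h0 : amplitude (ψ : WaveFn N L) q = 0
      · simp [h0]
      · exact absurd (hψ q h0) hq
  -- Commutation with B, at the level of pair densities: projecting the left or the right argument
  -- gives the same Fourier coefficients, since momentum transfer preserves the sector.
  · refine ext_inner_left ℂ fun u => ?_
    rw [← hsymm, h.inner_B, h.inner_B, ← hPS, ← hPS]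
    unfold potentialForm
    refine Finset.sum_congr rfl fun n _ => ?_
    obtain ⟨ρ, hρ⟩ := h.exists_density n u (P x)
    rw [← hPS] at hρ
    rw [hρ.pairDensity_eq]
    have hρ' : IsPairDensity n (P (S u) : WaveFn N L) (S x : WaveFn N L) ρ := by
      refine isPairDensity_of_fourier fun m => ?_
      rw [← hρ (fourier m)]
      refine (hasSum_fourier_density n m _ _).unique ?_
      convert hasSum_fourier_density n m (S u : WaveFn N L) (P (S x) : WaveFn N L) using 2 with q
      rw [hP, hP, totalMomentum_shiftMode, map_mul, Complex.conj_ofReal]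
      ring
    rw [hρ'.pairDensity_eq]

end IsRealization

/-! ### Expansion in an invariant subspace with simple spectrum -/

namespace IsFormPair

variable {H : Type*} [NormedAddCommGroup H] [InnerProductSpace ℂ H] {S B : H →L[ℂ] H}
  {Λ : ℝ} {ι : Type*} {E : ι → ℝ} {v : ι → H}

theorem formMaps_eigen {ψ : H} {e : ℝ} (h : FormMaps S B Λ ψ ((e : ℂ) • ψ)) :
    ∃ x, S x = ψ ∧ x + B x = ((e + Λ : ℝ) : ℂ) • S (S x) := by
  obtain ⟨x, rfl, hx⟩ := h
  refine ⟨x, rfl, ?_⟩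
  rw [hx, ← add_smul, map_smul]
  push_cast
  rfl

/-- Evaluating the symmetric form on a pair of eigenvectors in both orders gives (Eᵢ - Eₖ)⟨Ψᵢ|Ψₖ⟩ =
0. -/
theorem orthonormal_eigenvectors (h : IsFormPair S B) (hE : Function.Injective E)
    (hv : ∀ i, v i + B (v i) = ((E i + Λ : ℝ) : ℂ) • S (S (v i))) (hn : ∀ i, ‖S (v i)‖ = 1) :
    Orthonormal ℂ fun i => S (v i) := by
  refine ⟨hn, fun i k hik => ?_⟩
  have h1 := h.eigen_form hv (v i) k
  have h2 := h.eigen_form hv (v k) i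
  rw [h.inner_add_swap, ← inner_conj_symm, h2, map_mul, inner_conj_symm, Complex.conj_ofReal] at h1
  have h3 : ((E i - E k : ℝ) : ℂ) * inner ℂ (S (v i)) (S (v k)) = 0 := by
    push_cast at h1 ⊢
    linear_combination h1
  rcases mul_eq_zero.1 h3 with h4 | h4
  · exact absurd (hE (sub_eq_zero.1 (by exact_mod_cast h4))) hik
  · exact h4

/-- If, up to scalars, the `S (v i)` are all eigenvectors in the range of a projection `P` commuting
with the form pair, then every finite-energy vector in the range of `P` expands in them, with
convergence in the form norm that is uniform along the time evolution. -/
theorem exists_expansion [CompleteSpace H] (h : IsFormPair S B)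
    (hv : ∀ i, v i + B (v i) = ((E i + Λ : ℝ) : ℂ) • S (S (v i)))
    (ho : Orthonormal ℂ fun i => S (v i)) {P : H →L[ℂ] H}
    (hP : ∀ x y, (inner ℂ (P x) y : ℂ) = inner ℂ x (P y)) (hPS : ∀ x, P (S x) = S (P x))
    (hPB : ∀ x, P (B x) = B (P x)) (hPv : ∀ i, P (S (v i)) = S (v i))
    (hall : ∀ (e : ℝ) (x : H), P x ≠ 0 → FormMaps S B Λ (P x) ((e : ℂ) • P x) →
      ∃ i, ∃ c : ℂ, P x = c • S (v i))
    {u₀ : H} (hu₀ : P (S u₀) = S u₀) :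
    ∃ u : ℝ → H, TendstoUniformly (fun (F : Finset ι) (t : ℝ) =>
      ∑ i ∈ F, Complex.exp (-(Complex.I * E i * t)) •
        ((inner ℂ (S (v i)) (S u₀) : ℂ) • v i)) u atTop ∧ u 0 = u₀ := by
  classical
  obtain ⟨u, hu⟩ := h.exists_evolution_series hv ho (h.summable_energy hv ho u₀)
  refine ⟨u, hu, h.injective_S ?_⟩
  have hs : HasSum (fun i => (inner ℂ (S (v i)) (S u₀) : ℂ) • S (v i)) (S (u 0)) := by
    have h1 : HasSum (fun i => Complex.exp (-(Complex.I * E i * (0 : ℝ))) •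
        ((inner ℂ (S (v i)) (S u₀) : ℂ) • v i)) (u 0) := hu.tendsto_at 0
    simpa using S.hasSum h1
  have hPu : P (S (u 0)) = S (u 0) := by
    have h1 := P.hasSum hs
    refine h1.unique ?_
    simpa [Function.comp_def, hPv] using hs
  have hk : ∀ k, (inner ℂ (S (v k)) (S (u 0)) : ℂ) = inner ℂ (S (v k)) (S u₀) := fun k => by
    have h1 := (innerSL ℂ (S (v k))).hasSum hs
    refine h1.unique ?_
    have h2 : (fun i => innerSL ℂ (S (v k)) ((inner ℂ (S (v i)) (S u₀) : ℂ) • S (v i))) =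
        fun i => if i = k then (inner ℂ (S (v k)) (S u₀) : ℂ) else 0 := by
      funext i
      rw [innerSL_apply_apply, inner_smul_right,
        orthonormal_iff_ite.1 ho k i]
      by_cases hik : i = k
      · subst hik; simp
      · simp [hik, Ne.symm hik]
    rw [h2]
    exact hasSum_ite_eq k _
  -- The sum S (u 0) and S u₀ have equal coefficients along every S (v k). To conclude equality they
  -- are compared on a full eigenbasis b, whose projections P (b i) are zero or multiples of some S
  -- (v k).
  obtain ⟨s, b, e, hb⟩ := h.exists_diagonalization Λ
  refine b.ext_inner fun i => ?_
  rw [← hPu, ← hu₀, ← hP, ← hP]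
  by_cases h0 : P (b i) = 0
  · rw [h0, inner_zero_left, inner_zero_left]
  obtain ⟨x, hx1, hx2⟩ := (hb _ _).2 fun k => b.inner_smul_self e i k
  obtain ⟨k, c, hc⟩ := hall (e i) (b i) h0 ⟨P x, by rw [← hPS, hx1], by
    rw [← hPB, ← map_add, hx2, hPS, map_add, map_smul, map_smul]⟩
  rw [hc, inner_smul_left, inner_smul_left, hk]

/-- Form-norm convergence allows the energy form to be applied term by term, so mean energy is
computed from the eigenstate weights without placing S u₀ in the operator domain. -/
theorem hasSum_energy (h : IsFormPair S B)
    (hv : ∀ i, v i + B (v i) = ((E i + Λ : ℝ) : ℂ) • S (S (v i))) {u₀ : H}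
    (hs : HasSum (fun i => (inner ℂ (S (v i)) (S u₀) : ℂ) • v i) u₀) :
    HasSum (fun i => ‖(inner ℂ (S (v i)) (S u₀) : ℂ)‖ ^ 2 * (E i + Λ))
      (inner ℂ u₀ (u₀ + B u₀) : ℂ).re := by
  have h1 := Complex.reCLM.hasSum ((innerSL ℂ (u₀ + B u₀)).hasSum hs)
  rw [innerSL_apply_apply, ← h.inner_add_swap] at h1
  refine (congrArg (fun f => HasSum f _) (funext fun i => ?_)).mpr h1
  have h2 : (inner ℂ (S (v i)) (S u₀) : ℂ) * (inner ℂ (u₀ + B u₀) (v i)) =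
      ((‖(inner ℂ (S (v i)) (S u₀) : ℂ)‖ ^ 2 * (E i + Λ) : ℝ) : ℂ) := by
    rw [← h.inner_add_swap, h.eigen_form hv, ← inner_conj_symm (S u₀)]
    push_cast
    rw [← Complex.mul_conj']
    ring
  rw [innerSL_apply_apply, inner_smul_right, h2,
    Complex.reCLM_apply, Complex.ofReal_re]

theorem hasSum_weight {u₀ : H} (hs : HasSum (fun i => (inner ℂ (S (v i)) (S u₀) : ℂ) • v i) u₀) :
    HasSum (fun i => ‖(inner ℂ (S (v i)) (S u₀) : ℂ)‖ ^ 2) (‖S u₀‖ ^ 2) := by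
  have h1 := Complex.reCLM.hasSum ((innerSL ℂ (S u₀)).hasSum (S.hasSum hs))
  rw [innerSL_apply_apply, inner_self_eq_norm_sq_to_K, Complex.reCLM_apply] at h1
  have h0 : ((‖S u₀‖ : ℂ) ^ 2).re = ‖S u₀‖ ^ 2 := by norm_cast
  refine (congrArg₂ (fun f a => HasSum f a) (funext fun i => ?_) h0.symm).mpr h1
  have h2 : (inner ℂ (S (v i)) (S u₀) : ℂ) * (inner ℂ (S u₀) (S (v i))) =
      ((‖(inner ℂ (S (v i)) (S u₀) : ℂ)‖ ^ 2 : ℝ) : ℂ) := by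
    rw [← inner_conj_symm (S u₀), Complex.mul_conj']
    push_cast
    rfl
  rw [map_smul,
    innerSL_apply_apply, inner_smul_right, h2, Complex.reCLM_apply, Complex.ofReal_re]

/-- The expectation values of a form-bounded observable in the eigenvectors are summable with the
weights of a finite-energy vector. -/
theorem summable_expectation (h : IsFormPair S B)
    (hv : ∀ i, v i + B (v i) = ((E i + Λ : ℝ) : ℂ) • S (S (v i)))
    (ho : Orthonormal ℂ fun i => S (v i)) (u₀ : H) (Q : H →L[ℂ] H) :
    Summable fun i => ((‖(inner ℂ (S (v i)) (S u₀) : ℂ)‖ ^ 2 : ℝ) : ℂ) *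
      (inner ℂ (v i) (Q (v i)) : ℂ) := by
  refine Summable.of_norm_bounded ((h.summable_energy hv ho u₀).mul_left (2 * ‖Q‖)) fun i => ?_
  have h1 : ‖(inner ℂ (v i) (Q (v i)) : ℂ)‖ ≤ 2 * ‖Q‖ * (E i + Λ) := by
    calc ‖(inner ℂ (v i) (Q (v i)) : ℂ)‖ ≤ ‖v i‖ * ‖Q (v i)‖ := norm_inner_le_norm _ _
      _ ≤ ‖v i‖ * (‖Q‖ * ‖v i‖) := by gcongr; exact Q.le_opNorm _
      _ = ‖Q‖ * ‖v i‖ ^ 2 := by ring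
      _ ≤ ‖Q‖ * (2 * (E i + Λ)) := by gcongr; exact h.norm_sq_le hv ho i
      _ = _ := by ring
  rw [norm_mul, Complex.norm_real, Real.norm_of_nonneg (sq_nonneg _)]
  calc _ ≤ ‖(inner ℂ (S (v i)) (S u₀) : ℂ)‖ ^ 2 * (2 * ‖Q‖ * (E i + Λ)) := by gcongr
    _ = _ := by ring

theorem summable_re_expectation (h : IsFormPair S B)
    (hv : ∀ i, v i + B (v i) = ((E i + Λ : ℝ) : ℂ) • S (S (v i)))
    (ho : Orthonormal ℂ fun i => S (v i)) (u₀ : H) (Q : H →L[ℂ] H) :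
    Summable fun i => ‖(inner ℂ (S (v i)) (S u₀) : ℂ)‖ ^ 2 * (inner ℂ (v i) (Q (v i)) : ℂ).re := by
  have h1 := Complex.reCLM.summable (h.summable_expectation hv ho u₀ Q)
  refine h1.congr fun i => ?_
  rw [Complex.reCLM_apply, Complex.re_ofReal_mul]

/-- Time average of a form-bounded observable along the evolution: the diagonal ensemble. -/
theorem tendsto_average (h : IsFormPair S B) (hE : Function.Injective E)
    (hv : ∀ i, v i + B (v i) = ((E i + Λ : ℝ) : ℂ) • S (S (v i)))
    (ho : Orthonormal ℂ fun i => S (v i)) {u₀ : H} {u : ℝ → H}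
    (hu : TendstoUniformly (fun (F : Finset ι) (t : ℝ) =>
      ∑ i ∈ F, Complex.exp (-(Complex.I * E i * t)) •
        ((inner ℂ (S (v i)) (S u₀) : ℂ) • v i)) u atTop) (Q : H →L[ℂ] H) :
    Continuous (fun s => (inner ℂ (u s) (Q (u s)) : ℂ).re) ∧
    Tendsto (fun t : ℝ => t⁻¹ * ∫ s in (0 : ℝ)..t, (inner ℂ (u s) (Q (u s)) : ℂ).re) atTop
      (𝓝 (∑' i, ‖(inner ℂ (S (v i)) (S u₀) : ℂ)‖ ^ 2 * (inner ℂ (v i) (Q (v i)) : ℂ).re)) := by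
  have hM := (h.summable_expectation hv ho u₀ Q).hasSum
  have hre := Complex.reCLM.hasSum hM
  have e1 : ∀ i, (inner ℂ ((inner ℂ (S (v i)) (S u₀) : ℂ) • v i)
      (Q ((inner ℂ (S (v i)) (S u₀) : ℂ) • v i)) : ℂ) =
      ((‖(inner ℂ (S (v i)) (S u₀) : ℂ)‖ ^ 2 : ℝ) : ℂ) * (inner ℂ (v i) (Q (v i)) : ℂ) := fun i => by
    rw [map_smul, inner_smul_left, inner_smul_right, ← mul_assoc, Complex.conj_mul']
    push_cast
    rfl
  obtain ⟨hc, ht⟩ := tendsto_average_of_tendstoUniformly hE Q hu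
    (by simpa only [e1] using hM)
  have hcq : Continuous fun s => (inner ℂ (u s) (Q (u s)) : ℂ) :=
    hc.inner (Q.continuous.comp hc)
  refine ⟨Complex.continuous_re.comp hcq, ?_⟩
  have ht2 := (Complex.continuous_re.tendsto _).comp ht
  have e2 : (∑' i, ((‖(inner ℂ (S (v i)) (S u₀) : ℂ)‖ ^ 2 : ℝ) : ℂ) *
      (inner ℂ (v i) (Q (v i)) : ℂ)).re =
      ∑' i, ‖(inner ℂ (S (v i)) (S u₀) : ℂ)‖ ^ 2 * (inner ℂ (v i) (Q (v i)) : ℂ).re := by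
    rw [← Complex.reCLM_apply, ← hre.tsum_eq]
    refine tsum_congr fun i => ?_
    rw [Complex.reCLM_apply, Complex.re_ofReal_mul]
  rw [e2] at ht2
  refine ht2.congr fun t => ?_
  have e3 := Complex.reCLM.intervalIntegral_comp_comm (hcq.intervalIntegrable (μ := volume) 0 t)
  simp only [Complex.reCLM_apply] at e3
  rw [Function.comp_apply, Complex.real_smul, Complex.re_ofReal_mul, e3]

/-- W t is known on each eigenvector, and both sides sum the same phase-rotated series. Thus the
evolved state stays in the range of S, with a preimage under control at every time. -/
theorem evolution_eq {u₀ : H} {u : ℝ → H}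
    (hu : TendstoUniformly (fun (F : Finset ι) (t : ℝ) =>
      ∑ i ∈ F, Complex.exp (-(Complex.I * E i * t)) •
        ((inner ℂ (S (v i)) (S u₀) : ℂ) • v i)) u atTop)
    (hs : HasSum (fun i => (inner ℂ (S (v i)) (S u₀) : ℂ) • v i) u₀)
    {W : ℝ → (H ≃ₗᵢ[ℂ] H)}
    (hW : ∀ t i, W t (S (v i)) = Complex.exp (-(Complex.I * E i * t)) • S (v i)) (t : ℝ) :
    W t (S u₀) = S (u t) := by
  have h1 : HasSum (fun i => Complex.exp (-(Complex.I * E i * t)) •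
      ((inner ℂ (S (v i)) (S u₀) : ℂ) • v i)) (u t) := hu.tendsto_at t
  have h2 := (W t).toContinuousLinearEquiv.toContinuousLinearMap.hasSum (S.hasSum hs)
  refine h2.unique ?_
  refine (congrArg (fun f => HasSum f _) (funext fun i => ?_)).mpr (S.hasSum h1)
  change W t (S _) = S _
  rw [map_smul, map_smul, hW, map_smul, map_smul, smul_comm]

end IsFormPair

/-- Averaging the bound `a + A (p - mᵢ) ≤ Eᵢ - Vᵢ` over a probability distribution. -/
theorem averaged_lower_bound {ι : Type*} {w E V m : ι → ℝ} {a A p V₀ Λ M : ℝ} (hA : 0 < A)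
    (hw0 : ∀ i, 0 ≤ w i) (hw : HasSum w 1)
    (hE : HasSum (fun i => w i * (E i + Λ)) (a + V₀ + Λ))
    (hV : Summable fun i => w i * V i) (hm : HasSum (fun i => w i * m i) M)
    (hb : ∀ i, a + A * (p - m i) ≤ E i - V i) :
    p - A⁻¹ * (V₀ - ∑' i, w i * V i) ≤ M := by
  have h1 := ((hw.mul_right (a + A * p)).sub (hm.mul_left A))
  have h2 := (hE.sub (hw.mul_right Λ)).sub hV.hasSum
  have h3 := hasSum_le (fun i => by
    have := mul_le_mul_of_nonneg_left (hb i) (hw0 i)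
    show w i * (a + A * p) - A * (w i * m i) ≤ w i * (E i + Λ) - w i * Λ - w i * V i
    linarith) h1 h2
  have h4 : A * (p - M) ≤ V₀ - ∑' i, w i * V i := by linarith
  have h5 := (le_inv_mul_iff₀ hA).2 h4
  linarith

section

/-! ### The infinite-time momentum -/

variable {N : ℕ} {L : ℝ} [Fact (0 < L)] {mh mi : ℝ} {U : SignedMeasure (AddCircle L)}

theorem norm_initialState (j : ℤ) : ‖initialState N L j‖ = 1 :=
  norm_fermiSeaWave j

/-- The kinetic energy of an eigenvector is its energy minus its potential energy. -/
theorem HamiltonianMaps.kineticForm_eigenvector {ψ : FermiSpace N L} {e : ℝ}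
    (h : HamiltonianMaps mh mi U ψ ((e : ℂ) • ψ)) (hn : ‖ψ‖ = 1) :
    (kineticForm mh mi (ψ : WaveFn N L) (ψ : WaveFn N L)).re =
      e - potentialEnergy U (ψ : WaveFn N L) := by
  have h1 := congrArg Complex.re (h.2 ψ h.1)
  have h2 : (inner ℂ ψ ((e : ℂ) • ψ) : ℂ) = e := by
    refine (inner_smul_right ψ ψ (e : ℂ)).trans ?_
    exact (congrArg ((e : ℂ) * ·) (inner_self_eq_one_of_norm_eq_one hn)).trans (mul_one _)
  rw [h2, Complex.add_re, Complex.ofReal_re] at h1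
  rw [potentialEnergy]
  linarith

/-- The form energy of the initial state. -/
theorem IsRealization.form_initialState {Λ : ℝ} {S B : FermiSpace N L →L[ℂ] FermiSpace N L}
    (h : IsRealization mh mi U Λ S B) (hN : Odd N) (hmi : 0 < mi) {j : ℤ} {u₀ : FermiSpace N L}
    (hu₀ : S u₀ = initialState N L j) :
    (inner ℂ u₀ (u₀ + B u₀) : ℂ).re = ringMomentum L j ^ 2 / (2 * mi) +
      potentialEnergy U (initialState N L j : WaveFn N L) + Λ := by
  have h1 := h.kineticForm_eq hmi u₀ u₀
  have h2 := h.inner_B u₀ u₀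
  rw [hu₀] at h1 h2
  have h3 : (inner ℂ (initialState N L j) (initialState N L j) : ℂ) = 1 :=
    inner_self_eq_one_of_norm_eq_one (norm_initialState j)
  have h4 : kineticForm mh mi (initialState N L j : WaveFn N L) (initialState N L j : WaveFn N L) =
      ((ringMomentum L j ^ 2 / (2 * mi) : ℝ) : ℂ) := kineticForm_fermiSeaWave hN mh mi j
  rw [h3, h4, mul_one] at h1
  have h5 : (inner ℂ u₀ (u₀ + B u₀) : ℂ) = inner ℂ u₀ u₀ + inner ℂ u₀ (B u₀) :=
    inner_add_right _ _ _
  have h6 : (inner ℂ u₀ u₀ : ℂ) = ((ringMomentum L j ^ 2 / (2 * mi) + Λ : ℝ) : ℂ) := by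
    push_cast at h1 ⊢
    linear_combination -h1
  rw [h5, h2, h6, Complex.add_re, Complex.ofReal_re, potentialEnergy]
  ring

/-- The infinite-time momentum exists; it is the average of the momenta of the eigenstates, and the
initial state is distributed over them with conserved mean energy. -/
theorem exists_infiniteTimeMomentum (hN : Odd N) (hmh : 0 < mh) (hmi : 0 < mi) {j₀ : ℤ}
    (hnd : NondegenerateSector N mh mi U j₀)
    {Ψ : sectorEigenvalues N mh mi U j₀ → FermiSpace N L}
    (hΨ : ∀ E, ‖Ψ E‖ = 1 ∧ IsSectorEigenvector mh mi U j₀ E (Ψ E))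
    (hlt : ringMomentum L j₀ < criticalMomentum N L mh mi)
    {W : ℝ → (FermiSpace N L ≃ₗᵢ[ℂ] FermiSpace N L)} (hW : IsEvolution mh mi U W) :
    ∃ pInf : ℝ, IsInfiniteTimeMomentum W (initialState N L j₀) pInf ∧
      (Summable fun E => ‖(inner ℂ (initialState N L j₀) (Ψ E) : ℂ)‖ ^ 2 *
        potentialEnergy U (Ψ E : WaveFn N L)) ∧
      ringMomentum L j₀ - mi / (criticalMomentum N L mh mi - ringMomentum L j₀) *
        (potentialEnergy U (initialState N L j₀ : WaveFn N L) -
          ∑' E, ‖(inner ℂ (initialState N L j₀) (Ψ E) : ℂ)‖ ^ 2 *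
            potentialEnergy U (Ψ E : WaveFn N L)) ≤ pInf := by
  obtain ⟨Λ, S, B, h⟩ := exists_realization (N := N) hmh hmi U
  have hev : ∀ E, ∃ v, S v = Ψ E ∧ v + B v = ((E.1 + Λ : ℝ) : ℂ) • S (S v) := fun E =>
    IsFormPair.formMaps_eigen ((h.hamiltonianMaps_iff hmi _ _).1 (hΨ E).2.2)
  choose v hvΨ hv using hev
  -- From here the eigenstates are carried by their preimages under S, where the form norm is the
  -- ambient norm.
  obtain rfl : Ψ = fun E => S (v E) := funext fun E => (hvΨ E).symm
  clear hvΨ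
  beta_reduce at hΨ ⊢
  have hE : Function.Injective (fun E : sectorEigenvalues N mh mi U j₀ => E.1) :=
    Subtype.val_injective
  have ho := h.formPair.orthonormal_eigenvectors hE hv fun E => (hΨ E).1
  obtain ⟨P, hP1, hP2, hPsymm, hPS, hPB⟩ := h.exists_sector_projection j₀
  obtain ⟨u₀, hu₀⟩ := (h.finiteKineticEnergy_iff hmi (initialState N L j₀)).1
    (finiteKineticEnergy_fermiSeaWave hN mh mi j₀)
  have hPu₀ : P (S u₀) = S u₀ := by
    rw [hu₀]
    exact hP2 _ (hasTotalMomentum_fermiSeaWave hN j₀)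
  -- Nondegeneracy enters here: the one chosen eigenvector per eigenvalue exhausts the sector.
  have hall : ∀ (e : ℝ) (x : FermiSpace N L), P x ≠ 0 → FormMaps S B Λ (P x) ((e : ℂ) • P x) →
      ∃ i, ∃ c : ℂ, P x = c • S (v i) := fun e x hx hm => by
    have hs : IsSectorEigenvector mh mi U j₀ e (P x) :=
      ⟨hP1 x, (h.hamiltonianMaps_iff hmi _ _).2 hm⟩
    let i : sectorEigenvalues N mh mi U j₀ := ⟨e, P x, hx, hs⟩
    have hne : S (v i) ≠ 0 := fun h0 => by
      have h1 := (hΨ i).1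
      rw [h0, norm_zero] at h1
      exact zero_ne_one h1
    exact ⟨i, hnd e (S (v i)) (P x) hne (hΨ i).2 hs⟩
  obtain ⟨u, hu, hu0⟩ := h.formPair.exists_expansion hv ho hPsymm hPS hPB
    (fun E => hP2 _ (hΨ E).2.1) hall hPu₀
  have hsum : HasSum (fun i => (inner ℂ (S (v i)) (S u₀) : ℂ) • v i) u₀ := by
    have h1 : HasSum (fun i : sectorEigenvalues N mh mi U j₀ =>
        Complex.exp (-(Complex.I * (i.1 : ℂ) * (0 : ℝ))) •
        ((inner ℂ (S (v i)) (S u₀) : ℂ) • v i)) (u 0) := hu.tendsto_at 0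
    rw [hu0] at h1
    refine (congrArg (fun f => HasSum f _) (funext fun i => ?_)).mpr h1
    rw [Complex.ofReal_zero, mul_zero, neg_zero, Complex.exp_zero]
    exact (one_smul ℂ _).symm
  have hWt : ∀ t, W t (initialState N L j₀) = S (u t) := fun t => by
    rw [← hu₀]
    exact IsFormPair.evolution_eq hu hsum (fun t i => group_apply_eigenvector hW.add
      ((hW.generator _ _).1 (hΨ i).2.2) t) t
  obtain ⟨Q, hQ⟩ := h.exists_momentum_operator hmi
  have hmean : ∀ x, meanMomentum (S x : WaveFn N L) = (inner ℂ x (Q x) : ℂ).re := fun x =>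
    (hQ x).tsum_eq
  obtain ⟨hcont, hlim⟩ := h.formPair.tendsto_average hE hv ho hu Q
  have hw : ∀ i, ‖(inner ℂ (initialState N L j₀) (S (v i)) : ℂ)‖ ^ 2 =
      ‖(inner ℂ (S (v i)) (S u₀) : ℂ)‖ ^ 2 := fun i => by
    rw [hu₀]
    exact congrArg (· ^ 2) (norm_inner_symm (𝕜 := ℂ) (initialState N L j₀) (S (v i)))
  have hpot : ∀ x, potentialEnergy U (S x : WaveFn N L) = (inner ℂ x (B x) : ℂ).re := fun x => by
    rw [h.inner_B, potentialEnergy]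
  have hV : Summable fun i => ‖(inner ℂ (S (v i)) (S u₀) : ℂ)‖ ^ 2 *
      potentialEnergy U (S (v i) : WaveFn N L) :=
    (h.formPair.summable_re_expectation hv ho u₀ B).congr fun i => by rw [hpot]
  refine ⟨∑' i, ‖(inner ℂ (S (v i)) (S u₀) : ℂ)‖ ^ 2 * (inner ℂ (v i) (Q (v i)) : ℂ).re,
    ⟨fun t => ?_, fun t => ?_, ?_⟩, ?_, ?_⟩
  · rw [hWt]
    exact h.inMomentumDomain hmi _
  · simp only [hWt, hmean]
    exact hcont.intervalIntegrable 0 t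
  · simp only [hWt, hmean]
    exact hlim
  · exact hV.congr fun i => by rw [hw]
  · have h1 := averaged_lower_bound
      (A := (criticalMomentum N L mh mi - ringMomentum L j₀) / mi) (p := ringMomentum L j₀)
      (a := ringMomentum L j₀ ^ 2 / (2 * mi))
      (w := fun i => ‖(inner ℂ (S (v i)) (S u₀) : ℂ)‖ ^ 2)
      (E := fun i => i.1) (V := fun i => potentialEnergy U (S (v i) : WaveFn N L))
      (m := fun i => (inner ℂ (v i) (Q (v i)) : ℂ).re) (Λ := Λ)
      (V₀ := potentialEnergy U (initialState N L j₀ : WaveFn N L))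
      (div_pos (sub_pos.2 hlt) hmi) (fun i => sq_nonneg _)
      (by
        have h2 := IsFormPair.hasSum_weight hsum
        rwa [hu₀, norm_initialState, one_pow, ← hu₀] at h2)
      (by
        have h2 := h.formPair.hasSum_energy hv hsum
        rwa [h.form_initialState hN hmi hu₀] at h2)
      hV (h.formPair.summable_re_expectation hv ho u₀ Q).hasSum
      -- The kinetic bound in an eigenstate, with the kinetic energy replaced by energy minus
      -- potential energy.
      (fun i => by
        have h2 := h.kinetic_lower_bound hN hmh hmi (hΨ i).2.1 (hΨ i).1
        rwa [(hΨ i).2.2.kineticForm_eigenvector (hΨ i).1, hmean] at h2)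
    rw [inv_div] at h1
    refine le_trans (le_of_eq ?_) h1
    simp only [hw]

theorem potentialEnergy_eigenvector_nonneg (hmh : 0 < mh) (hmi : 0 < mi) (hU : 0 ≤ U) {j : ℤ}
    {e : ℝ} {ψ : FermiSpace N L} (hψ : IsSectorEigenvector mh mi U j e ψ) :
    0 ≤ potentialEnergy U (ψ : WaveFn N L) := by
  obtain ⟨Λ, S, B, h⟩ := exists_realization (N := N) hmh hmi U
  obtain ⟨v, rfl⟩ := (h.finiteKineticEnergy_iff hmi ψ).1 hψ.2.1
  exact potentialEnergy_nonneg hU fun n => h.exists_density n v v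

end

end ImpurityGas

end


/-! ### Assembly of the theorem -/

theorem mainTheorem1 (N : ℕ) (hN : Odd N) (L : ℝ) [Fact (0 < L)] (mh mi : ℝ)
    (hmh : 0 < mh) (hmi : 0 < mi) (U : SignedMeasure (AddCircle L))
    (j₀ : ℤ) (p₀ : ℝ) (hp₀ : p₀ = ringMomentum L j₀)
    (hpos : 0 < p₀) (hlt : p₀ < criticalMomentum N L mh mi)
    (hnd : NondegenerateSector N mh mi U j₀)
    (Ψ : sectorEigenvalues N mh mi U j₀ → FermiSpace N L)
    (hΨ : ∀ E, ‖Ψ E‖ = 1 ∧ IsSectorEigenvector mh mi U j₀ E (Ψ E)) :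
    (∃! W, IsEvolution (N := N) mh mi U W) ∧
    ∀ W, IsEvolution (N := N) mh mi U W →
      ∃ pInf : ℝ, IsInfiniteTimeMomentum W (initialState N L j₀) pInf ∧
        (Summable fun E => ‖(inner ℂ (initialState N L j₀) (Ψ E) : ℂ)‖ ^ 2 *
          potentialEnergy U (Ψ E : WaveFn N L)) ∧
        pInf ≥ p₀ - mi / (criticalMomentum N L mh mi - p₀) *
          (potentialEnergy U (initialState N L j₀ : WaveFn N L) -
            ∑' E, ‖(inner ℂ (initialState N L j₀) (Ψ E) : ℂ)‖ ^ 2 *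
              potentialEnergy U (Ψ E : WaveFn N L)) ∧
        (0 ≤ U →
          pInf ≥ p₀ - mi * fermiMomentum N L * U Set.univ /
              (Real.pi * (criticalMomentum N L mh mi - p₀)) * ((N : ℝ) / ((N : ℝ) - 1))) := by
  have hL : 0 < L := Fact.out
  obtain ⟨Λ, S, B, h⟩ := exists_realization (N := N) hmh hmi U
  refine ⟨h.existsUnique_evolution hmi, fun W hW => ?_⟩
  subst hp₀
  obtain ⟨pInf, h1, h2, h3⟩ := exists_infiniteTimeMomentum hN hmh hmi hnd hΨ hlt hW
  refine ⟨pInf, h1, h2, h3, fun hU => ge_iff_le.2 (le_trans ?_ h3)⟩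
  have hsum : 0 ≤ ∑' E, ‖(inner ℂ (initialState N L j₀) (Ψ E) : ℂ)‖ ^ 2 *
      potentialEnergy U (Ψ E : WaveFn N L) :=
    tsum_nonneg fun E => mul_nonneg (sq_nonneg _)
      (potentialEnergy_eigenvector_nonneg hmh hmi hU (hΨ E).2)
  have hV₀ : potentialEnergy U (initialState N L j₀ : WaveFn N L) = N * U Set.univ / L :=
    potentialEnergy_fermiSeaWave U j₀
  have hd : 0 < criticalMomentum N L mh mi - ringMomentum L j₀ := sub_pos.2 hlt
  -- N = 1 would give k_F = 0, leaving no room for 0 < p₀ < q₀.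
  have hN1 : (N : ℝ) - 1 ≠ 0 := fun h0 => by
    have h4 : ringMomentum L j₀ < fermiMomentum N L := hlt.trans_le (min_le_left _ _)
    rw [fermiMomentum, h0, zero_div, mul_zero] at h4
    exact lt_asymm hpos h4
  -- Since k_F = π(N - 1)/L, the mean interaction N Ū/L equals (k_F Ū/π) · N/(N - 1).
  have he : mi * fermiMomentum N L * U Set.univ /
      (Real.pi * (criticalMomentum N L mh mi - ringMomentum L j₀)) * ((N : ℝ) / ((N : ℝ) - 1)) =
      mi / (criticalMomentum N L mh mi - ringMomentum L j₀) *
        potentialEnergy U (initialState N L j₀ : WaveFn N L) := by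
    have hpi := Real.pi_ne_zero
    rw [hV₀, fermiMomentum]
    field_simp
  rw [he]
  refine sub_le_sub_left (mul_le_mul_of_nonneg_left ?_ (div_pos hmi hd).le) _
  linarith
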